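/- Let $\mathbb S^1=\mathbb R/2\pi\mathbb Z$. Let $\Pi\colon G=\widetilde{SL(2,\mathbb R)}\to SL(2,\mathbb R)$ be the universal cover, and let $\phi_L\colon\mathbb R\times(0,\infty)\times\mathbb R\to G$ be the continuous map with $\phi_L(0,1,0)=I$ and \[(\Pi\circ\phi_L)(\theta,\rho,\nu)=\begin{pmatrix}\cos\theta&\sin\theta\\-\sin\theta&\cos\theta\end{pmatrix}\begin{pmatrix}\sqrt\rho&0\\0&1/\sqrt\rho\end{pmatrix}\begin{pmatrix}1&0\\ \nu/2&1\end{pmatrix}.\] Put $G_0=\phi_L\big((0,\infty)\times(0,\infty)\times\mathbb R\big)\subset G$. For $q\in L^\infty([0,2\pi])$ let $v_1,v_2$ be the solutions of $v''=qv$ on $[0,2\pi]$ with $v_1(0)=1$, $v_1'(0)=0$, $v_2(0)=0$, $v_2'(0)=1$, let $\tilde\Phi\colon[0,2\pi]\to G$ be the continuous map with $\tilde\Phi(0)=I$ and $\Pi(\tilde\Phi(t))=\begin{pmatrix}v_1(t)&v_2(t)\\v_1'(t)&v_2'(t)\end{pmatrix}$, and put $\mu(q)=\tilde\Phi(2\pi)$.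 For a smooth $f\colon\mathbb R\to\mathbb R$ and $u\in L^\infty([0,2\pi])$ put $\mu_f(u)=\mu(f'\circ u)$. A smooth function $g\colon\mathbb R\to\mathbb R$ is nowhere flat if there is a positive integer $r$ such that for every $x\in\mathbb R$ there is an integer $r'$ with $0<r'\le r$ and $g^{(r')}(x)\ne0$. A real separable Banach space $X$ is smoothing if there are continuous inclusions $C^\infty(\mathbb S^1)\subset X\subset L^\infty([0,2\pi])$, where $C^\infty(\mathbb S^1)$ carries its usual topology of uniform convergence of all derivatives. Let $X^*$ be the set of $u\in X$ that are not (almost everywhere equal to) a constant. Proposition. Let $X$ be a smoothing Banach space and let $f\colon\mathbb R\to\mathbb R$ be a smooth function such that $f'$ is nowhere flat and surjective. Then $\mu_f$ maps $X^*$ into $G_0$, and $\mu_f\colon X^*\to G_0$ is surjective. -/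

import Mathlib

open MeasureTheory Set Topology
open scoped ContDiff MatrixGroups unitInterval ENNReal

noncomputable section

namespace SturmLiouville

/-! ### The universal cover `Π : G → SL(2, ℝ)` -/

/-- Continuous paths in `SL(2, ℝ)`, parametrized by `[0, 1]`, that start at the identity, with the
compact-open topology. -/
abbrev BasedPath : Type := {γ : C(I, SL(2, ℝ)) // γ 0 = 1}

/-- Homotopy of based paths relative to both endpoints. -/
instance basedPathSetoid : Setoid BasedPath where
  r γ₀ γ₁ := ContinuousMap.HomotopicRel γ₀.1 γ₁.1 {0, 1}
  iseqv :=
    { refl := fun γ => ContinuousMap.HomotopicRel.refl γ.1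
      symm := fun h => ContinuousMap.HomotopicRel.symm h
      trans := fun h h' => ContinuousMap.HomotopicRel.trans h h' }

/-- The universal cover `G` of `SL(2, ℝ)`: the homotopy classes (with fixed endpoints) of paths that
start at the identity, with the quotient topology. Its elements are the *lifted matrices*. -/
def G : Type := Quotient basedPathSetoid

instance : TopologicalSpace G := inferInstanceAs (TopologicalSpace (Quotient basedPathSetoid))

/-- The class of a based path. -/
def toG (γ : BasedPath) : G := Quotient.mk basedPathSetoid γ

/-- The covering map `Π : G → SL(2, ℝ)`, sending the class of a path to its endpoint. -/
def proj : G → SL(2, ℝ) :=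
  Quotient.lift (fun γ : BasedPath => γ.1 1) fun _ _ h => h.fst_eq_snd (by simp)

/-- The identity of `G`: the class of the constant path. -/
def oneG : G := toG ⟨ContinuousMap.const I 1, rfl⟩

/-- The initial piece `r ↦ γ (s r)` of a based path `γ`, for `s ∈ [0, 1]`. -/
def initialPiece (γ : BasedPath) (s : I) : BasedPath :=
  ⟨⟨fun r => γ.1 (s * r), by fun_prop⟩, by simpa using γ.2⟩

/-- The lift to `G` of a based path `γ` in `SL(2, ℝ)`: the continuous path in `G` that starts at
the identity and projects to `γ`. Its value at `s` is the class of the piece of `γ` over `[0, s]`.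
-/
def liftPath (γ : BasedPath) : C(I, G) where
  toFun s := toG (initialPiece γ s)
  continuous_toFun := by
    refine continuous_quotient_mk'.comp (Continuous.subtype_mk ?_ _)
    refine ContinuousMap.continuous_of_continuous_uncurry _ ?_
    change Continuous fun p : I × I => γ.1 (p.1 * p.2)
    fun_prop

lemma proj_liftPath (γ : BasedPath) (s : I) : proj (liftPath γ s) = γ.1 s := by
  change γ.1 (s * 1) = γ.1 s
  rw [mul_one]

lemma liftPath_zero (γ : BasedPath) : liftPath γ 0 = oneG := by
  refine congrArg toG (Subtype.ext (ContinuousMap.ext fun r => ?_))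
  change γ.1 (0 * r) = 1
  rw [zero_mul, γ.2]

/-! ### The left Iwasawa decomposition and the set `G₀` -/

/-- The matrix `(Π ∘ φ_L)(θ, ρ, ν)` with its three factors (rotation, diagonal, unipotent). -/
def iwasawaMatrix (θ ρ ν : ℝ) : Matrix (Fin 2) (Fin 2) ℝ :=
  !![Real.cos θ, Real.sin θ; -Real.sin θ, Real.cos θ] *
    !![√ρ, 0; 0, 1 / √ρ] *
    !![1, 0; ν / 2, 1]

lemma det_iwasawaMatrix (θ ν : ℝ) {ρ : ℝ} (hρ : 0 < ρ) : (iwasawaMatrix θ ρ ν).det = 1 := by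
  have h : √ρ ≠ 0 := (Real.sqrt_pos.2 hρ).ne'
  have h2 := Real.sin_sq_add_cos_sq θ
  simp only [iwasawaMatrix, Matrix.det_mul, Matrix.det_fin_two_of]
  field_simp
  linarith

/-- The path `s ↦ (Π ∘ φ_L)(s θ, 1 + s (ρ - 1), s ν)` in `SL(2, ℝ)`, the image of the segment from
`(0, 1, 0)` to `(θ, ρ, ν)` in `ℝ × (0, ∞) × ℝ`. -/
def iwasawaPath (θ : ℝ) (ρ : Ioi (0 : ℝ)) (ν : ℝ) : BasedPath :=
  have hpos : ∀ s : I, 0 < 1 + (s : ℝ) * ((ρ : ℝ) - 1) := fun s => by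
    have h0 := s.2.1
    have h1 := s.2.2
    have hρ : (0 : ℝ) < ρ := ρ.2
    rcases h0.eq_or_lt with h | h
    · rw [← h]; norm_num
    · nlinarith [mul_pos h hρ]
  ⟨⟨fun s => ⟨iwasawaMatrix (s * θ) (1 + s * (ρ - 1)) (s * ν), det_iwasawaMatrix _ _ (hpos s)⟩, by
    refine Continuous.subtype_mk ?_ _
    have h : ∀ s : I, √(1 + (s : ℝ) * ((ρ : ℝ) - 1)) ≠ 0 := fun s => (Real.sqrt_pos.2 (hpos s)).ne'
    refine continuous_matrix fun i j => ?_
    fin_cases i <;> fin_cases j <;>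
      simp [iwasawaMatrix] <;> fun_prop (disch := exact h _)⟩, by
    refine Subtype.ext ?_
    change iwasawaMatrix ((0 : I) * θ) (1 + (0 : I) * ((ρ : ℝ) - 1)) ((0 : I) * ν) = 1
    simp [iwasawaMatrix, Matrix.one_fin_two]⟩

/-- The left Iwasawa diffeomorphism `φ_L : ℝ × (0, ∞) × ℝ → G`: the lift of `iwasawaMatrix` with
`φ_L(0, 1, 0) = 1`. Its value is the end of the lift of the image of the segment from `(0, 1, 0)`. -/
def phiL (θ : ℝ) (ρ : Ioi (0 : ℝ)) (ν : ℝ) : G := liftPath (iwasawaPath θ ρ ν) 1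

lemma proj_phiL (θ : ℝ) (ρ : Ioi (0 : ℝ)) (ν : ℝ) :
    (proj (phiL θ ρ ν) : Matrix (Fin 2) (Fin 2) ℝ) = iwasawaMatrix θ ρ ν := by
  rw [phiL, proj_liftPath]
  change iwasawaMatrix ((1 : I) * θ) (1 + (1 : I) * ((ρ : ℝ) - 1)) ((1 : I) * ν) = _
  simp

/-- `G₀ = φ_L((0, ∞) × (0, ∞) × ℝ)`. -/
def G₀ : Set G := {g | ∃ (θ : ℝ) (ρ : Ioi (0 : ℝ)) (ν : ℝ), 0 < θ ∧ g = phiL θ ρ ν}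

/-! ### The monodromy map -/

/-- `Φ = (v₁, v₂; v₁', v₂')` on `[0, 2π]`, where `v₁, v₂` are the fundamental solutions of
`v'' = q v` with `v₁(0) = 1, v₁'(0) = 0, v₂(0) = 0, v₂'(0) = 1`. As `q` is only integrable, the
equation is understood in the usual (Carathéodory) sense: `vᵢ` is `C¹` and `vᵢ'` is absolutely
continuous with derivative `q vᵢ` almost everywhere, that is, `vᵢ'` is an integral of `q vᵢ`. -/
structure IsFundamentalMatrix (q : ℝ → ℝ) (Φ : ℝ → SL(2, ℝ)) : Prop where
  integrable : IntegrableOn q (Icc 0 (2 * Real.pi))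
  continuousOn : ContinuousOn Φ (Icc 0 (2 * Real.pi))
  initial : Φ 0 = 1
  v₁_eq : ∀ t ∈ Icc 0 (2 * Real.pi), Φ t 0 0 = 1 + ∫ s in (0 : ℝ)..t, Φ s 1 0
  v₂_eq : ∀ t ∈ Icc 0 (2 * Real.pi), Φ t 0 1 = ∫ s in (0 : ℝ)..t, Φ s 1 1
  deriv_v₁_eq : ∀ t ∈ Icc 0 (2 * Real.pi), Φ t 1 0 = ∫ s in (0 : ℝ)..t, q s * Φ s 0 0
  deriv_v₂_eq : ∀ t ∈ Icc 0 (2 * Real.pi), Φ t 1 1 = 1 + ∫ s in (0 : ℝ)..t, q s * Φ s 0 1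

/-- A fundamental matrix as a path parametrized by `[0, 1]`: `s ↦ Φ (2 π s)`. -/
def IsFundamentalMatrix.path {q : ℝ → ℝ} {Φ : ℝ → SL(2, ℝ)} (h : IsFundamentalMatrix q Φ) :
    BasedPath :=
  ⟨⟨fun s => Φ (2 * Real.pi * s), by
    refine h.continuousOn.comp_continuous (by fun_prop) fun s => ?_
    have hs0 := s.2.1
    have hs1 := s.2.2
    have hpi := Real.pi_pos
    exact ⟨by positivity, by nlinarith⟩⟩, by simpa using h.initial⟩

open Classical in
/-- The monodromy `μ(q) = Φ̃(2π)`, where `Φ̃` is the lift to `G` of the fundamental matrix of `q`.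
(For `q` integrable on `[0, 2π]` the fundamental matrix exists and is unique on `[0, 2π]`; for other
`q` the value is the identity, which is not in `G₀`.) -/
def monodromy (q : ℝ → ℝ) : G :=
  if h : ∃ Φ : ℝ → SL(2, ℝ), IsFundamentalMatrix q Φ then liftPath h.choose_spec.path 1 else oneG

/-- The space `L^∞([0, 2π])`. -/
abbrev Linfty : Type := Lp ℝ ∞ (volume.restrict (Icc 0 (2 * Real.pi)))

/-- The nonlinear monodromy map `μ_f(u) = μ(f' ∘ u)` on `L^∞([0, 2π])`. -/
def nonlinearMonodromy (f : ℝ → ℝ) (u : Linfty) : G := monodromy fun t => deriv f (u t)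

/-! ### Nowhere flat functions and smoothing spaces -/

/-- A smooth function `g` is nowhere flat if for some `r` and all `x`, some derivative of `g` of
order between `1` and `r` does not vanish at `x`. -/
def NowhereFlat (g : ℝ → ℝ) : Prop :=
  ContDiff ℝ ∞ g ∧ ∃ r : ℕ, 0 < r ∧ ∀ x : ℝ, ∃ r' : ℕ, 0 < r' ∧ r' ≤ r ∧ iteratedDeriv r' g x ≠ 0

/-- `C^∞(𝕊¹)`, where `𝕊¹ = ℝ / 2πℤ`, as the smooth `2π`-periodic functions on `ℝ`. -/
structure SmoothCircle : Type where
  toFun : ℝ → ℝ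
  smooth : ContDiff ℝ ∞ toFun
  periodic : Function.Periodic toFun (2 * Real.pi)

/-- The usual topology of `C^∞(𝕊¹)`: uniform convergence of the derivatives of every order. -/
instance : TopologicalSpace SmoothCircle :=
  ⨅ k : ℕ, TopologicalSpace.induced
    (fun φ : SmoothCircle => UniformFun.ofFun (iteratedDeriv k φ.toFun)) inferInstance

/-- A real separable Banach space `X` is *smoothing*, where `incl` is the inclusion
`X ⊂ L^∞([0, 2π])`, if the inclusions `C^∞(𝕊¹) ⊂ X ⊂ L^∞([0, 2π])` are continuous.
(The map `j` is determined by `incl`, and it is linear and injective.) -/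
structure IsSmoothing (X : Type*) [NormedAddCommGroup X] [NormedSpace ℝ X] (incl : X →L[ℝ] Linfty) :
    Prop where
  complete : CompleteSpace X
  separable : TopologicalSpace.SeparableSpace X
  injective : Function.Injective incl
  smooth_incl : ∃ j : SmoothCircle → X, Continuous j ∧
    ∀ φ : SmoothCircle, incl (j φ) =ᵐ[volume.restrict (Icc 0 (2 * Real.pi))] φ.toFun

/-- `X^* = X ∖ {u constant}`. -/
def nonconstant {X : Type*} [NormedAddCommGroup X] [NormedSpace ℝ X] (incl : X →L[ℝ] Linfty) :
    Set X :=
  {u | ¬ ∃ c : ℝ, incl u =ᵐ[volume.restrict (Icc 0 (2 * Real.pi))] fun _ => c}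

end SturmLiouville

end

namespace SturmLiouville

/-! ### Lifted angles and homotopy classes of paths in `SL(2, ℝ)` -/

/-! In the Iwasawa coordinates `(θ, ρ, ν)`, with `θ` lifted to `ℝ`, the group becomes `ℝ × (0, ∞) ×
ℝ`, which is convex. So a homotopy class of based paths is determined by its endpoint and its total
column angle (`toG_eq_of_colAngle`). The angle of the first row is better adapted to the equation.
It stays within `π` of the column angle and has the same sign, so `G₀` consists of the classes with
positive total row angle. The first row of a fundamental matrix is `(v₁, v₂)` and its Wronskian is
1. Hence its angle has speed `1 / (v₁² + v₂²) > 0` (`polar_of_wronskian`), and every bounded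
potential has monodromy in `G₀`.

For surjectivity write `g = f'` and take a target matrix `T` with row angle `A > 0`. Choose a
regular point `x₀` of `g` with `g x₀ = κ² > (T 0 0)²`. Prescribing the row in polar form yields a
bounded potential `q`, equal to `κ²` near the left end, whose monodromy is exactly the target
(`exists_exact_potential`). Surjectivity of `g` lets `q` factor as `g ∘ x` with `x` bounded and
measurable. Mollifying `x` gives smooth periodic `u n` with `g ∘ u n → q` in `L¹`, still equal to
`x₀` on a subinterval, and the fundamental matrices converge.

The remaining error is a matrix near 1. It is removed exactly by a small smooth perturbation of the
constant potential `κ²` on that subinterval (`eventually_exists_correction`), which lifts to a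
perturbation of `u n` through a smooth local inverse of `g` at `x₀`. The endpoint is then `T`; the
row angle is within 1 of `A` and congruent to it modulo `2π`, hence equal to `A`. The function found
is not constant: a constant one would equal `x₀`, and then `T 0 0 = cosh (2πκ) > κ`. -/

/-- The continuous angle of a path in the punctured plane that starts at `(1, 0)`. -/
lemma exists_continuous_angle (x y : C(I, ℝ)) (h : ∀ s, 0 < x s ^ 2 + y s ^ 2) (hx : x 0 = 1)
    (hy : y 0 = 0) : ∃ a : C(I, ℝ), a 0 = 0 ∧ ∀ s, x s = √(x s ^ 2 + y s ^ 2) * Real.cos (a s) ∧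
      y s = √(x s ^ 2 + y s ^ 2) * Real.sin (a s) := by
  have hz : ∀ s, (x s : ℂ) + y s * Complex.I ≠ 0 := fun s h0 => by
    have h1 := congrArg Complex.re h0
    have h2 := congrArg Complex.im h0
    simp at h1 h2
    have := h s
    rw [h1, h2] at this
    norm_num at this
  let γ : C(I, {z : ℂ // z ≠ 0}) := ⟨fun s => ⟨(x s : ℂ) + y s * Complex.I, hz s⟩, by fun_prop⟩
  -- The lift through `exp` is a continuous logarithm: its imaginary part is the angle, and the
  -- exponential of its real part is the modulus.
  obtain ⟨Γ, hΓ, hΓ0⟩ := Complex.isCoveringMap_exp.exists_path_lifts γ 0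
    (Subtype.ext (by simp [γ, hx, hy]))
  refine ⟨⟨fun s => (Γ s).im, by fun_prop⟩, by simp [hΓ0], fun s => ?_⟩
  have hs : Complex.exp (Γ s) = (x s : ℂ) + y s * Complex.I := congrArg Subtype.val (congrFun hΓ s)
  have hre := congrArg Complex.re hs
  have him := congrArg Complex.im hs
  rw [Complex.exp_re] at hre
  rw [Complex.exp_im] at him
  simp at hre him
  have hr : √(x s ^ 2 + y s ^ 2) = Real.exp (Γ s).re := by
    rw [← hre, ← him, show (Real.exp (Γ s).re * Real.cos (Γ s).im) ^ 2 +
      (Real.exp (Γ s).re * Real.sin (Γ s).im) ^ 2 = Real.exp (Γ s).re ^ 2 by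
        linear_combination Real.exp (Γ s).re ^ 2 * Real.sin_sq_add_cos_sq (Γ s).im]
    exact Real.sqrt_sq (Real.exp_pos _).le
  rw [hr]
  exact ⟨hre.symm, him.symm⟩

lemma liftPath_one (γ : BasedPath) : liftPath γ 1 = toG γ := by
  refine congrArg toG (Subtype.ext (ContinuousMap.ext fun r => ?_))
  change γ.1 (1 * r) = γ.1 r
  rw [one_mul]

lemma det_eq (M : SL(2, ℝ)) : M 0 0 * M 1 1 - M 0 1 * M 1 0 = 1 := by
  rw [← Matrix.det_fin_two, M.det_coe]

lemma continuous_entry (i j : Fin 2) : Continuous fun M : SL(2, ℝ) => M i j :=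
  (continuous_subtype_val : Continuous fun M : SL(2, ℝ) => M.1).matrix_elem i j

/-- The entry `γᵢⱼ` of a based path. -/
def BasedPath.entry (γ : BasedPath) (i j : Fin 2) : C(I, ℝ) :=
  ⟨fun s => γ.1 s i j, (continuous_entry i j).comp γ.1.continuous⟩

lemma BasedPath.entry_zero (γ : BasedPath) (i j : Fin 2) :
    γ.entry i j 0 = (1 : Matrix (Fin 2) (Fin 2) ℝ) i j := by
  change γ.1 0 i j = _
  rw [γ.2]; rfl

lemma row_sq_pos (M : SL(2, ℝ)) : 0 < M 0 0 ^ 2 + M 0 1 ^ 2 := by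
  have h := det_eq M
  by_contra! hn
  have h0 : M 0 0 = 0 := by nlinarith [sq_nonneg (M 0 0), sq_nonneg (M 0 1)]
  have h1 : M 0 1 = 0 := by nlinarith [sq_nonneg (M 0 0), sq_nonneg (M 0 1)]
  rw [h0, h1] at h
  norm_num at h

lemma col_sq_pos (M : SL(2, ℝ)) : 0 < M 1 1 ^ 2 + M 0 1 ^ 2 := by
  have h := det_eq M
  by_contra! hn
  have h0 : M 1 1 = 0 := by nlinarith [sq_nonneg (M 1 1), sq_nonneg (M 0 1)]
  have h1 : M 0 1 = 0 := by nlinarith [sq_nonneg (M 1 1), sq_nonneg (M 0 1)]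
  rw [h0, h1] at h
  norm_num at h

/-- `a` is the continuous angle of the first row of the path `γ`. -/
structure IsRowAngle (γ : BasedPath) (a : C(I, ℝ)) : Prop where
  zero : a 0 = 0
  cos_eq : ∀ s, γ.1 s 0 0 = √(γ.1 s 0 0 ^ 2 + γ.1 s 0 1 ^ 2) * Real.cos (a s)
  sin_eq : ∀ s, γ.1 s 0 1 = √(γ.1 s 0 0 ^ 2 + γ.1 s 0 1 ^ 2) * Real.sin (a s)

/-- `θ` is the continuous angle of the second column of the path `γ`, measured from the second
axis. -/
structure IsColAngle (γ : BasedPath) (θ : C(I, ℝ)) : Prop where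
  zero : θ 0 = 0
  cos_eq : ∀ s, γ.1 s 1 1 = √(γ.1 s 1 1 ^ 2 + γ.1 s 0 1 ^ 2) * Real.cos (θ s)
  sin_eq : ∀ s, γ.1 s 0 1 = √(γ.1 s 1 1 ^ 2 + γ.1 s 0 1 ^ 2) * Real.sin (θ s)

lemma exists_isRowAngle (γ : BasedPath) : ∃ a, IsRowAngle γ a := by
  obtain ⟨a, h0, h⟩ := exists_continuous_angle (γ.entry 0 0) (γ.entry 0 1)
    (fun s => row_sq_pos (γ.1 s)) (by simp [γ.entry_zero]) (by simp [γ.entry_zero])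
  exact ⟨a, h0, fun s => (h s).1, fun s => (h s).2⟩

lemma exists_isColAngle (γ : BasedPath) : ∃ θ, IsColAngle γ θ := by
  obtain ⟨a, h0, h⟩ := exists_continuous_angle (γ.entry 1 1) (γ.entry 0 1)
    (fun s => col_sq_pos (γ.1 s)) (by simp [γ.entry_zero]) (by simp [γ.entry_zero])
  exact ⟨a, h0, fun s => (h s).1, fun s => (h s).2⟩

/-- The coordinate `ρ` of a matrix. -/
noncomputable def rhoCoord (M : SL(2, ℝ)) : ℝ := 1 / (M 1 1 ^ 2 + M 0 1 ^ 2)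

/-- The coordinate `ν` of a matrix. -/
noncomputable def nuCoord (M : SL(2, ℝ)) : ℝ :=
  2 * (M 0 0 * M 0 1 + M 1 0 * M 1 1) / (M 1 1 ^ 2 + M 0 1 ^ 2)

lemma rhoCoord_pos (M : SL(2, ℝ)) : 0 < rhoCoord M := one_div_pos.2 (col_sq_pos M)

/-- The second column of the Iwasawa product is `(sin θ, cos θ) / √ρ`, which fixes `θ` modulo `2π`
and `ρ`. The inner product of the two columns is `ν / (2ρ)`, which fixes `ν`. The determinant
supplies the rest. -/
lemma eq_iwasawaMatrix (M : SL(2, ℝ)) {θ : ℝ}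
    (hc : M 1 1 = √(M 1 1 ^ 2 + M 0 1 ^ 2) * Real.cos θ)
    (hs : M 0 1 = √(M 1 1 ^ 2 + M 0 1 ^ 2) * Real.sin θ) :
    (M : Matrix (Fin 2) (Fin 2) ℝ) = iwasawaMatrix θ (rhoCoord M) (nuCoord M) := by
  have hp := col_sq_pos M
  have hd := det_eq M
  have hr : 0 < √(M 1 1 ^ 2 + M 0 1 ^ 2) := Real.sqrt_pos.2 hp
  have hr2 : √(M 1 1 ^ 2 + M 0 1 ^ 2) ^ 2 = M 1 1 ^ 2 + M 0 1 ^ 2 := Real.sq_sqrt hp.le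
  have h1 : √(rhoCoord M) = 1 / √(M 1 1 ^ 2 + M 0 1 ^ 2) := by
    rw [rhoCoord, Real.sqrt_div zero_le_one, Real.sqrt_one]
  have h2 : nuCoord M = 2 * (M 0 0 * M 0 1 + M 1 0 * M 1 1) / √(M 1 1 ^ 2 + M 0 1 ^ 2) ^ 2 := by
    rw [nuCoord, hr2]
  set r := √(M 1 1 ^ 2 + M 0 1 ^ 2)
  have hcos : Real.cos θ = M 1 1 / r := by rw [hc]; field_simp
  have hsin : Real.sin θ = M 0 1 / r := by rw [hs]; field_simp
  rw [iwasawaMatrix, h1, h2, hcos, hsin]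
  ext i j
  fin_cases i <;> fin_cases j <;> simp [Matrix.mul_apply, Fin.sum_univ_two] <;> field_simp
  · rw [mul_comm, ← sub_eq_zero]; linear_combination (M 1 1) * hd + M 0 0 * (hr2)
  · linear_combination (- M 0 1) * hd + M 1 0 * (hr2)

lemma continuous_iwasawaMatrix {Y : Type*} [TopologicalSpace Y] {θ ρ ν : Y → ℝ} (hθ : Continuous θ)
    (hρ : Continuous ρ) (hν : Continuous ν) (hpos : ∀ y, 0 < ρ y) :
    Continuous fun y =>
      (⟨iwasawaMatrix (θ y) (ρ y) (ν y), det_iwasawaMatrix _ _ (hpos y)⟩ : SL(2, ℝ)) := by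
  refine Continuous.subtype_mk ?_ _
  have h : ∀ y, √(ρ y) ≠ 0 := fun y => (Real.sqrt_pos.2 (hpos y)).ne'
  have hi : Continuous fun y => (√(ρ y))⁻¹ := by fun_prop (disch := exact h _)
  refine continuous_matrix fun i j => ?_
  fin_cases i <;> fin_cases j <;> simp [iwasawaMatrix] <;> fun_prop

/-- Based paths with the same endpoint and the same total column angle are homotopic. -/
lemma toG_eq_of_colAngle {γ₀ γ₁ : BasedPath} {θ₀ θ₁ : C(I, ℝ)} (h₀ : IsColAngle γ₀ θ₀)
    (h₁ : IsColAngle γ₁ θ₁) (he : γ₀.1 1 = γ₁.1 1) (hθ : θ₀ 1 = θ₁ 1) : toG γ₀ = toG γ₁ := by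
  refine Quotient.sound (s := basedPathSetoid) ?_
  have hpos : ∀ (t s : I), 0 < (1 - (t : ℝ)) * rhoCoord (γ₀.1 s) + t * rhoCoord (γ₁.1 s) := by
    intro t s
    have h0 := t.2.1
    have h1 := t.2.2
    have p0 := rhoCoord_pos (γ₀.1 s)
    have p1 := rhoCoord_pos (γ₁.1 s)
    rcases h0.eq_or_lt with h | h
    · rw [← h]; simpa using p0
    · have := mul_pos h p1
      have := mul_nonneg (sub_nonneg.2 h1) p0.le
      linarith
  have hρ : ∀ γ : BasedPath, Continuous fun s => rhoCoord (γ.1 s) := fun γ =>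
    Continuous.div continuous_const
      (((γ.entry 1 1).continuous.pow 2).add ((γ.entry 0 1).continuous.pow 2))
      fun s => (col_sq_pos (γ.1 s)).ne'
  have hν : ∀ γ : BasedPath, Continuous fun s => nuCoord (γ.1 s) := fun γ =>
    Continuous.div (continuous_const.mul
      (((γ.entry 0 0).continuous.mul (γ.entry 0 1).continuous).add
        ((γ.entry 1 0).continuous.mul (γ.entry 1 1).continuous)))
      (((γ.entry 1 1).continuous.pow 2).add ((γ.entry 0 1).continuous.pow 2))
      fun s => (col_sq_pos (γ.1 s)).ne'
  have hρ0 := hρ γ₀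
  have hρ1 := hρ γ₁
  have hν0 := hν γ₀
  have hν1 := hν γ₁
  have c0 := hρ0.comp (continuous_snd (X := I) (Y := I))
  have c1 := hρ1.comp (continuous_snd (X := I) (Y := I))
  have c2 := hν0.comp (continuous_snd (X := I) (Y := I))
  have c3 := hν1.comp (continuous_snd (X := I) (Y := I))
  simp only [Function.comp_def] at c0 c1 c2 c3
  have hθc : Continuous fun p : I × I => (1 - (p.1 : ℝ)) * θ₀ p.2 + p.1 * θ₁ p.2 := by fun_prop
  have hρc : Continuous fun p : I × I =>
    (1 - (p.1 : ℝ)) * rhoCoord (γ₀.1 p.2) + p.1 * rhoCoord (γ₁.1 p.2) := by fun_prop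
  have hνc : Continuous fun p : I × I =>
    (1 - (p.1 : ℝ)) * nuCoord (γ₀.1 p.2) + p.1 * nuCoord (γ₁.1 p.2) := by fun_prop
  -- The homotopy is the straight line in the coordinates `(θ, ρ, ν)`.
  obtain ⟨F, hF, hFv⟩ : ∃ F : I × I → SL(2, ℝ), Continuous F ∧ ∀ p, (F p).1 =
      iwasawaMatrix ((1 - (p.1 : ℝ)) * θ₀ p.2 + p.1 * θ₁ p.2)
      ((1 - (p.1 : ℝ)) * rhoCoord (γ₀.1 p.2) + p.1 * rhoCoord (γ₁.1 p.2))
      ((1 - (p.1 : ℝ)) * nuCoord (γ₀.1 p.2) + p.1 * nuCoord (γ₁.1 p.2)) :=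
    ⟨_, continuous_iwasawaMatrix hθc hρc hνc fun p => hpos p.1 p.2, fun p => rfl⟩
  have hF0 : ∀ s, F (0, s) = γ₀.1 s := fun s => by
    refine Subtype.ext ?_
    rw [eq_iwasawaMatrix (γ₀.1 s) (h₀.cos_eq s) (h₀.sin_eq s)]
    simp [hFv]
  have hF1 : ∀ s, F (1, s) = γ₁.1 s := fun s => by
    refine Subtype.ext ?_
    rw [eq_iwasawaMatrix (γ₁.1 s) (h₁.cos_eq s) (h₁.sin_eq s)]
    simp [hFv]
  refine ⟨⟨⟨⟨F, hF⟩, hF0, hF1⟩, ?_⟩⟩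
  intro t s hs
  change F (t, s) = γ₀.1 s
  -- At either end the two paths have the same coordinates, so the segment between them is a point
  -- and the homotopy is relative to the endpoints.
  have key : θ₀ s = θ₁ s ∧ γ₀.1 s = γ₁.1 s := by
    rcases hs with rfl | rfl
    · exact ⟨by rw [h₀.zero, h₁.zero], by rw [γ₀.2, γ₁.2]⟩
    · exact ⟨hθ, he⟩
  rw [← hF0 s]
  refine Subtype.ext ?_
  rw [hFv, hFv]
  simp only [key.1, key.2]
  congr 1 <;> simp <;> ring

/-- The row angle and the column angle of a path differ by less than `π`. -/
lemma abs_rowAngle_sub_colAngle_lt {γ : BasedPath} {a θ : C(I, ℝ)} (ha : IsRowAngle γ a)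
    (hθ : IsColAngle γ θ) (s : I) : |a s - θ s| < Real.pi := by
  -- Both angles have a sine proportional to the shared entry `γ 0 1`. If they were antipodal, this
  -- entry would vanish and the diagonal entries would have product at most 0, against determinant
  -- 1.
  have hne : ∀ s, |a s - θ s| ≠ Real.pi := by
    intro s hs
    have hR : 0 < √(γ.1 s 0 0 ^ 2 + γ.1 s 0 1 ^ 2) := Real.sqrt_pos.2 (row_sq_pos _)
    have hr : 0 < √(γ.1 s 1 1 ^ 2 + γ.1 s 0 1 ^ 2) := Real.sqrt_pos.2 (col_sq_pos _)
    have hd := det_eq (γ.1 s)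
    have e1 := ha.cos_eq s
    have e2 := ha.sin_eq s
    have e3 := hθ.cos_eq s
    have e4 := hθ.sin_eq s
    set R := √(γ.1 s 0 0 ^ 2 + γ.1 s 0 1 ^ 2)
    set r := √(γ.1 s 1 1 ^ 2 + γ.1 s 0 1 ^ 2)
    have hcs : Real.cos (a s) = -Real.cos (θ s) ∧ Real.sin (a s) = -Real.sin (θ s) := by
      rcases (abs_eq Real.pi_pos.le).1 hs with h | h
      · rw [show a s = θ s + Real.pi by linarith]
        exact ⟨Real.cos_add_pi _, Real.sin_add_pi _⟩
      · rw [show a s = θ s - Real.pi by linarith]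
        exact ⟨Real.cos_sub_pi _, Real.sin_sub_pi _⟩
    have h0 : Real.sin (θ s) = 0 := by
      have : (R + r) * Real.sin (θ s) = 0 := by
        rw [hcs.2] at e2
        linarith
      rcases mul_eq_zero.1 this with h | h
      · linarith
      · exact h
    rw [h0, mul_zero] at e4
    rw [hcs.1] at e1
    rw [e4, e1, e3] at hd
    nlinarith [mul_pos hR hr, sq_nonneg (Real.cos (θ s)), mul_nonneg (mul_pos hR hr).le (sq_nonneg (Real.cos (θ s)))]
  by_contra! hs
  have hcont : Continuous fun s => |a s - θ s| := by fun_prop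
  obtain ⟨t, ht⟩ := mem_range_of_exists_le_of_exists_ge hcont
    ⟨0, by rw [ha.zero, hθ.zero]; simpa using Real.pi_pos.le⟩ ⟨s, hs⟩
  exact hne t ht

/-- The row angle at the end of a path is positive if and only if the column angle is. -/
lemma rowAngle_pos_iff {γ : BasedPath} {a θ : C(I, ℝ)} (ha : IsRowAngle γ a)
    (hθ : IsColAngle γ θ) (s : I) : 0 < a s ↔ 0 < θ s := by
  have hR : 0 < √(γ.1 s 0 0 ^ 2 + γ.1 s 0 1 ^ 2) := Real.sqrt_pos.2 (row_sq_pos _)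
  have hr : 0 < √(γ.1 s 1 1 ^ 2 + γ.1 s 0 1 ^ 2) := Real.sqrt_pos.2 (col_sq_pos _)
  have hlt := abs_lt.1 (abs_rowAngle_sub_colAngle_lt ha hθ s)
  have e := (ha.sin_eq s).symm.trans (hθ.sin_eq s)
  -- If `y ≤ 0 < x` and `x - y < π`, then `x` lies in `(0, π)` and `y` in `(-π, 0]`, so the sines
  -- cannot agree up to positive factors.
  have key : ∀ {x y R r : ℝ}, 0 < R → 0 < r → R * Real.sin x = r * Real.sin y → x - y < Real.pi →
      0 < x → 0 < y := by
    intro x y R r hR hr h hxy hx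
    by_contra! hy
    have h1 : 0 < Real.sin x := Real.sin_pos_of_pos_of_lt_pi hx (by linarith)
    have h2 : Real.sin y ≤ 0 := Real.sin_nonpos_of_nonpos_of_neg_pi_le hy (by linarith)
    nlinarith [mul_pos hR h1]
  exact ⟨key hR hr e (by linarith), key hr hR e.symm (by linarith)⟩

/-- Based paths with the same endpoint and the same total row angle are homotopic. -/
lemma toG_eq_of_rowAngle {γ₀ γ₁ : BasedPath} {a₀ a₁ : C(I, ℝ)} (h₀ : IsRowAngle γ₀ a₀)
    (h₁ : IsRowAngle γ₁ a₁) (he : γ₀.1 1 = γ₁.1 1) (ha : a₀ 1 = a₁ 1) : toG γ₀ = toG γ₁ := by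
  obtain ⟨θ₀, hθ₀⟩ := exists_isColAngle γ₀
  obtain ⟨θ₁, hθ₁⟩ := exists_isColAngle γ₁
  refine toG_eq_of_colAngle hθ₀ hθ₁ he ?_
  have l0 := abs_lt.1 (abs_rowAngle_sub_colAngle_lt h₀ hθ₀ 1)
  have l1 := abs_lt.1 (abs_rowAngle_sub_colAngle_lt h₁ hθ₁ 1)
  have hr : √(γ₁.1 1 1 1 ^ 2 + γ₁.1 1 0 1 ^ 2) ≠ 0 := (Real.sqrt_pos.2 (col_sq_pos _)).ne'
  have e1 := hθ₀.cos_eq 1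
  have e2 := hθ₀.sin_eq 1
  have hcos : Real.cos (θ₀ 1) = Real.cos (θ₁ 1) := by
    rw [he] at e1; exact mul_left_cancel₀ hr (e1.symm.trans (hθ₁.cos_eq 1))
  have hsin : Real.sin (θ₀ 1) = Real.sin (θ₁ 1) := by
    rw [he] at e2; exact mul_left_cancel₀ hr (e2.symm.trans (hθ₁.sin_eq 1))
  -- The common endpoint fixes the column angles modulo `2π`. Both are within `π` of the same row
  -- angle, so they differ by less than `2π`.
  have h1 : Real.cos (θ₀ 1 - θ₁ 1) = 1 := by
    rw [Real.cos_sub, hcos, hsin]; linear_combination Real.sin_sq_add_cos_sq (θ₁ 1)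
  have := (Real.cos_eq_one_iff_of_lt_of_lt (by linarith) (by linarith)).1 h1
  linarith

/-- The angle `s ↦ s θ` is the column angle of the path that defines `φ_L(θ, ρ, ν)`. -/
lemma isColAngle_iwasawaPath (θ : ℝ) (ρ : Ioi (0 : ℝ)) (ν : ℝ) :
    IsColAngle (iwasawaPath θ ρ ν) ⟨fun s => s * θ, by fun_prop⟩ := by
  have key : ∀ s : I, 0 < 1 + (s : ℝ) * ((ρ : ℝ) - 1) := fun s => by
    have h0 := s.2.1
    have h1 := s.2.2
    have hρ : (0 : ℝ) < ρ := ρ.2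
    rcases h0.eq_or_lt with h | h
    · rw [← h]; norm_num
    · nlinarith [mul_pos h hρ]
  have e1 : ∀ s : I, (iwasawaPath θ ρ ν).1 s 1 1 =
      1 / √(1 + (s : ℝ) * ((ρ : ℝ) - 1)) * Real.cos (s * θ) := fun s => by
    change iwasawaMatrix (s * θ) (1 + s * (ρ - 1)) (s * ν) 1 1 = _
    simp [iwasawaMatrix]; ring
  have e2 : ∀ s : I, (iwasawaPath θ ρ ν).1 s 0 1 =
      1 / √(1 + (s : ℝ) * ((ρ : ℝ) - 1)) * Real.sin (s * θ) := fun s => by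
    change iwasawaMatrix (s * θ) (1 + s * (ρ - 1)) (s * ν) 0 1 = _
    simp [iwasawaMatrix]; ring
  have e3 : ∀ s : I, √((iwasawaPath θ ρ ν).1 s 1 1 ^ 2 + (iwasawaPath θ ρ ν).1 s 0 1 ^ 2) =
      1 / √(1 + (s : ℝ) * ((ρ : ℝ) - 1)) := fun s => by
    have hp : 0 ≤ 1 / √(1 + (s : ℝ) * ((ρ : ℝ) - 1)) := by positivity
    rw [e1, e2]
    nth_rewrite 3 [← Real.sqrt_sq hp]
    congr 1
    linear_combination (1 / √(1 + (s : ℝ) * ((ρ : ℝ) - 1))) ^ 2 * Real.sin_sq_add_cos_sq (s * θ)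
  refine ⟨by simp, fun s => ?_, fun s => ?_⟩
  · rw [e3, e1]; rfl
  · rw [e3, e2]; rfl

/-- `G₀` is defined through the column angle; agreement of signs allows it to be tested on the row
angle, which is the one the differential equation controls. -/
lemma mem_G₀_of_rowAngle_pos {γ : BasedPath} {a : C(I, ℝ)} (ha : IsRowAngle γ a) (h : 0 < a 1) :
    toG γ ∈ G₀ := by
  obtain ⟨θ, hθ⟩ := exists_isColAngle γ
  refine ⟨θ 1, ⟨rhoCoord (γ.1 1), rhoCoord_pos _⟩, nuCoord (γ.1 1),
    (rowAngle_pos_iff ha hθ 1).1 h, ?_⟩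
  rw [phiL, liftPath_one]
  refine toG_eq_of_colAngle hθ (isColAngle_iwasawaPath _ _ _) ?_ (by simp)
  refine Subtype.ext ?_
  rw [eq_iwasawaMatrix (γ.1 1) (hθ.cos_eq 1) (hθ.sin_eq 1), ← proj_phiL _ ⟨_, rhoCoord_pos _⟩, phiL,
    proj_liftPath]

/-- An element of `G₀` is the class of a path whose row angle ends at a positive number. -/
lemma exists_rowAngle_pos_of_mem_G₀ {g : G} (hg : g ∈ G₀) :
    ∃ (γ : BasedPath) (a : C(I, ℝ)), IsRowAngle γ a ∧ 0 < a 1 ∧ g = toG γ := by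
  obtain ⟨θ, ρ, ν, hθ, rfl⟩ := hg
  obtain ⟨a, ha⟩ := exists_isRowAngle (iwasawaPath θ ρ ν)
  refine ⟨_, a, ha, (rowAngle_pos_iff ha (isColAngle_iwasawaPath θ ρ ν) 1).2 (by simpa using hθ), ?_⟩
  rw [phiL, liftPath_one]

/-! ### Solutions of `v'' = q v` for bounded measurable `q` -/

/-- `(v, w)` solves `v' = w`, `w' = q v` on `[a, b]` in the sense of Carathéodory. -/
structure IsSolOn (q : ℝ → ℝ) (a b : ℝ) (v w : ℝ → ℝ) : Prop where
  cont_v : ContinuousOn v (Icc a b)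
  cont_w : ContinuousOn w (Icc a b)
  v_eq : ∀ t ∈ Icc a b, v t = v a + ∫ s in a..t, w s
  w_eq : ∀ t ∈ Icc a b, w t = w a + ∫ s in a..t, q s * v s

lemma intervalIntegrable_of_bounded {q : ℝ → ℝ} {L : ℝ} (hq : Measurable q) (hL : ∀ t, |q t| ≤ L)
    (a b : ℝ) : IntervalIntegrable q volume a b := by
  rw [intervalIntegrable_iff]
  exact Measure.integrableOn_of_bounded (by simp) hq.aestronglyMeasurable
    (Filter.Eventually.of_forall hL)

/-- Gronwall's inequality in integral form. -/
lemma gronwall_integral {φ : ℝ → ℝ} {a b ε L : ℝ} (hL : 0 ≤ L) (hφ : ContinuousOn φ (Icc a b))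
    (h : ∀ t ∈ Icc a b, φ t ≤ ε + L * ∫ s in a..t, φ s) :
    ∀ t ∈ Icc a b, φ t ≤ ε * Real.exp (L * (t - a)) := by
  intro t ht
  have hab : a ≤ b := ht.1.trans ht.2
  -- A continuous extension to the whole line makes the primitive differentiable everywhere,
  -- endpoints included.
  have hψ : Continuous (IccExtend hab (domRestrict (Icc a b) φ)) := hφ.domRestrict.Icc_extend'
  set ψ := IccExtend hab (domRestrict (Icc a b) φ)
  have hψφ : ∀ t ∈ Icc a b, ψ t = φ t := fun t ht => by
    exact IccExtend_of_mem _ _ ht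
  have hint : ∀ t ∈ Icc a b, ∫ s in a..t, φ s = ∫ s in a..t, ψ s := fun t ht => by
    refine intervalIntegral.integral_congr fun s hs => ?_
    rw [uIcc_of_le ht.1] at hs
    exact (hψφ s ⟨hs.1, hs.2.trans ht.2⟩).symm
  have hder : ∀ t, HasDerivAt (fun t => ∫ s in a..t, ψ s) (ψ t) t := fun t =>
    intervalIntegral.integral_hasDerivAt_right (hψ.intervalIntegrable _ _)
      (hψ.stronglyMeasurableAtFilter _ _) hψ.continuousAt
  have hE : ∀ t, HasDerivAt (fun t => Real.exp (-(L * (t - a))) * (ε + L * ∫ s in a..t, ψ s))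
      (Real.exp (-(L * (t - a))) * L * (ψ t - (ε + L * ∫ s in a..t, ψ s))) t := fun t => by
    have h1 : HasDerivAt (fun t => -(L * (t - a))) (-(L * 1)) t :=
      (((hasDerivAt_id t).sub_const a).const_mul L).neg
    refine (h1.exp.mul (((hder t).const_mul L).const_add ε)).congr_deriv ?_
    ring
  have hanti : AntitoneOn (fun t => Real.exp (-(L * (t - a))) * (ε + L * ∫ s in a..t, ψ s))
      (Icc a b) := by
    refine antitoneOn_of_deriv_nonpos (convex_Icc a b)
      (fun t _ => (hE t).continuousAt.continuousWithinAt)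
      (fun t _ => (hE t).differentiableAt.differentiableWithinAt) fun t ht => ?_
    rw [interior_Icc] at ht
    have ht' := Ioo_subset_Icc_self ht
    rw [(hE t).deriv]
    have := h t ht'
    rw [hint t ht', ← hψφ t ht'] at this
    exact mul_nonpos_of_nonneg_of_nonpos (by positivity) (by linarith)
  have h2 := hanti (left_mem_Icc.2 hab) ht ht.1
  simp only [sub_self, mul_zero, neg_zero, Real.exp_zero, intervalIntegral.integral_same, add_zero,
    one_mul] at h2
  have h3 := h t ht
  rw [hint t ht] at h3
  refine h3.trans ?_
  rw [Real.exp_neg] at h2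
  have hp := Real.exp_pos (L * (t - a))
  rw [inv_mul_le_iff₀ hp] at h2
  linarith

/-- Solutions depend continuously on the potential in the `L¹` norm. -/
lemma IsSolOn.dist_le {q q' v w v' w' : ℝ → ℝ} {a b L B δ : ℝ} (h : IsSolOn q a b v w)
    (h' : IsSolOn q' a b v' w') (hq : Measurable q) (hL : ∀ t, |q t| ≤ L) (hq' : Measurable q')
    (hL' : ∀ t, |q' t| ≤ L) (hB : ∀ t ∈ Icc a b, |v' t| ≤ B) (hv : v a = v' a) (hw : w a = w' a)
    (hδ : ∫ s in a..b, |q s - q' s| ≤ δ) :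
    ∀ t ∈ Icc a b, |v t - v' t| + |w t - w' t| ≤ B * δ * Real.exp ((1 + L) * (b - a)) := by
  intro t ht
  have hab : a ≤ b := ht.1.trans ht.2
  have hL0 : 0 ≤ L := (abs_nonneg _).trans (hL 0)
  have hB0 : 0 ≤ B := (abs_nonneg _).trans (hB t ht)
  have hqi : ∀ t, IntervalIntegrable q volume a t := intervalIntegrable_of_bounded hq hL a
  have hqi' : ∀ t, IntervalIntegrable q' volume a t := intervalIntegrable_of_bounded hq' hL' a
  have hsub : ∀ {t}, t ∈ Icc a b → uIcc a t ⊆ Icc a b := fun {t} ht => by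
    rw [uIcc_of_le ht.1]; exact Icc_subset_Icc_right ht.2
  have hδ0 : 0 ≤ δ := le_trans
    (intervalIntegral.integral_nonneg hab fun s _ => abs_nonneg (q s - q' s)) hδ
  have hcv : ContinuousOn (fun t => |v t - v' t|) (Icc a b) := (h.cont_v.sub h'.cont_v).abs
  have hcw : ContinuousOn (fun t => |w t - w' t|) (Icc a b) := (h.cont_w.sub h'.cont_w).abs
  have key := gronwall_integral (φ := fun t => |v t - v' t| + |w t - w' t|) (a := a) (b := b)
    (ε := B * δ) (L := 1 + L) (by linarith) (hcv.add hcw) ?_ t ht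
  · refine key.trans ?_
    gcongr
    exact ht.2
  · intro t ht
    have hs := hsub ht
    have iv := (hcv.mono hs).intervalIntegrable (μ := volume)
    have iw := (hcw.mono hs).intervalIntegrable (μ := volume)
    have e1 : |v t - v' t| ≤ ∫ s in a..t, |w s - w' s| := by
      have : v t - v' t = ∫ s in a..t, (w s - w' s) := by
        rw [intervalIntegral.integral_sub (h.cont_w.mono hs).intervalIntegrable
          (h'.cont_w.mono hs).intervalIntegrable, h.v_eq t ht, h'.v_eq t ht, hv]
        ring
      rw [this]
      exact intervalIntegral.abs_integral_le_integral_abs ht.1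
    have hdi : IntervalIntegrable (fun s => |q s - q' s|) volume a t := ((hqi t).sub (hqi' t)).abs
    have e2 : |w t - w' t| ≤ L * (∫ s in a..t, |v s - v' s|) + B * δ := by
      have i1 : IntervalIntegrable (fun s => q s * v s) volume a t :=
        (hqi t).mul_continuousOn (h.cont_v.mono hs)
      have i2 : IntervalIntegrable (fun s => q' s * v' s) volume a t :=
        (hqi' t).mul_continuousOn (h'.cont_v.mono hs)
      have : w t - w' t = ∫ s in a..t, (q s * v s - q' s * v' s) := by
        rw [intervalIntegral.integral_sub i1 i2, h.w_eq t ht, h'.w_eq t ht, hw]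
        ring
      rw [this]
      refine (intervalIntegral.abs_integral_le_integral_abs ht.1).trans ?_
      have e3 : ∫ s in a..t, |q s * v s - q' s * v' s| ≤
          ∫ s in a..t, (L * |v s - v' s| + B * |q s - q' s|) := by
        refine intervalIntegral.integral_mono_on ht.1 (i1.sub i2).abs
          ((iv.const_mul L).add (hdi.const_mul B)) fun s hs => ?_
        have hs' : s ∈ Icc a b := ⟨hs.1, hs.2.trans ht.2⟩
        -- With this splitting only the reference solution `v'` has to be bounded, so the final
        -- constant does not depend on `v`.
        have : q s * v s - q' s * v' s = q s * (v s - v' s) + v' s * (q s - q' s) := by ring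
        rw [this]
        refine (abs_add_le _ _).trans ?_
        rw [abs_mul, abs_mul]
        gcongr
        · exact hL s
        · exact hB s hs'
      refine e3.trans ?_
      rw [intervalIntegral.integral_add (iv.const_mul L) (hdi.const_mul B),
        intervalIntegral.integral_const_mul, intervalIntegral.integral_const_mul]
      gcongr
      refine le_trans ?_ hδ
      refine intervalIntegral.integral_mono_interval le_rfl ht.1 ht.2
        (Filter.Eventually.of_forall fun s => abs_nonneg _) ((hqi b).sub (hqi' b)).abs
    have e4 : ∫ s in a..t, (|v s - v' s| + |w s - w' s|) =
        (∫ s in a..t, |v s - v' s|) + ∫ s in a..t, |w s - w' s| :=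
      intervalIntegral.integral_add iv iw
    have p1 : 0 ≤ ∫ s in a..t, |v s - v' s| :=
      intervalIntegral.integral_nonneg ht.1 fun s _ => abs_nonneg _
    have p2 : 0 ≤ ∫ s in a..t, |w s - w' s| :=
      intervalIntegral.integral_nonneg ht.1 fun s _ => abs_nonneg _
    rw [e4]
    nlinarith [mul_nonneg hL0 p2]

lemma IsSolOn.unique {q v w v' w' : ℝ → ℝ} {a b L : ℝ} (h : IsSolOn q a b v w)
    (h' : IsSolOn q a b v' w') (hq : Measurable q) (hL : ∀ t, |q t| ≤ L) (hv : v a = v' a)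
    (hw : w a = w' a) : ∀ t ∈ Icc a b, v t = v' t ∧ w t = w' t := by
  intro t ht
  obtain ⟨B, hB⟩ := isCompact_Icc.exists_bound_of_continuousOn h'.cont_v
  have := h.dist_le h' hq hL hq hL hB hv hw (δ := 0) (by simp) t ht
  simp only [mul_zero, zero_mul] at this
  have h1 := abs_nonneg (v t - v' t)
  have h2 := abs_nonneg (w t - w' t)
  exact ⟨sub_eq_zero.1 (abs_eq_zero.1 (by linarith)), sub_eq_zero.1 (abs_eq_zero.1 (by linarith))⟩

lemma IsSolOn.linear {q v w v' w' : ℝ → ℝ} {a b L : ℝ} (h : IsSolOn q a b v w)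
    (h' : IsSolOn q a b v' w') (hq : Measurable q) (hL : ∀ t, |q t| ≤ L) (k l : ℝ) :
    IsSolOn q a b (fun t => k * v t + l * v' t) fun t => k * w t + l * w' t := by
  have hqi : ∀ t, IntervalIntegrable q volume a t := intervalIntegrable_of_bounded hq hL a
  have hsub : ∀ {t}, t ∈ Icc a b → uIcc a t ⊆ Icc a b := fun {t} ht => by
    rw [uIcc_of_le ht.1]; exact Icc_subset_Icc_right ht.2
  refine ⟨(h.cont_v.const_mul k).add (h'.cont_v.const_mul l),
    (h.cont_w.const_mul k).add (h'.cont_w.const_mul l), fun t ht => ?_, fun t ht => ?_⟩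
  · rw [intervalIntegral.integral_add
      ((h.cont_w.mono (hsub ht)).intervalIntegrable.const_mul k)
      ((h'.cont_w.mono (hsub ht)).intervalIntegrable.const_mul l),
      intervalIntegral.integral_const_mul, intervalIntegral.integral_const_mul, h.v_eq t ht,
      h'.v_eq t ht]
    ring
  · have : ∀ s, q s * (k * v s + l * v' s) = k * (q s * v s) + l * (q s * v' s) := fun s => by ring
    simp_rw [this]
    rw [intervalIntegral.integral_add
      (((hqi t).mul_continuousOn (h.cont_v.mono (hsub ht))).const_mul k)
      (((hqi t).mul_continuousOn (h'.cont_v.mono (hsub ht))).const_mul l),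
      intervalIntegral.integral_const_mul, intervalIntegral.integral_const_mul, h.w_eq t ht,
      h'.w_eq t ht]
    ring

lemma IsSolOn.mono {q v w : ℝ → ℝ} {a b c d L : ℝ} (h : IsSolOn q a b v w) (hq : Measurable q)
    (hL : ∀ t, |q t| ≤ L) (hac : a ≤ c) (hcd : c ≤ d) (hdb : d ≤ b) : IsSolOn q c d v w := by
  have hs : Icc c d ⊆ Icc a b := Icc_subset_Icc hac hdb
  have hsub : ∀ {t}, t ∈ Icc a b → uIcc a t ⊆ Icc a b := fun {t} ht => by
    rw [uIcc_of_le ht.1]; exact Icc_subset_Icc_right ht.2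
  have hc : c ∈ Icc a b := ⟨hac, hcd.trans hdb⟩
  refine ⟨h.cont_v.mono hs, h.cont_w.mono hs, fun t ht => ?_, fun t ht => ?_⟩
  · rw [h.v_eq t (hs ht), h.v_eq c hc, ← intervalIntegral.integral_interval_sub_left
      ((h.cont_w.mono (hsub (hs ht))).intervalIntegrable)
      ((h.cont_w.mono (hsub hc)).intervalIntegrable)]
    ring
  · rw [h.w_eq t (hs ht), h.w_eq c hc, ← intervalIntegral.integral_interval_sub_left
      ((intervalIntegrable_of_bounded hq hL _ _).mul_continuousOn (h.cont_v.mono (hsub (hs ht))))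
      ((intervalIntegrable_of_bounded hq hL _ _).mul_continuousOn (h.cont_v.mono (hsub hc)))]
    ring

lemma IsSolOn.congr_ae {q q' v w : ℝ → ℝ} {a b : ℝ} (h : IsSolOn q a b v w)
    (hq : ∀ᵐ t, t ∈ Icc a b → q t = q' t) : IsSolOn q' a b v w := by
  refine ⟨h.cont_v, h.cont_w, h.v_eq, fun t ht => ?_⟩
  rw [h.w_eq t ht]
  congr 1
  refine intervalIntegral.integral_congr_ae ?_
  filter_upwards [hq] with s hs hst
  rw [uIoc_of_le ht.1] at hst
  rw [hs ⟨hst.1.le, hst.2.trans ht.2⟩]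

/-- The Wronskian of two solutions is constant. -/
lemma IsSolOn.wronskian {q v w v' w' : ℝ → ℝ} {a b L : ℝ} (h : IsSolOn q a b v w)
    (h' : IsSolOn q a b v' w') (hq : Measurable q) (hL : ∀ t, |q t| ≤ L) :
    ∀ t ∈ Icc a b, v t * w' t - v' t * w t = v a * w' a - v' a * w a := by
  intro t ht
  have hab : a ≤ b := ht.1.trans ht.2
  have hu : uIcc a b = Icc a b := uIcc_of_le hab
  have hqi : IntervalIntegrable q volume a b := intervalIntegrable_of_bounded hq hL a b
  have key : ∀ {v w : ℝ → ℝ}, IsSolOn q a b v w →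
      IntervalIntegrable w volume a b ∧ IntervalIntegrable (fun s => q s * v s) volume a b :=
    fun {v w} h => ⟨ContinuousOn.intervalIntegrable (hu ▸ h.cont_w),
      hqi.mul_continuousOn (hu ▸ h.cont_v)⟩
  -- The components `w` are differentiable only almost everywhere. The Wronskian is therefore built
  -- from the integral representations, whose absolute continuity turns an almost everywhere zero
  -- derivative into constancy.
  have hc : ∀ (c : ℝ) {g : ℝ → ℝ}, IntervalIntegrable g volume a b →
      AbsolutelyContinuousOnInterval (fun t => c + ∫ s in a..t, g s) a b := fun c g hg =>
    (LipschitzOnWith.absolutelyContinuousOnInterval (f := fun _ => c) (K := 0)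
      (by simp [LipschitzOnWith])).fun_add
      (hg.absolutelyContinuousOnInterval_intervalIntegral (by simp))
  obtain ⟨iw, iv⟩ := key h
  obtain ⟨iw', iv'⟩ := key h'
  have hP := ((hc (v a) iw).fun_mul (hc (w' a) iv')).fun_sub ((hc (v' a) iw').fun_mul (hc (w a) iv))
  obtain ⟨C, hC⟩ := hP.const_of_ae_hasDerivAt_zero (by
    filter_upwards [iw.ae_hasDerivAt_integral, iv.ae_hasDerivAt_integral,
      iw'.ae_hasDerivAt_integral, iv'.ae_hasDerivAt_integral] with x h1 h2 h3 h4 hx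
    have d1 := (h1 hx a (by simp)).const_add (v a)
    have d2 := (h2 hx a (by simp)).const_add (w a)
    have d3 := (h3 hx a (by simp)).const_add (v' a)
    have d4 := (h4 hx a (by simp)).const_add (w' a)
    refine ((d1.mul d4).sub (d3.mul d2)).congr_deriv ?_
    rw [hu] at hx
    rw [← h.v_eq x hx, ← h.w_eq x hx, ← h'.v_eq x hx, ← h'.w_eq x hx]
    ring)
  have e1 := hC t (hu ▸ ht)
  have e2 := hC a (by simp)
  simp only [← h.v_eq t ht, ← h.w_eq t ht, ← h'.v_eq t ht, ← h'.w_eq t ht,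
    intervalIntegral.integral_same, add_zero] at e1 e2
  rw [e1, e2]

lemma integral_exp_mul_le {l : ℝ} (hl : 0 < l) (t : ℝ) :
    ∫ s in (0 : ℝ)..t, Real.exp (l * s) ≤ Real.exp (l * t) / l := by
  have h : ∀ s ∈ uIcc 0 t, HasDerivAt (fun s => Real.exp (l * s) / l) (Real.exp (l * s)) s := by
    intro s _
    have h1 : HasDerivAt (fun s => l * s) (l * 1) s := (hasDerivAt_id s).const_mul l
    refine (h1.exp.div_const l).congr_deriv ?_
    field_simp
  rw [intervalIntegral.integral_eq_sub_of_hasDerivAt h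
    (Continuous.intervalIntegrable (by fun_prop) _ _)]
  have : 0 < Real.exp (l * 0) / l := by positivity
  linarith

/-- In the sup norm weighted by `exp (-l t)` each integration gains a factor `1 / l`; two of them
make the Picard map a contraction on an interval of any length. -/
lemma abs_integral_le_exp {g : ℝ → ℝ} {t l C : ℝ} (ht : 0 ≤ t) (hl : 0 < l) (hC : 0 ≤ C)
    (hg : ∀ s ∈ Icc 0 t, |g s| ≤ C * Real.exp (l * s)) :
    |∫ s in (0 : ℝ)..t, g s| ≤ C / l * Real.exp (l * t) := by
  have h1 : ‖∫ s in (0 : ℝ)..t, g s‖ ≤ ∫ s in (0 : ℝ)..t, C * Real.exp (l * s) := by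
    refine intervalIntegral.norm_integral_le_of_norm_le ht ?_
      (Continuous.intervalIntegrable (by fun_prop) _ _)
    exact Filter.Eventually.of_forall fun s hs => hg s ⟨hs.1.le, hs.2⟩
  rw [Real.norm_eq_abs, intervalIntegral.integral_const_mul] at h1
  refine h1.trans ((mul_le_mul_of_nonneg_left (integral_exp_mul_le hl t) hC).trans_eq ?_)
  ring

/-- Existence of solutions for a bounded measurable potential. -/
lemma exists_isSolOn {q : ℝ → ℝ} {L b : ℝ} (hq : Measurable q) (hL : ∀ t, |q t| ≤ L) (hb : 0 ≤ b)
    (v₀ w₀ : ℝ) : ∃ v w : ℝ → ℝ, IsSolOn q 0 b v w ∧ v 0 = v₀ ∧ w 0 = w₀ := by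
  have hL0 : 0 ≤ L := (abs_nonneg _).trans (hL 0)
  -- Two integrations give the contraction factor `L / l²`, which is at most `1 / 4` because `(L -
  -- 1)² ≥ 0`.
  set l := L + 1 with hl
  have hl0 : 0 < l := by positivity
  let ext : C(Icc 0 b, ℝ) → ℝ → ℝ := fun y => IccExtend hb y
  have hext : ∀ y, Continuous (ext y) := fun y => y.continuous.Icc_extend'
  let v : C(Icc 0 b, ℝ) → ℝ → ℝ := fun y t => Real.exp (l * t) * ext y t
  have hv : ∀ y, Continuous (v y) := fun y => Continuous.mul (by fun_prop) (hext y)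
  have hqv : ∀ y s t, IntervalIntegrable (fun s => q s * v y s) volume s t := fun y s t =>
    (intervalIntegrable_of_bounded hq hL s t).mul_continuousOn (hv y).continuousOn
  let w : C(Icc 0 b, ℝ) → ℝ → ℝ := fun y t => w₀ + ∫ s in (0 : ℝ)..t, q s * v y s
  have hw : ∀ y, Continuous (w y) := fun y =>
    continuous_const.add (intervalIntegral.continuous_primitive (hqv y) 0)
  let V : C(Icc 0 b, ℝ) → ℝ → ℝ := fun y t => v₀ + ∫ s in (0 : ℝ)..t, w y s
  have hV : ∀ y, Continuous (V y) := fun y =>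
    continuous_const.add (intervalIntegral.continuous_primitive
      (fun s t => (hw y).intervalIntegrable s t) 0)
  -- The unknown is `y = exp (-l t) v`, so that the plain sup norm of `y` is the weighted norm of
  -- `v`.
  let T : C(Icc 0 b, ℝ) → C(Icc 0 b, ℝ) := fun y =>
    ⟨fun t => Real.exp (-(l * t)) * V y t, by have := hV y; fun_prop⟩
  have hT : ContractingWith (1 / 4) T := by
    refine ⟨by rw [← NNReal.coe_lt_coe]; norm_num, LipschitzWith.of_dist_le_mul fun y y' => ?_⟩
    have hd : ∀ s, |ext y s - ext y' s| ≤ dist y y' := fun s =>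
      ContinuousMap.dist_apply_le_dist (f := y) (g := y') _
    rw [ContinuousMap.dist_le (by positivity)]
    rintro ⟨t, ht⟩
    have h1 : ∀ s ∈ Icc 0 t, |w y s - w y' s| ≤ L * dist y y' / l * Real.exp (l * s) := by
      intro s hs
      have : w y s - w y' s = ∫ r in (0 : ℝ)..s, (q r * v y r - q r * v y' r) := by
        rw [intervalIntegral.integral_sub (hqv y 0 s) (hqv y' 0 s)]; simp only [w]; ring
      rw [this]
      refine abs_integral_le_exp hs.1 hl0 (by positivity) fun r _ => ?_
      have : q r * v y r - q r * v y' r = q r * (ext y r - ext y' r) * Real.exp (l * r) := by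
        simp only [v]; ring
      rw [this, abs_mul, abs_mul, abs_of_pos (Real.exp_pos _)]
      gcongr
      · exact hL r
      · exact hd r
    have h2 : |V y t - V y' t| ≤ L * dist y y' / l / l * Real.exp (l * t) := by
      have : V y t - V y' t = ∫ r in (0 : ℝ)..t, (w y r - w y' r) := by
        rw [intervalIntegral.integral_sub ((hw y).intervalIntegrable _ _)
          ((hw y').intervalIntegrable _ _)]; simp only [V]; ring
      rw [this]
      exact abs_integral_le_exp ht.1 hl0 (by positivity) h1
    change |Real.exp (-(l * t)) * V y t - Real.exp (-(l * t)) * V y' t| ≤ _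
    rw [← mul_sub, abs_mul, abs_of_pos (Real.exp_pos _), Real.exp_neg,
      inv_mul_le_iff₀ (Real.exp_pos _)]
    refine h2.trans ?_
    rw [mul_comm]
    gcongr
    rw [div_div, div_le_iff₀ (by positivity)]
    have h3 : L ≤ 1 / 4 * (l * l) := by nlinarith [sq_nonneg (L - 1)]
    push_cast
    nlinarith [dist_nonneg (x := y) (y := y'), mul_le_mul_of_nonneg_right h3 (dist_nonneg (x := y) (y := y'))]
  obtain ⟨y, hy⟩ : ∃ y, T y = y := ⟨_, hT.fixedPoint_isFixedPt⟩
  have hVv : ∀ t ∈ Icc 0 b, V y t = v y t := by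
    intro t ht
    have h1 := congrArg (fun f : C(Icc 0 b, ℝ) => f ⟨t, ht⟩) hy
    simp only [T, ContinuousMap.coe_mk] at h1
    have h2 : ext y t = y ⟨t, ht⟩ := IccExtend_of_mem _ _ ht
    simp only [v, h2, ← h1]
    rw [← mul_assoc, ← Real.exp_add]
    simp
  refine ⟨V y, w y, ⟨(hV y).continuousOn, (hw y).continuousOn, fun t ht => ?_, fun t ht => ?_⟩, ?_, ?_⟩
  · simp [V]
  · have : ∫ s in (0 : ℝ)..t, q s * V y s = ∫ s in (0 : ℝ)..t, q s * v y s := by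
      refine intervalIntegral.integral_congr fun s hs => ?_
      rw [uIcc_of_le ht.1] at hs
      rw [hVv s ⟨hs.1, hs.2.trans ht.2⟩]
    rw [this]
    simp [w]
  · simp [V]
  · simp [w]

/-! ### The fundamental matrix -/

lemma IsFundamentalMatrix.isSolOn₁ {q : ℝ → ℝ} {Φ : ℝ → SL(2, ℝ)} (h : IsFundamentalMatrix q Φ) :
    IsSolOn q 0 (2 * Real.pi) (fun t => Φ t 0 0) fun t => Φ t 1 0 := by
  have h0 : Φ 0 0 0 = 1 ∧ Φ 0 1 0 = 0 := by rw [h.initial]; simp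
  refine ⟨(continuous_entry 0 0).comp_continuousOn h.continuousOn,
    (continuous_entry 1 0).comp_continuousOn h.continuousOn, fun t ht => ?_, fun t ht => ?_⟩
  · rw [h0.1]; exact h.v₁_eq t ht
  · rw [h0.2, zero_add]; exact h.deriv_v₁_eq t ht

lemma IsFundamentalMatrix.isSolOn₂ {q : ℝ → ℝ} {Φ : ℝ → SL(2, ℝ)} (h : IsFundamentalMatrix q Φ) :
    IsSolOn q 0 (2 * Real.pi) (fun t => Φ t 0 1) fun t => Φ t 1 1 := by
  have h0 : Φ 0 0 1 = 0 ∧ Φ 0 1 1 = 1 := by rw [h.initial]; simp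
  refine ⟨(continuous_entry 0 1).comp_continuousOn h.continuousOn,
    (continuous_entry 1 1).comp_continuousOn h.continuousOn, fun t ht => ?_, fun t ht => ?_⟩
  · rw [h0.1, zero_add]; exact h.v₂_eq t ht
  · rw [h0.2]; exact h.deriv_v₂_eq t ht

lemma exists_isFundamentalMatrix {q : ℝ → ℝ} {L : ℝ} (hq : Measurable q) (hL : ∀ t, |q t| ≤ L) :
    ∃ Φ, IsFundamentalMatrix q Φ := by
  have hpi : (0 : ℝ) ≤ 2 * Real.pi := by positivity
  obtain ⟨v₁, w₁, h₁, hv₁, hw₁⟩ := exists_isSolOn hq hL hpi 1 0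
  obtain ⟨v₂, w₂, h₂, hv₂, hw₂⟩ := exists_isSolOn hq hL hpi 0 1
  have hW := h₁.wronskian h₂ hq hL
  rw [hv₁, hw₁, hv₂, hw₂] at hW
  -- The Wronskian is known only on `[0, 2π]`; freezing the solutions outside makes the determinant
  -- 1 at every time.
  let p : ℝ → Icc 0 (2 * Real.pi) := projIcc 0 (2 * Real.pi) hpi
  have hp : ∀ t ∈ Icc 0 (2 * Real.pi), (p t : ℝ) = t := fun t ht => by
    simp [p, projIcc_of_mem hpi ht]
  let Φ : ℝ → SL(2, ℝ) := fun t => ⟨!![v₁ (p t), v₂ (p t); w₁ (p t), w₂ (p t)], by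
    rw [Matrix.det_fin_two_of]
    have := hW (p t) (p t).2
    linarith⟩
  have e00 : ∀ t ∈ Icc 0 (2 * Real.pi), Φ t 0 0 = v₁ t := fun t ht => by
    change v₁ (p t) = v₁ t; rw [hp t ht]
  have e01 : ∀ t ∈ Icc 0 (2 * Real.pi), Φ t 0 1 = v₂ t := fun t ht => by
    change v₂ (p t) = v₂ t; rw [hp t ht]
  have e10 : ∀ t ∈ Icc 0 (2 * Real.pi), Φ t 1 0 = w₁ t := fun t ht => by
    change w₁ (p t) = w₁ t; rw [hp t ht]
  have e11 : ∀ t ∈ Icc 0 (2 * Real.pi), Φ t 1 1 = w₂ t := fun t ht => by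
    change w₂ (p t) = w₂ t; rw [hp t ht]
  have hint : ∀ {g g' : ℝ → ℝ} {t : ℝ}, t ∈ Icc 0 (2 * Real.pi) →
      (∀ s ∈ Icc 0 (2 * Real.pi), g s = g' s) → ∫ s in (0 : ℝ)..t, g s = ∫ s in (0 : ℝ)..t, g' s :=
    fun {g g' t} ht h => intervalIntegral.integral_congr fun s hs => by
      rw [uIcc_of_le ht.1] at hs
      exact h s ⟨hs.1, hs.2.trans ht.2⟩
  refine ⟨Φ, ?_, ?_, ?_, fun t ht => ?_, fun t ht => ?_, fun t ht => ?_, fun t ht => ?_⟩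
  · rw [integrableOn_Icc_iff_integrableOn_Ioc, ← intervalIntegrable_iff_integrableOn_Ioc_of_le hpi]
    exact intervalIntegrable_of_bounded hq hL _ _
  · refine Continuous.continuousOn (Continuous.subtype_mk ?_ _)
    have hc : ∀ {g : ℝ → ℝ}, ContinuousOn g (Icc 0 (2 * Real.pi)) → Continuous fun t => g (p t) :=
      fun hg => hg.comp_continuous (continuous_subtype_val.comp continuous_projIcc) fun t => (p t).2
    refine continuous_matrix fun i j => ?_
    fin_cases i <;> fin_cases j
    exacts [hc h₁.cont_v, hc h₂.cont_v, hc h₁.cont_w, hc h₂.cont_w]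
  · have h0 : (0 : ℝ) ∈ Icc 0 (2 * Real.pi) := ⟨le_rfl, hpi⟩
    ext i j
    fin_cases i <;> fin_cases j
    · exact (e00 0 h0).trans hv₁
    · exact (e01 0 h0).trans hv₂
    · exact (e10 0 h0).trans hw₁
    · exact (e11 0 h0).trans hw₂
  · rw [e00 t ht, hint ht e10, h₁.v_eq t ht, hv₁]
  · rw [e01 t ht, hint ht e11, h₂.v_eq t ht, hv₂, zero_add]
  · rw [e10 t ht, hint ht fun s hs => by rw [e00 s hs], h₁.w_eq t ht, hw₁, zero_add]
  · rw [e11 t ht, hint ht fun s hs => by rw [e01 s hs], h₂.w_eq t ht, hw₂]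

lemma IsFundamentalMatrix.congr_ae {q q' : ℝ → ℝ} {Φ : ℝ → SL(2, ℝ)} (h : IsFundamentalMatrix q Φ)
    (hq : q =ᵐ[volume.restrict (Icc 0 (2 * Real.pi))] q') : IsFundamentalMatrix q' Φ := by
  have hq' := (ae_restrict_iff' measurableSet_Icc).1 hq
  have h1 := h.isSolOn₁.congr_ae hq'
  have h2 := h.isSolOn₂.congr_ae hq'
  refine ⟨h.integrable.congr hq, h.continuousOn, h.initial, h.v₁_eq, h.v₂_eq, fun t ht => ?_,
    fun t ht => ?_⟩
  · simpa [h.initial] using h1.w_eq t ht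
  · simpa [h.initial] using h2.w_eq t ht

lemma IsFundamentalMatrix.unique {q : ℝ → ℝ} {L : ℝ} (hq : Measurable q) (hL : ∀ t, |q t| ≤ L)
    {Φ Ψ : ℝ → SL(2, ℝ)} (h : IsFundamentalMatrix q Φ) (h' : IsFundamentalMatrix q Ψ) :
    ∀ t ∈ Icc 0 (2 * Real.pi), Φ t = Ψ t := by
  intro t ht
  have h1 := h.isSolOn₁.unique h'.isSolOn₁ hq hL (by rw [h.initial, h'.initial])
    (by rw [h.initial, h'.initial]) t ht
  have h2 := h.isSolOn₂.unique h'.isSolOn₂ hq hL (by rw [h.initial, h'.initial])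
    (by rw [h.initial, h'.initial]) t ht
  ext i j
  fin_cases i <;> fin_cases j
  exacts [h1.1, h2.1, h1.2, h2.2]

/-- The monodromy of a potential that agrees almost everywhere with a bounded measurable one. -/
lemma monodromy_eq {q q' : ℝ → ℝ} {L : ℝ} (hq : Measurable q) (hL : ∀ t, |q t| ≤ L)
    (hqq' : q =ᵐ[volume.restrict (Icc 0 (2 * Real.pi))] q') {Φ : ℝ → SL(2, ℝ)}
    (h : IsFundamentalMatrix q Φ) : monodromy q' = toG h.path := by
  have hex : ∃ Φ, IsFundamentalMatrix q' Φ := ⟨Φ, h.congr_ae hqq'⟩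
  rw [monodromy, dif_pos hex, liftPath_one]
  refine congrArg toG (Subtype.ext (ContinuousMap.ext fun s => ?_))
  have hpi := Real.pi_pos
  -- The fundamental matrix chosen in `monodromy` is unique on `[0, 2π]`, and the path uses only
  -- these times.
  refine (hex.choose_spec.congr_ae hqq'.symm).unique hq hL h _ ⟨?_, ?_⟩
  · have := s.2.1; positivity
  · have := s.2.2; nlinarith

/-! ### The row angle of a fundamental matrix -/

lemma eq_left_of_hasDerivAt_zero {f : ℝ → ℝ} {a b : ℝ} (hc : ContinuousOn f (Icc a b))
    (h : ∀ t ∈ Ioo a b, HasDerivAt f 0 t) : ∀ t ∈ Icc a b, f t = f a := by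
  intro t ht
  rcases ht.1.eq_or_lt with rfl | hat
  · rfl
  obtain ⟨c, -, hc⟩ := exists_hasDerivAt_eq_slope f (fun _ => 0) hat
    (hc.mono (Icc_subset_Icc_right ht.2)) fun x hx => h x ⟨hx.1, hx.2.trans_le ht.2⟩
  have := sub_pos.2 hat
  field_simp at hc
  linarith

lemma hasDerivAt_integral_of_continuousOn {g : ℝ → ℝ} {a b t : ℝ} (hg : ContinuousOn g (Icc a b))
    (ht : t ∈ Ioo a b) : HasDerivAt (fun t => ∫ s in a..t, g s) (g t) t := by
  refine intervalIntegral.integral_hasDerivAt_right ?_ ?_ ?_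
  · refine (hg.mono ?_).intervalIntegrable
    rw [uIcc_of_le ht.1.le]
    exact Icc_subset_Icc_right ht.2.le
  · exact ContinuousOn.stronglyMeasurableAtFilter isOpen_Ioo (hg.mono Ioo_subset_Icc_self) t ht
  · exact hg.continuousAt (Icc_mem_nhds ht.1 ht.2)

lemma continuousOn_integral_of_continuousOn {g : ℝ → ℝ} {a b : ℝ} (hab : a ≤ b)
    (hg : ContinuousOn g (Icc a b)) : ContinuousOn (fun t => ∫ s in a..t, g s) (Icc a b) := by
  have := intervalIntegral.continuousOn_primitive_interval (μ := volume) (f := g) (a := a) (b := b)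
    (by rw [uIcc_of_le hab]; exact hg.integrableOn_Icc)
  rwa [uIcc_of_le hab] at this

lemma IsSolOn.hasDerivAt {q v w : ℝ → ℝ} {a b : ℝ} (h : IsSolOn q a b v w) {t : ℝ}
    (ht : t ∈ Ioo a b) : HasDerivAt v (w t) t := by
  refine ((hasDerivAt_integral_of_continuousOn h.cont_w ht).const_add (v a)).congr_of_eventuallyEq ?_
  filter_upwards [Icc_mem_nhds ht.1 ht.2] with s hs using h.v_eq s hs

/-- This is the derivative of `(v₁ c + v₂ s) / R` along an angle of speed `1 / R²`. It serves twice: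
for `(c, s) = (cos α, sin α)` and for the rotated pair `(-sin α, cos α)`. -/
lemma polar_deriv_aux {v₁ w₁ v₂ w₂ c s R : ℝ} (hR : R ≠ 0) (h : R ^ 2 = v₁ ^ 2 + v₂ ^ 2)
    (hW : v₁ * w₂ - v₂ * w₁ = 1) :
    ((w₁ * c + v₁ * (-s * (1 / (v₁ ^ 2 + v₂ ^ 2))) + (w₂ * s + v₂ * (c * (1 / (v₁ ^ 2 + v₂ ^ 2))))) *
      R - (v₁ * c + v₂ * s) * ((v₁ * w₁ + v₂ * w₂) / R)) / R ^ 2 = 0 := by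
  rw [← h]
  field_simp
  linear_combination (w₁ * c + w₂ * s) * h + (v₁ * s - v₂ * c) * hW

/-- A planar curve `(v₁, v₂)` with `v₁ v₂' - v₁' v₂ = 1` has angle `∫ 1 / (v₁² + v₂²)`. -/
lemma polar_of_wronskian {v₁ w₁ v₂ w₂ : ℝ → ℝ} {a b α₀ : ℝ} (hv₁ : ContinuousOn v₁ (Icc a b))
    (hv₂ : ContinuousOn v₂ (Icc a b)) (hd₁ : ∀ t ∈ Ioo a b, HasDerivAt v₁ (w₁ t) t)
    (hd₂ : ∀ t ∈ Ioo a b, HasDerivAt v₂ (w₂ t) t)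
    (hW : ∀ t ∈ Icc a b, v₁ t * w₂ t - v₂ t * w₁ t = 1)
    (h₁ : v₁ a = √(v₁ a ^ 2 + v₂ a ^ 2) * Real.cos α₀)
    (h₂ : v₂ a = √(v₁ a ^ 2 + v₂ a ^ 2) * Real.sin α₀) :
    ∀ t ∈ Icc a b,
      v₁ t = √(v₁ t ^ 2 + v₂ t ^ 2) *
        Real.cos (α₀ + ∫ s in a..t, 1 / (v₁ s ^ 2 + v₂ s ^ 2)) ∧
      v₂ t = √(v₁ t ^ 2 + v₂ t ^ 2) *
        Real.sin (α₀ + ∫ s in a..t, 1 / (v₁ s ^ 2 + v₂ s ^ 2)) := by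
  intro t ht
  have hab := ht.1.trans ht.2
  have hpos : ∀ t ∈ Icc a b, 0 < v₁ t ^ 2 + v₂ t ^ 2 := by
    intro t ht
    have h := hW t ht
    by_contra! hn
    have h0 : v₁ t = 0 := by nlinarith [sq_nonneg (v₁ t), sq_nonneg (v₂ t)]
    have h1 : v₂ t = 0 := by nlinarith [sq_nonneg (v₁ t), sq_nonneg (v₂ t)]
    rw [h0, h1] at h
    norm_num at h
  have hg : ContinuousOn (fun s => 1 / (v₁ s ^ 2 + v₂ s ^ 2)) (Icc a b) :=
    continuousOn_const.div ((hv₁.pow 2).add (hv₂.pow 2)) fun s hs => (hpos s hs).ne'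
  have hαc := (continuousOn_integral_of_continuousOn hab hg).const_add α₀
  have hαd : ∀ t ∈ Ioo a b, HasDerivAt
      (fun t => α₀ + ∫ s in a..t, 1 / (v₁ s ^ 2 + v₂ s ^ 2)) (1 / (v₁ t ^ 2 + v₂ t ^ 2)) t :=
    fun t ht => (hasDerivAt_integral_of_continuousOn hg ht).const_add α₀
  have hα0 : α₀ + ∫ s in a..a, 1 / (v₁ s ^ 2 + v₂ s ^ 2) = α₀ := by simp
  set α : ℝ → ℝ := fun t => α₀ + ∫ s in a..t, 1 / (v₁ s ^ 2 + v₂ s ^ 2)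
  change v₁ t = _ * Real.cos (α t) ∧ v₂ t = _ * Real.sin (α t)
  change α a = α₀ at hα0
  clear_value α
  have hRc : ContinuousOn (fun t => √(v₁ t ^ 2 + v₂ t ^ 2)) (Icc a b) :=
    ((hv₁.pow 2).add (hv₂.pow 2)).sqrt
  have hR0 : ∀ t ∈ Icc a b, √(v₁ t ^ 2 + v₂ t ^ 2) ≠ 0 := fun t ht =>
    (Real.sqrt_pos.2 (hpos t ht)).ne'
  have hcos := Real.continuous_cos.comp_continuousOn hαc
  have hsin := Real.continuous_sin.comp_continuousOn hαc
  have hRd : ∀ t ∈ Ioo a b, HasDerivAt (fun t => √(v₁ t ^ 2 + v₂ t ^ 2))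
      ((v₁ t * w₁ t + v₂ t * w₂ t) / √(v₁ t ^ 2 + v₂ t ^ 2)) t := fun t ht => by
    have h := (((hd₁ t ht).fun_pow 2).fun_add ((hd₂ t ht).fun_pow 2)).sqrt
      (hpos t (Ioo_subset_Icc_self ht)).ne'
    refine h.congr_deriv ?_
    have := hR0 t (Ioo_subset_Icc_self ht)
    field_simp
    ring
  have hsq := Real.sin_sq_add_cos_sq
  -- The unit vector `(v₁, v₂) / R` has constant inner product (`hu`) and constant cross product
  -- (`hz`) with `(cos α, sin α)`. Their values at `a` are 1 and 0, so the two unit vectors coincide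
  -- throughout.
  have hu := eq_left_of_hasDerivAt_zero
    (f := fun t => (v₁ t * Real.cos (α t) + v₂ t * Real.sin (α t)) / √(v₁ t ^ 2 + v₂ t ^ 2))
    (a := a) (b := b) (((hv₁.mul hcos).add (hv₂.mul hsin)).div hRc hR0) (fun t ht => by
      have ht' := Ioo_subset_Icc_self ht
      have h := ((((hd₁ t ht).mul (hαd t ht).cos).add ((hd₂ t ht).mul (hαd t ht).sin)).div
        (hRd t ht) (hR0 t ht'))
      exact h.congr_deriv (polar_deriv_aux (hR0 t ht') (Real.sq_sqrt (hpos t ht').le) (hW t ht'))) t ht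
  have hz := eq_left_of_hasDerivAt_zero
    (f := fun t => (v₂ t * Real.cos (α t) - v₁ t * Real.sin (α t)) / √(v₁ t ^ 2 + v₂ t ^ 2))
    (a := a) (b := b) (((hv₂.mul hcos).sub (hv₁.mul hsin)).div hRc hR0) (fun t ht => by
      have ht' := Ioo_subset_Icc_self ht
      have h := ((((hd₂ t ht).mul (hαd t ht).cos).sub ((hd₁ t ht).mul (hαd t ht).sin)).div
        (hRd t ht) (hR0 t ht'))
      refine h.congr_deriv (Eq.trans ?_ (polar_deriv_aux (c := -Real.sin (α t))
        (s := Real.cos (α t)) (hR0 t ht') (Real.sq_sqrt (hpos t ht').le) (hW t ht')))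
      simp only [Pi.sub_apply, Pi.mul_apply]
      ring) t ht
  have ha : a ∈ Icc a b := left_mem_Icc.2 hab
  simp only [hα0] at hu hz
  have hu1 : (v₁ a * Real.cos α₀ + v₂ a * Real.sin α₀) / √(v₁ a ^ 2 + v₂ a ^ 2) = 1 := by
    rw [div_eq_one_iff_eq (hR0 a ha)]
    linear_combination Real.cos α₀ * h₁ + Real.sin α₀ * h₂ + √(v₁ a ^ 2 + v₂ a ^ 2) * hsq α₀
  have hz1 : (v₂ a * Real.cos α₀ - v₁ a * Real.sin α₀) / √(v₁ a ^ 2 + v₂ a ^ 2) = 0 := by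
    rw [div_eq_zero_iff]
    left
    linear_combination Real.cos α₀ * h₂ - Real.sin α₀ * h₁
  rw [hu1, div_eq_one_iff_eq (hR0 t ht)] at hu
  rw [hz1, div_eq_zero_iff, or_iff_left (hR0 t ht)] at hz
  constructor
  · linear_combination Real.cos (α t) * hu - Real.sin (α t) * hz - v₁ t * hsq (α t)
  · linear_combination Real.sin (α t) * hu + Real.cos (α t) * hz - v₂ t * hsq (α t)

/-- The total angle of the first row of a fundamental matrix. -/
noncomputable def totalAngle (Φ : ℝ → SL(2, ℝ)) : ℝ :=
  ∫ s in (0 : ℝ)..2 * Real.pi, 1 / (Φ s 0 0 ^ 2 + Φ s 0 1 ^ 2)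

lemma IsFundamentalMatrix.polar {q : ℝ → ℝ} {Φ : ℝ → SL(2, ℝ)} (h : IsFundamentalMatrix q Φ) :
    ∀ t ∈ Icc 0 (2 * Real.pi),
      Φ t 0 0 = √(Φ t 0 0 ^ 2 + Φ t 0 1 ^ 2) *
        Real.cos (∫ s in (0 : ℝ)..t, 1 / (Φ s 0 0 ^ 2 + Φ s 0 1 ^ 2)) ∧
      Φ t 0 1 = √(Φ t 0 0 ^ 2 + Φ t 0 1 ^ 2) *
        Real.sin (∫ s in (0 : ℝ)..t, 1 / (Φ s 0 0 ^ 2 + Φ s 0 1 ^ 2)) := by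
  intro t ht
  simpa using polar_of_wronskian (α₀ := 0) h.isSolOn₁.cont_v h.isSolOn₂.cont_v
    (fun t ht => h.isSolOn₁.hasDerivAt ht) (fun t ht => h.isSolOn₂.hasDerivAt ht)
    (fun t _ => det_eq (Φ t)) (by simp [h.initial]) (by simp [h.initial]) t ht

lemma IsFundamentalMatrix.continuousOn_angle {q : ℝ → ℝ} {Φ : ℝ → SL(2, ℝ)}
    (h : IsFundamentalMatrix q Φ) :
    ContinuousOn (fun s => 1 / (Φ s 0 0 ^ 2 + Φ s 0 1 ^ 2)) (Icc 0 (2 * Real.pi)) :=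
  continuousOn_const.div ((h.isSolOn₁.cont_v.pow 2).add (h.isSolOn₂.cont_v.pow 2))
    fun s _ => (row_sq_pos (Φ s)).ne'

lemma IsFundamentalMatrix.exists_isRowAngle {q : ℝ → ℝ} {Φ : ℝ → SL(2, ℝ)}
    (h : IsFundamentalMatrix q Φ) : ∃ a, IsRowAngle h.path a ∧ a 1 = totalAngle Φ := by
  have hpi := Real.pi_pos
  have hmem : ∀ s : I, 2 * Real.pi * s ∈ Icc 0 (2 * Real.pi) := fun s =>
    ⟨by have := s.2.1; positivity, by have := s.2.2; nlinarith⟩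
  have hc := (continuousOn_integral_of_continuousOn (by positivity)
    h.continuousOn_angle).comp_continuous (f := fun s : I => 2 * Real.pi * s) (by fun_prop) hmem
  refine ⟨⟨_, hc⟩, ⟨by simp, fun s => ?_, fun s => ?_⟩, by simp [totalAngle]⟩
  · exact (h.polar _ (hmem s)).1
  · exact (h.polar _ (hmem s)).2

lemma IsFundamentalMatrix.totalAngle_pos {q : ℝ → ℝ} {Φ : ℝ → SL(2, ℝ)}
    (h : IsFundamentalMatrix q Φ) : 0 < totalAngle Φ := by
  have hpi := Real.pi_pos
  refine intervalIntegral.intervalIntegral_pos_of_pos_on ?_ ?_ (by positivity)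
  · refine ContinuousOn.intervalIntegrable ?_
    rw [uIcc_of_le (by positivity)]
    exact h.continuousOn_angle
  · intro s _
    exact one_div_pos.2 (row_sq_pos (Φ s))

/-- A class in `L^∞` is bounded only almost everywhere. Truncating `g ∘ u` at a bound for `g` on the
essential range changes it on a null set, and yields the everywhere bounded potential that the
existence theory asks for. -/
lemma exists_bounded_measurable_ae_eq {g : ℝ → ℝ} (hg : Continuous g) (u : Linfty) :
    ∃ (q : ℝ → ℝ) (L : ℝ), Measurable q ∧ (∀ t, |q t| ≤ L) ∧
      q =ᵐ[volume.restrict (Icc 0 (2 * Real.pi))] fun t => g (u t) := by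
  obtain ⟨B, hB⟩ : ∃ B : ℝ, ∀ᵐ t ∂(volume.restrict (Icc 0 (2 * Real.pi))), ‖u t‖ ≤ B :=
    ⟨_, ae_le_eLpNormEssSup.mono fun t ht => by
      have h1 := (Lp.memLp u).2
      rw [eLpNorm_exponent_top] at h1
      have := ENNReal.toReal_mono h1.ne ht
      simpa using this⟩
  obtain ⟨L, hL⟩ := (isCompact_Icc (a := -B) (b := B)).exists_bound_of_continuousOn hg.continuousOn
  have hL0 : -|L| ≤ |L| := by linarith [abs_nonneg L]
  refine ⟨fun t => max (-|L|) (min |L| (g (u t))), |L|, ?_, fun t => ?_, ?_⟩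
  · have := (Lp.stronglyMeasurable u).measurable
    exact measurable_const.max (measurable_const.min (hg.measurable.comp this))
  · rw [abs_le]
    exact ⟨le_max_left _ _, max_le hL0 (min_le_left _ _)⟩
  · filter_upwards [hB] with t ht
    have := hL (u t) (abs_le.1 ht)
    rw [Real.norm_eq_abs] at this
    have h2 := abs_le.1 (this.trans (le_abs_self L))
    rw [min_eq_right h2.2, max_eq_right h2.1]

/-- The nonlinear monodromy takes values in `G₀`. -/
lemma nonlinearMonodromy_mem_G₀ {f : ℝ → ℝ} (hf : Continuous (deriv f)) (u : Linfty) :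
    nonlinearMonodromy f u ∈ G₀ := by
  obtain ⟨q, L, hq, hL, hqu⟩ := exists_bounded_measurable_ae_eq hf u
  obtain ⟨Φ, hΦ⟩ := exists_isFundamentalMatrix hq hL
  rw [nonlinearMonodromy, monodromy_eq hq hL hqu hΦ]
  obtain ⟨a, ha, ha1⟩ := hΦ.exists_isRowAngle
  exact mem_G₀_of_rowAngle_pos ha (ha1 ▸ hΦ.totalAngle_pos)

/-! ### Steering by a potential given in polar form -/

/-- A smooth positive function with prescribed 1-jets at both ends and prescribed integral. -/
lemma exists_pos_jets_integral {a b p₀ p₁ J : ℝ} (hab : a < b) (hp₀ : 0 < p₀) (hp₁ : 0 < p₁)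
    (s₀ s₁ : ℝ) (hJ : 0 < J) :
    ∃ p : ℝ → ℝ, ContDiff ℝ ∞ p ∧ (∀ t, 0 < p t) ∧ p a = p₀ ∧ p b = p₁ ∧ HasDerivAt p s₀ a ∧
      HasDerivAt p s₁ b ∧ ∫ t in a..b, p t = J := by
  have hd : 0 < b - a := sub_pos.2 hab
  -- The squared linear weights have logarithmic derivatives `-2 / (b - a)` at `a` and `2 / (b - a)`
  -- at `b`; `k₀` and `k₁` compensate for them.
  set k₀ := s₀ / p₀ + 2 / (b - a) with hk₀
  set k₁ := s₁ / p₁ - 2 / (b - a) with hk₁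
  -- Each summand has a double zero at the far end, so it carries the 1-jet of one end only. The
  -- Gaussian factors do not affect these jets and push the integral to 0 as `n` grows.
  let P : ℝ → ℝ → ℝ := fun n t =>
    ((b - t) / (b - a)) ^ 2 * p₀ * Real.exp (k₀ * (t - a) - n * (t - a) ^ 2) +
    ((t - a) / (b - a)) ^ 2 * p₁ * Real.exp (k₁ * (t - b) - n * (t - b) ^ 2)
  have hPsm : ∀ n, ContDiff ℝ ∞ (P n) := fun n => by
    simp only [P, div_eq_mul_inv]
    fun_prop
  have hPpos : ∀ n t, 0 < P n t := fun n t => by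
    rcases eq_or_ne t b with rfl | htb
    · have h1 : (t - a) / (t - a) = 1 := div_self hd.ne'
      simp only [P, sub_self, zero_div, h1]
      simp [hp₁]
    · have h1 : 0 < ((b - t) / (b - a)) ^ 2 := by
        have : (b - t) / (b - a) ≠ 0 := div_ne_zero (sub_ne_zero.2 htb.symm) hd.ne'
        positivity
      simp only [P]
      positivity
  have hlim : Filter.Tendsto (fun n : ℕ => ∫ t in a..b, P n t) Filter.atTop (𝓝 0) := by
    have h0 : ∫ t in a..b, (0 : ℝ) = 0 := by simp
    rw [← h0]
    refine intervalIntegral.tendsto_integral_filter_of_dominated_convergence (P 0) ?_ ?_ ?_ ?_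
    · exact Filter.Eventually.of_forall fun n => (hPsm n).continuous.aestronglyMeasurable
    · refine Filter.Eventually.of_forall fun n => Filter.Eventually.of_forall fun t _ => ?_
      rw [Real.norm_of_nonneg (hPpos n t).le]
      simp only [P]
      gcongr <;> positivity
    · exact (hPsm 0).continuous.intervalIntegrable _ _
    · have hne : ∀ᵐ t : ℝ, t ≠ a ∧ t ≠ b := by
        filter_upwards [Measure.ae_ne volume a, Measure.ae_ne volume b] with t h1 h2
          using ⟨h1, h2⟩
      filter_upwards [hne] with t ht _
      have key : ∀ (k x : ℝ), x ≠ 0 →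
          Filter.Tendsto (fun n : ℕ => Real.exp (k - n * x ^ 2)) Filter.atTop (𝓝 0) := by
        intro k x hx
        refine Real.tendsto_exp_atBot.comp ?_
        refine Filter.tendsto_atBot_add_const_left _ k (Filter.tendsto_neg_atTop_atBot.comp ?_)
        exact tendsto_natCast_atTop_atTop.atTop_mul_const (by positivity)
      have := ((key (k₀ * (t - a)) (t - a) (sub_ne_zero.2 ht.1)).const_mul
        (((b - t) / (b - a)) ^ 2 * p₀)).add ((key (k₁ * (t - b)) (t - b)
          (sub_ne_zero.2 ht.2)).const_mul (((t - a) / (b - a)) ^ 2 * p₁))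
      simpa using this
  obtain ⟨n, hn⟩ := (hlim.eventually (gt_mem_nhds hJ)).exists
  -- The missing part of the integral is filled in by a nonnegative function with double zeros at
  -- both ends, which leaves the jets alone.
  let β : ℝ → ℝ := fun t => (t - a) ^ 2 * (b - t) ^ 2
  have hβ : ContDiff ℝ ∞ β := by simp only [β]; fun_prop
  have hβ0 : ∀ t, 0 ≤ β t := fun t => by positivity
  have hβi : 0 < ∫ t in a..b, β t := by
    refine intervalIntegral.intervalIntegral_pos_of_pos_on (hβ.continuous.intervalIntegrable _ _)
      (fun t ht => ?_) hab
    have h1 := sub_pos.2 ht.1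
    have h2 := sub_pos.2 ht.2
    simp only [β]
    positivity
  set l := (J - ∫ t in a..b, P n t) / ∫ t in a..b, β t with hl
  have hl0 : 0 ≤ l := div_nonneg (by linarith) hβi.le
  have hder : ∀ t, HasDerivAt (fun t => P n t + l * β t)
      (((2 * ((b - t) / (b - a)) * (-1 / (b - a))) * p₀ *
          Real.exp (k₀ * (t - a) - n * (t - a) ^ 2) +
        ((b - t) / (b - a)) ^ 2 * p₀ * (Real.exp (k₀ * (t - a) - n * (t - a) ^ 2) *
          (k₀ - n * (2 * (t - a)))) +
        ((2 * ((t - a) / (b - a)) * (1 / (b - a))) * p₁ *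
          Real.exp (k₁ * (t - b) - n * (t - b) ^ 2) +
        ((t - a) / (b - a)) ^ 2 * p₁ * (Real.exp (k₁ * (t - b) - n * (t - b) ^ 2) *
          (k₁ - n * (2 * (t - b)))))) +
        l * (2 * (t - a) * (b - t) ^ 2 + (t - a) ^ 2 * (2 * (b - t) * (-1)))) t := by
    intro t
    have i1 : ∀ c : ℝ, HasDerivAt (fun t => t - c) 1 t := fun c => (hasDerivAt_id t).sub_const c
    have i2 : HasDerivAt (fun t => b - t) (-1) t := (hasDerivAt_id t).const_sub b
    have e : ∀ k c : ℝ, HasDerivAt (fun t => Real.exp (k * (t - c) - n * (t - c) ^ 2))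
        (Real.exp (k * (t - c) - n * (t - c) ^ 2) * (k - n * (2 * (t - c)))) t := fun k c => by
      refine (((i1 c).const_mul k).fun_sub (((i1 c).fun_pow 2).const_mul (n : ℝ))).exp.congr_deriv ?_
      simp
    have d1 := ((((i2.div_const (b - a)).fun_pow 2).mul_const p₀).fun_mul (e k₀ a))
    have d2 := (((((i1 a).div_const (b - a)).fun_pow 2).mul_const p₁).fun_mul (e k₁ b))
    have d3 := (((i1 a).fun_pow 2).fun_mul (i2.fun_pow 2)).const_mul l
    refine ((d1.fun_add d2).fun_add d3).congr_deriv ?_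
    simp
  refine ⟨fun t => P n t + l * β t, (hPsm n).add (contDiff_const.mul hβ), fun t => ?_, ?_, ?_, ?_,
    ?_, ?_⟩
  · have := hPpos n t
    have := mul_nonneg hl0 (hβ0 t)
    positivity
  · simp [P, β, hd.ne']
  · simp [P, β, hd.ne']
  · refine (hder a).congr_deriv ?_
    simp [hd.ne', hk₀]
    field_simp
    ring
  · refine (hder b).congr_deriv ?_
    simp [hd.ne', hk₁]
    field_simp
    ring
  · rw [intervalIntegral.integral_add ((hPsm n).continuous.intervalIntegrable _ _)
      ((hβ.continuous.intervalIntegrable _ _).const_mul l), intervalIntegral.integral_const_mul, hl,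
      div_mul_cancel₀ _ hβi.ne']
    ring

/-- `v'' = q v` on the whole line, in the classical sense, with `w = v'`. -/
structure IsClassicalSol (q v w : ℝ → ℝ) : Prop where
  deriv_v : ∀ t, HasDerivAt v (w t) t
  deriv_w : ∀ t, HasDerivAt w (q t * v t) t

lemma IsClassicalSol.isSolOn {q v w : ℝ → ℝ} (h : IsClassicalSol q v w) (hq : Continuous q)
    (a b : ℝ) : IsSolOn q a b v w := by
  have hv : Continuous v := continuous_iff_continuousAt.2 fun t => (h.deriv_v t).continuousAt
  have hw : Continuous w := continuous_iff_continuousAt.2 fun t => (h.deriv_w t).continuousAt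
  refine ⟨hv.continuousOn, hw.continuousOn, fun t _ => ?_, fun t _ => ?_⟩
  · rw [intervalIntegral.integral_eq_sub_of_hasDerivAt (fun t _ => h.deriv_v t)
      (hw.intervalIntegrable _ _)]
    ring
  · rw [intervalIntegral.integral_eq_sub_of_hasDerivAt (fun t _ => h.deriv_w t)
      ((hq.mul hv).intervalIntegrable _ _)]
    ring

/-- Two matrices with lifted row angles `α₀ < α₁` are joined over `[a, b]` by a solution that turns
by `α₁ - α₀`. -/
lemma exists_steering {a b α₀ α₁ : ℝ} (hab : a < b) (hα : α₀ < α₁) {M N : SL(2, ℝ)}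
    (hM₁ : M 0 0 = √(M 0 0 ^ 2 + M 0 1 ^ 2) * Real.cos α₀)
    (hM₂ : M 0 1 = √(M 0 0 ^ 2 + M 0 1 ^ 2) * Real.sin α₀)
    (hN₁ : N 0 0 = √(N 0 0 ^ 2 + N 0 1 ^ 2) * Real.cos α₁)
    (hN₂ : N 0 1 = √(N 0 0 ^ 2 + N 0 1 ^ 2) * Real.sin α₁) :
    ∃ q v₁ w₁ v₂ w₂ : ℝ → ℝ, Continuous q ∧ IsClassicalSol q v₁ w₁ ∧ IsClassicalSol q v₂ w₂ ∧
      (v₁ a = M 0 0 ∧ w₁ a = M 1 0 ∧ v₂ a = M 0 1 ∧ w₂ a = M 1 1) ∧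
      (v₁ b = N 0 0 ∧ w₁ b = N 1 0 ∧ v₂ b = N 0 1 ∧ w₂ b = N 1 1) ∧
      ∫ t in a..b, 1 / (v₁ t ^ 2 + v₂ t ^ 2) = α₁ - α₀ := by
  have hpM := row_sq_pos M
  have hpN := row_sq_pos N
  obtain ⟨p, hp, hpos, hpa, hpb, hda, hdb, hint⟩ := exists_pos_jets_integral hab
    (one_div_pos.2 hpM) (one_div_pos.2 hpN)
    (-2 * (M 0 0 * M 1 0 + M 0 1 * M 1 1) / (M 0 0 ^ 2 + M 0 1 ^ 2) ^ 2)
    (-2 * (N 0 0 * N 1 0 + N 0 1 * N 1 1) / (N 0 0 ^ 2 + N 0 1 ^ 2) ^ 2) (sub_pos.2 hα)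
  -- The row is sought as `R (cos α, sin α)` with `α' = p`. Wronskian 1 means `R² p = 1`, which
  -- makes the tangential acceleration `2 R' α' + R α''` vanish. What is left is radial, so both
  -- components solve `v'' = q v` with `q = R'' / R - p²`.
  let R : ℝ → ℝ := fun t => 1 / √(p t)
  have hsp : ∀ t, 0 < √(p t) := fun t => Real.sqrt_pos.2 (hpos t)
  have hR : ContDiff ℝ ∞ R :=
    contDiff_const.div (hp.sqrt fun t => (hpos t).ne') fun t => (hsp t).ne'
  have hR0 : ∀ t, 0 < R t := fun t => one_div_pos.2 (hsp t)
  have hRp : ∀ t, R t ^ 2 * p t = 1 := fun t => by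
    simp only [R]
    rw [div_pow, Real.sq_sqrt (hpos t).le, one_pow, one_div, inv_mul_cancel₀ (hpos t).ne']
  have hR1 : ∀ t, HasDerivAt R (deriv R t) t := fun t =>
    (hR.differentiable (by simp) t).hasDerivAt
  have hR' : ContDiff ℝ ∞ (deriv R) := (contDiff_infty_iff_deriv.1 hR).2
  have hR2 : ∀ t, HasDerivAt (deriv R) (deriv (deriv R) t) t := fun t =>
    (hR'.differentiable (by simp) t).hasDerivAt
  have hR'' : Continuous (deriv (deriv R)) := ((contDiff_infty_iff_deriv.1 hR').2).continuous
  have hRjet : ∀ {t s : ℝ}, HasDerivAt p s t → deriv R t = -(s * R t ^ 3) / 2 := fun {t s} h => by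
    have h1 : HasDerivAt R _ t := (h.sqrt (hpos t).ne').fun_inv (hsp t).ne' |>.congr_of_eventuallyEq
      (Filter.Eventually.of_forall fun t => by simp [R])
    rw [h1.deriv]
    have := (hsp t).ne'
    simp only [R]
    field_simp
  let α : ℝ → ℝ := fun t => α₀ + ∫ s in a..t, p s
  have hα1 : ∀ t, HasDerivAt α (p t) t := fun t =>
    (intervalIntegral.integral_hasDerivAt_right (hp.continuous.intervalIntegrable _ _)
      (hp.continuous.stronglyMeasurableAtFilter _ _) hp.continuous.continuousAt).const_add α₀
  have hαa : α a = α₀ := by simp [α]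
  have hαb : α b = α₁ := by simp only [α]; rw [hint]; ring
  have hcont : Continuous fun t => deriv (deriv R) t / R t - p t ^ 2 :=
    (hR''.div hR.continuous fun t => (hR0 t).ne').sub (hp.continuous.pow 2)
  -- The second row must be the derivative of the first. Its radial component is `R'`, which the
  -- slope of `p` encodes, and its tangential component is forced by the determinant. Thus a 1-jet
  -- of `p` and an angle determine the matrix.
  have hjets : ∀ {t β : ℝ} {K : SL(2, ℝ)}, K 0 0 = √(K 0 0 ^ 2 + K 0 1 ^ 2) * Real.cos β →
      K 0 1 = √(K 0 0 ^ 2 + K 0 1 ^ 2) * Real.sin β → α t = β → p t = 1 / (K 0 0 ^ 2 + K 0 1 ^ 2) →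
      HasDerivAt p (-2 * (K 0 0 * K 1 0 + K 0 1 * K 1 1) / (K 0 0 ^ 2 + K 0 1 ^ 2) ^ 2) t →
      R t * Real.cos (α t) = K 0 0 ∧ deriv R t * Real.cos (α t) - R t * p t * Real.sin (α t) = K 1 0 ∧
      R t * Real.sin (α t) = K 0 1 ∧
      deriv R t * Real.sin (α t) + R t * p t * Real.cos (α t) = K 1 1 := by
    intro t β K h1 h2 hβ hpt hpd
    have hK := row_sq_pos K
    have hRt : R t = √(K 0 0 ^ 2 + K 0 1 ^ 2) := by
      simp only [R]; rw [hpt, Real.sqrt_div zero_le_one, Real.sqrt_one, one_div_one_div]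
    have hr := Real.sq_sqrt hK.le
    have hd := det_eq K
    rw [hRjet hpd, hpt, hβ, hRt, ← hr]
    have hr0 := (Real.sqrt_pos.2 hK).ne'
    rw [Real.sqrt_sq (Real.sqrt_nonneg _)]
    set r := √(K 0 0 ^ 2 + K 0 1 ^ 2)
    have hsq := Real.sin_sq_add_cos_sq β
    refine ⟨h1.symm, ?_, h2.symm, ?_⟩
    · have hc : Real.cos β = K 0 0 / r := by rw [h1]; field_simp
      have hs : Real.sin β = K 0 1 / r := by rw [h2]; field_simp
      rw [hc, hs]
      field_simp
      linear_combination (K 0 1) * hd - K 1 0 * hr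
    · have hc : Real.cos β = K 0 0 / r := by rw [h1]; field_simp
      have hs : Real.sin β = K 0 1 / r := by rw [h2]; field_simp
      rw [hc, hs]
      field_simp
      linear_combination (-K 0 0) * hd - K 1 1 * hr
  refine ⟨fun t => deriv (deriv R) t / R t - p t ^ 2,
    fun t => R t * Real.cos (α t), fun t => deriv R t * Real.cos (α t) - R t * p t * Real.sin (α t),
    fun t => R t * Real.sin (α t), fun t => deriv R t * Real.sin (α t) + R t * p t * Real.cos (α t),
    hcont, ⟨fun t => ?_, fun t => ?_⟩, ⟨fun t => ?_, fun t => ?_⟩, hjets hM₁ hM₂ hαa hpa hda,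
    hjets hN₁ hN₂ hαb hpb hdb, ?_⟩
  · refine ((hR1 t).fun_mul (hα1 t).cos).congr_deriv ?_
    ring
  · have hinv : ∀ t, R t * p t = 1 / R t := fun t => by
      rw [eq_div_iff (hR0 t).ne']; linear_combination hRp t
    simp only [hinv]
    refine (((hR2 t).fun_mul (hα1 t).cos).fun_sub
      (((hasDerivAt_const t (1 : ℝ)).fun_div (hR1 t) (hR0 t).ne').fun_mul (hα1 t).sin)).congr_deriv ?_
    have h0 := (hR0 t).ne'
    have h1 : p t = 1 / R t ^ 2 := by rw [eq_div_iff (by positivity)]; linear_combination hRp t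
    rw [h1]
    field_simp
    ring
  · refine ((hR1 t).fun_mul (hα1 t).sin).congr_deriv ?_
    ring
  · have hinv : ∀ t, R t * p t = 1 / R t := fun t => by
      rw [eq_div_iff (hR0 t).ne']; linear_combination hRp t
    simp only [hinv]
    refine (((hR2 t).fun_mul (hα1 t).sin).fun_add
      (((hasDerivAt_const t (1 : ℝ)).fun_div (hR1 t) (hR0 t).ne').fun_mul (hα1 t).cos)).congr_deriv ?_
    have h0 := (hR0 t).ne'
    have h1 : p t = 1 / R t ^ 2 := by rw [eq_div_iff (by positivity)]; linear_combination hRp t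
    rw [h1]
    field_simp
    ring
  · rw [← hint]
    refine intervalIntegral.integral_congr fun t _ => ?_
    change 1 / ((R t * Real.cos (α t)) ^ 2 + (R t * Real.sin (α t)) ^ 2) = p t
    have h0 := (hR0 t).ne'
    rw [div_eq_iff]
    · linear_combination (-p t * R t ^ 2) * Real.sin_sq_add_cos_sq (α t) - hRp t
    · have : (R t * Real.cos (α t)) ^ 2 + (R t * Real.sin (α t)) ^ 2 = R t ^ 2 := by
        linear_combination (R t ^ 2) * Real.sin_sq_add_cos_sq (α t)
      rw [this]
      positivity

lemma hasDerivAt_cosh_mul (κ t : ℝ) :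
    HasDerivAt (fun t => Real.cosh (κ * t)) (κ * Real.sinh (κ * t)) t := by
  have h1 : HasDerivAt (fun t => κ * t) (κ * 1) t := (hasDerivAt_id t).const_mul κ
  refine h1.cosh.congr_deriv ?_
  ring

lemma hasDerivAt_sinh_mul (κ t : ℝ) :
    HasDerivAt (fun t => Real.sinh (κ * t)) (κ * Real.cosh (κ * t)) t := by
  have h1 : HasDerivAt (fun t => κ * t) (κ * 1) t := (hasDerivAt_id t).const_mul κ
  refine h1.sinh.congr_deriv ?_
  ring

lemma isClassicalSol_cosh (κ : ℝ) : IsClassicalSol (fun _ => κ ^ 2) (fun t => Real.cosh (κ * t))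
    fun t => κ * Real.sinh (κ * t) :=
  ⟨hasDerivAt_cosh_mul κ, fun t => ((hasDerivAt_sinh_mul κ t).const_mul κ).congr_deriv (by ring)⟩

lemma isClassicalSol_sinh {κ : ℝ} (hκ : 0 < κ) : IsClassicalSol (fun _ => κ ^ 2)
    (fun t => Real.sinh (κ * t) / κ) fun t => Real.cosh (κ * t) :=
  ⟨fun t => ((hasDerivAt_sinh_mul κ t).div_const κ).congr_deriv (by field_simp),
    fun t => (hasDerivAt_cosh_mul κ t).congr_deriv (by field_simp)⟩

/-- The flow of `v'' = κ² v`. -/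
noncomputable def hypFlow (κ : ℝ) (hκ : 0 < κ) (t : ℝ) : SL(2, ℝ) :=
  ⟨!![Real.cosh (κ * t), Real.sinh (κ * t) / κ; κ * Real.sinh (κ * t), Real.cosh (κ * t)], by
    rw [Matrix.det_fin_two_of]
    field_simp
    linear_combination Real.cosh_sq (κ * t)⟩

/-- A target matrix with positive lifted row angle is reached exactly by a potential that is
constant near the left end. -/
lemma exists_exact_potential {κ A : ℝ} (hκ : 0 < κ) (hA : 0 < A) {T : SL(2, ℝ)}
    (hT₁ : T 0 0 = √(T 0 0 ^ 2 + T 0 1 ^ 2) * Real.cos A)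
    (hT₂ : T 0 1 = √(T 0 0 ^ 2 + T 0 1 ^ 2) * Real.sin A) :
    ∃ (δ L : ℝ) (q : ℝ → ℝ) (Φ : ℝ → SL(2, ℝ)), 0 < δ ∧ δ < 2 * Real.pi ∧ Measurable q ∧
      (∀ t, |q t| ≤ L) ∧ (∀ t ≤ δ, q t = κ ^ 2) ∧ IsFundamentalMatrix q Φ ∧
      Φ (2 * Real.pi) = T ∧ totalAngle Φ = A := by
  have hpi := Real.pi_gt_three
  -- On `[0, δ]` the row turns with speed at most 1, so it uses at most `A / 2` of the angle and a
  -- positive amount remains for the steering.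
  set δ := min 1 (A / 2) with hδ
  have hδ0 : 0 < δ := lt_min one_pos (by positivity)
  have hδ2 : δ < 2 * Real.pi := (min_le_left _ _).trans_lt (by linarith)
  have hδA : δ < A := (min_le_right _ _).trans_lt (by linarith)
  set α₀ := ∫ s in (0 : ℝ)..δ, 1 / (Real.cosh (κ * s) ^ 2 + (Real.sinh (κ * s) / κ) ^ 2) with hα₀
  have hge : ∀ s, 1 ≤ Real.cosh (κ * s) ^ 2 + (Real.sinh (κ * s) / κ) ^ 2 := fun s => by
    nlinarith [Real.one_le_cosh (κ * s), sq_nonneg (Real.sinh (κ * s) / κ)]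
  have hcont : Continuous fun s => 1 / (Real.cosh (κ * s) ^ 2 + (Real.sinh (κ * s) / κ) ^ 2) :=
    Continuous.div continuous_const (by fun_prop) fun s => (zero_lt_one.trans_le (hge s)).ne'
  have hα₀A : α₀ < A := by
    have h1 : α₀ ≤ ∫ s in (0 : ℝ)..δ, (1 : ℝ) :=
      intervalIntegral.integral_mono_on hδ0.le (hcont.intervalIntegrable _ _) (by simp)
        fun s _ => (div_le_one (zero_lt_one.trans_le (hge s))).2 (hge s)
    simp at h1
    linarith
  have hC := (isClassicalSol_cosh κ).isSolOn continuous_const 0 δ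
  have hS := (isClassicalSol_sinh hκ).isSolOn continuous_const 0 δ
  have hpol := polar_of_wronskian (α₀ := 0) hC.cont_v hS.cont_v (fun t ht => hC.hasDerivAt ht)
    (fun t ht => hS.hasDerivAt ht) (fun t _ => det_eq (hypFlow κ hκ t)) (by simp) (by simp) δ
    ⟨hδ0.le, le_rfl⟩
  rw [zero_add, ← hα₀] at hpol
  obtain ⟨p, v₁, w₁, v₂, w₂, hp, h₁, h₂, ⟨i1, i2, i3, i4⟩, ⟨e1, e2, e3, e4⟩, hint⟩ :=
    exists_steering (M := hypFlow κ hκ δ) hδ2 hα₀A hpol.1 hpol.2 hT₁ hT₂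
  obtain ⟨B, hB⟩ := isCompact_Icc.exists_bound_of_continuousOn (hp.continuousOn (s := Icc δ (2 * Real.pi)))
  -- The projection freezes `p` beyond `2π`, which makes `q` bounded on the whole line.
  let q : ℝ → ℝ := fun t => if t ≤ δ then κ ^ 2 else p (projIcc δ (2 * Real.pi) hδ2.le t)
  have hq : Measurable q := Measurable.ite measurableSet_Iic measurable_const
    (hp.measurable.comp (continuous_subtype_val.comp continuous_projIcc).measurable)
  have hL : ∀ t, |q t| ≤ max (κ ^ 2) B := fun t => by
    simp only [q]
    split_ifs
    · rw [abs_of_nonneg (sq_nonneg κ)]; exact le_max_left _ _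
    · exact (hB _ (Subtype.prop _)).trans (le_max_right _ _)
  have hqδ : ∀ t ≤ δ, q t = κ ^ 2 := fun t ht => if_pos ht
  obtain ⟨Φ, hΦ⟩ := exists_isFundamentalMatrix hq hL
  have hq1 : ∀ᵐ t, t ∈ Icc 0 δ → (fun _ => κ ^ 2) t = q t :=
    Filter.Eventually.of_forall fun t ht => (hqδ t ht.2).symm
  have hq2 : ∀ᵐ t, t ∈ Icc δ (2 * Real.pi) → p t = q t := by
    filter_upwards [Measure.ae_ne volume δ] with t ht1 ht
    have : ¬ t ≤ δ := not_le.2 (lt_of_le_of_ne ht.1 ht1.symm)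
    simp only [q, if_neg this, projIcc_of_mem hδ2.le ht]
  have c1 := (hΦ.isSolOn₁.mono hq hL le_rfl hδ0.le hδ2.le).unique (hC.congr_ae hq1) hq hL
    (by simp [hΦ.initial]) (by simp [hΦ.initial])
  have c2 := (hΦ.isSolOn₂.mono hq hL le_rfl hδ0.le hδ2.le).unique (hS.congr_ae hq1) hq hL
    (by simp [hΦ.initial]) (by simp [hΦ.initial])
  have hδm : δ ∈ Icc 0 δ := ⟨hδ0.le, le_rfl⟩
  have d1 := (hΦ.isSolOn₁.mono hq hL hδ0.le hδ2.le le_rfl).unique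
    ((h₁.isSolOn hp δ (2 * Real.pi)).congr_ae hq2) hq hL
    ((c1 δ hδm).1.trans i1.symm) ((c1 δ hδm).2.trans i2.symm)
  have d2 := (hΦ.isSolOn₂.mono hq hL hδ0.le hδ2.le le_rfl).unique
    ((h₂.isSolOn hp δ (2 * Real.pi)).congr_ae hq2) hq hL
    ((c2 δ hδm).1.trans i3.symm) ((c2 δ hδm).2.trans i4.symm)
  have hem : 2 * Real.pi ∈ Icc δ (2 * Real.pi) := ⟨hδ2.le, le_rfl⟩
  refine ⟨δ, _, q, Φ, hδ0, hδ2, hq, hL, hqδ, hΦ, ?_, ?_⟩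
  · ext i j
    fin_cases i <;> fin_cases j
    exacts [(d1 _ hem).1.trans e1, (d2 _ hem).1.trans e3, (d1 _ hem).2.trans e2,
      (d2 _ hem).2.trans e4]
  · have hi : ∀ {x y : ℝ}, 0 ≤ x → x ≤ y → y ≤ 2 * Real.pi → IntervalIntegrable
        (fun s => 1 / (Φ s 0 0 ^ 2 + Φ s 0 1 ^ 2)) volume x y := fun {x y} hx hxy hy => by
      refine ContinuousOn.intervalIntegrable (hΦ.continuousOn_angle.mono ?_)
      rw [uIcc_of_le hxy]
      exact Icc_subset_Icc hx hy
    rw [totalAngle, ← intervalIntegral.integral_add_adjacent_intervals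
      (hi le_rfl hδ0.le hδ2.le) (hi hδ0.le hδ2.le le_rfl)]
    have j1 : ∫ s in (0 : ℝ)..δ, 1 / (Φ s 0 0 ^ 2 + Φ s 0 1 ^ 2) = α₀ := by
      refine intervalIntegral.integral_congr fun s hs => ?_
      rw [uIcc_of_le hδ0.le] at hs
      simp only [(c1 s hs).1, (c2 s hs).1]
    have j2 : ∫ s in δ..2 * Real.pi, 1 / (Φ s 0 0 ^ 2 + Φ s 0 1 ^ 2) = A - α₀ := by
      rw [← hint]
      refine intervalIntegral.integral_congr fun s hs => ?_
      rw [uIcc_of_le hδ2.le] at hs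
      simp only [(d1 s hs).1, (d2 s hs).1]
    rw [j1, j2]
    ring

/-! ### Small perturbations of a constant potential -/

/-- The function `tanh (κ t) / κ`, the projective coordinate of the flow of `v'' = κ² v`. -/
noncomputable def hypCoord (κ t : ℝ) : ℝ := Real.sinh (κ * t) / (κ * Real.cosh (κ * t))

lemma hasDerivAt_hypCoord {κ : ℝ} (hκ : 0 < κ) (t : ℝ) :
    HasDerivAt (hypCoord κ) (1 / Real.cosh (κ * t) ^ 2) t := by
  have hc := Real.cosh_pos (κ * t)
  refine ((hasDerivAt_sinh_mul κ t).fun_div ((hasDerivAt_cosh_mul κ t).const_mul κ)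
    (by positivity)).congr_deriv ?_
  field_simp
  linear_combination Real.cosh_sq (κ * t)

lemma strictMono_hypCoord {κ : ℝ} (hκ : 0 < κ) : StrictMono (hypCoord κ) := by
  refine strictMono_of_deriv_pos fun t => ?_
  rw [(hasDerivAt_hypCoord hκ t).deriv]
  have hc := Real.cosh_pos (κ * t)
  positivity

lemma hypCoord_zero (κ : ℝ) : hypCoord κ 0 = 0 := by simp [hypCoord]

/-- The coordinate never leaves a compact interval, so estimates that hold near `K = 1` on this
interval hold uniformly for all times. -/
lemma hypCoord_mem {κ : ℝ} (hκ : 0 < κ) (t : ℝ) : hypCoord κ t ∈ Icc (-(1 / κ)) (1 / κ) := by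
  have hc := Real.cosh_pos (κ * t)
  have h1 : |Real.sinh (κ * t)| ≤ Real.cosh (κ * t) := by
    refine abs_le_of_sq_le_sq ?_ hc.le
    linarith [Real.cosh_sq (κ * t)]
  rw [mem_Icc, ← abs_le, hypCoord, abs_div, abs_mul, abs_of_pos hκ, abs_of_pos hc,
    div_le_div_iff₀ (by positivity) hκ]
  nlinarith

lemma contDiff_hypCoord {κ : ℝ} (hκ : 0 < κ) : ContDiff ℝ ∞ (hypCoord κ) := by
  have h1 : ContDiff ℝ ∞ fun t : ℝ => κ * t := contDiff_const.mul contDiff_id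
  exact h1.sinh.div (contDiff_const.mul h1.cosh) fun t =>
    (mul_pos hκ (Real.cosh_pos _)).ne'

/-- Liouville's change of variables from `V'' = P V` to `v'' = (κ² + P / cosh⁴) v`. -/
lemma IsClassicalSol.of_hypCoord {κ : ℝ} (hκ : 0 < κ) {P V V' : ℝ → ℝ}
    (hV : ∀ t, HasDerivAt V (V' (hypCoord κ t)) (hypCoord κ t))
    (hV' : ∀ t, HasDerivAt V' (P (hypCoord κ t) * V (hypCoord κ t)) (hypCoord κ t)) :
    IsClassicalSol (fun t => κ ^ 2 + P (hypCoord κ t) / Real.cosh (κ * t) ^ 4)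
      (fun t => Real.cosh (κ * t) * V (hypCoord κ t))
      fun t => κ * Real.sinh (κ * t) * V (hypCoord κ t) +
        V' (hypCoord κ t) / Real.cosh (κ * t) := by
  constructor
  · intro t
    have hc := Real.cosh_pos (κ * t)
    have h := (hV t).comp t (hasDerivAt_hypCoord hκ t)
    refine ((hasDerivAt_cosh_mul κ t).fun_mul h).congr_deriv ?_
    simp only [Function.comp]
    field_simp
  · intro t
    have hc := Real.cosh_pos (κ * t)
    have h := (hV t).comp t (hasDerivAt_hypCoord hκ t)
    have h' := (hV' t).comp t (hasDerivAt_hypCoord hκ t)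
    refine ((((hasDerivAt_sinh_mul κ t).const_mul κ).fun_mul h).fun_add
      (h'.fun_div (hasDerivAt_cosh_mul κ t) hc.ne')).congr_deriv ?_
    simp only [Function.comp]
    field_simp
    ring

/-- `V = (H')^{-1/2}` and `H V` solve `V'' = P V` where `-2 P` is the Schwarzian derivative
of `H`. -/
lemma hasDerivAt_of_schwarzian {H H₁ H₂ H₃ : ℝ → ℝ} {x : ℝ} (h₀ : HasDerivAt H (H₁ x) x)
    (h₁ : HasDerivAt H₁ (H₂ x) x) (h₂ : HasDerivAt H₂ (H₃ x) x) (hpos : 0 < H₁ x) :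
    (HasDerivAt (fun x => 1 / √(H₁ x)) (-H₂ x / (2 * H₁ x * √(H₁ x))) x ∧
      HasDerivAt (fun x => -H₂ x / (2 * H₁ x * √(H₁ x)))
        ((-H₃ x / (2 * H₁ x) + 3 / 4 * (H₂ x / H₁ x) ^ 2) * (1 / √(H₁ x))) x) ∧
    (HasDerivAt (fun x => H x / √(H₁ x)) (√(H₁ x) - H x * H₂ x / (2 * H₁ x * √(H₁ x))) x ∧
      HasDerivAt (fun x => √(H₁ x) - H x * H₂ x / (2 * H₁ x * √(H₁ x)))
        ((-H₃ x / (2 * H₁ x) + 3 / 4 * (H₂ x / H₁ x) ^ 2) * (H x / √(H₁ x))) x) := by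
  have hs := h₁.sqrt hpos.ne'
  have hr : 0 < √(H₁ x) := Real.sqrt_pos.2 hpos
  have hr2 : √(H₁ x) ^ 2 = H₁ x := Real.sq_sqrt hpos.le
  have hden : 2 * H₁ x * √(H₁ x) ≠ 0 := by positivity
  have hd := (h₁.const_mul 2).fun_mul hs
  refine ⟨⟨?_, ?_⟩, ?_, ?_⟩
  · refine ((hasDerivAt_const x (1 : ℝ)).fun_div hs hr.ne').congr_deriv ?_
    rw [hr2]
    field_simp
    ring
  · refine (h₂.fun_neg.fun_div hd hden).congr_deriv ?_
    field_simp
    rw [hr2]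
    ring
  · refine (h₀.fun_div hs hr.ne').congr_deriv ?_
    field_simp
    rw [hr2]
  · refine (hs.fun_sub ((h₀.fun_mul h₂).fun_div hd hden)).congr_deriv ?_
    field_simp
    rw [hr2]
    ring

/-- The derivatives are tracked up to order three because a Schwarzian derivative will be formed.
The transition takes place in `[X/3, 2X/3]`, so all of them vanish at `0` and `X` themselves. -/
lemma exists_cutoff {X : ℝ} (hX : 0 < X) :
    ∃ χ χ₁ χ₂ χ₃ : ℝ → ℝ, ContDiff ℝ ∞ χ ∧ ContDiff ℝ ∞ χ₁ ∧ ContDiff ℝ ∞ χ₂ ∧ ContDiff ℝ ∞ χ₃ ∧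
      (∀ x, HasDerivAt χ (χ₁ x) x) ∧ (∀ x, HasDerivAt χ₁ (χ₂ x) x) ∧
      (∀ x, HasDerivAt χ₂ (χ₃ x) x) ∧
      (∀ x ≤ 0, χ x = 0 ∧ χ₁ x = 0 ∧ χ₂ x = 0 ∧ χ₃ x = 0) ∧
      ∀ x, X ≤ x → χ x = 1 ∧ χ₁ x = 0 ∧ χ₂ x = 0 ∧ χ₃ x = 0 := by
  let χ : ℝ → ℝ := fun x => Real.smoothTransition (3 * x / X - 1)
  have hχ : ContDiff ℝ ∞ χ := Real.smoothTransition.contDiff.comp (by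
    simp only [div_eq_mul_inv]; fun_prop)
  have h1 := (contDiff_infty_iff_deriv.1 hχ).2
  have h2 := (contDiff_infty_iff_deriv.1 h1).2
  have h3 := (contDiff_infty_iff_deriv.1 h2).2
  have hd : ∀ {g : ℝ → ℝ}, ContDiff ℝ ∞ g → ∀ x, HasDerivAt g (deriv g x) x := fun hg x =>
    (hg.differentiable (by simp) x).hasDerivAt
  have key : ∀ {x c : ℝ}, (∀ᶠ y in 𝓝 x, χ y = c) →
      χ x = c ∧ deriv χ x = 0 ∧ deriv (deriv χ) x = 0 ∧ deriv (deriv (deriv χ)) x = 0 := by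
    intro x c h
    have e0 : χ =ᶠ[𝓝 x] fun _ => c := h
    have e1 : deriv χ =ᶠ[𝓝 x] fun _ => 0 := by simpa using e0.deriv
    have e2 : deriv (deriv χ) =ᶠ[𝓝 x] fun _ => 0 := by simpa using e1.deriv
    have e3 : deriv (deriv (deriv χ)) =ᶠ[𝓝 x] fun _ => 0 := by simpa using e2.deriv
    exact ⟨e0.eq_of_nhds, e1.eq_of_nhds, e2.eq_of_nhds, e3.eq_of_nhds⟩
  refine ⟨χ, deriv χ, deriv (deriv χ), deriv (deriv (deriv χ)), hχ, h1, h2, h3, hd hχ, hd h1,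
    hd h2, fun x hx => key ?_, fun x hx => key ?_⟩
  · filter_upwards [gt_mem_nhds (show x < X / 3 by linarith)] with y hy
    refine Real.smoothTransition.zero_of_nonpos ?_
    rw [sub_nonpos, div_le_one hX]
    linarith
  · filter_upwards [lt_mem_nhds (show 2 * X / 3 < x by linarith)] with y hy
    refine Real.smoothTransition.one_of_one_le ?_
    rw [le_sub_iff_add_le, le_div_iff₀ hX]
    linarith

/-- Every matrix `K` near the identity is a correction that a small perturbation of the constant
potential `κ²`, supported in `[0, τ]`, makes to the flow. -/
lemma eventually_exists_correction {κ τ η : ℝ} (hκ : 0 < κ) (hτ : 0 < τ) (hη : 0 < η) :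
    ∀ᶠ K in 𝓝 (1 : SL(2, ℝ)), ∃ q v₁ w₁ v₂ w₂ : ℝ → ℝ, ContDiff ℝ ∞ q ∧
      (∀ t, |q t - κ ^ 2| < η) ∧ (∀ t, t ∉ Ioo 0 τ → q t = κ ^ 2) ∧
      IsClassicalSol q v₁ w₁ ∧ IsClassicalSol q v₂ w₂ ∧
      (v₁ 0 = 1 ∧ w₁ 0 = 0 ∧ v₂ 0 = 0 ∧ w₂ 0 = 1) ∧
      (v₁ τ = (hypFlow κ hκ τ * K) 0 0 ∧ w₁ τ = (hypFlow κ hκ τ * K) 1 0 ∧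
        v₂ τ = (hypFlow κ hκ τ * K) 0 1 ∧ w₂ τ = (hypFlow κ hκ τ * K) 1 1) := by
  set X := hypCoord κ τ with hXdef
  have hX : 0 < X := by rw [← hypCoord_zero κ]; exact strictMono_hypCoord hκ hτ
  obtain ⟨χ, χ₁, χ₂, χ₃, s0, s1, s2, s3, d0, d1, d2, hlo, hhi⟩ := exists_cutoff hX
  -- In the coordinate `x` the ratio `v₂ / v₁` is `x` for the flow itself, and the Möbius map `(K 0
  -- 1 + K 1 1 x) / D` for the flow times `K`. `H` interpolates between the two with the cutoff, `E`
  -- is their difference, and `P` is `-1/2` times the Schwarzian derivative of `H`.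
  let D : SL(2, ℝ) → ℝ → ℝ := fun K x => K 0 0 + K 1 0 * x
  let E : SL(2, ℝ) → ℝ → ℝ := fun K x => (K 0 1 + K 1 1 * x) / D K x - x
  let E₁ : SL(2, ℝ) → ℝ → ℝ := fun K x => 1 / D K x ^ 2 - 1
  let E₂ : SL(2, ℝ) → ℝ → ℝ := fun K x => -2 * K 1 0 / D K x ^ 3
  let E₃ : SL(2, ℝ) → ℝ → ℝ := fun K x => 6 * K 1 0 ^ 2 / D K x ^ 4
  let H : SL(2, ℝ) → ℝ → ℝ := fun K x => x + χ x * E K x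
  let H₁ : SL(2, ℝ) → ℝ → ℝ := fun K x => 1 + (χ₁ x * E K x + χ x * E₁ K x)
  let H₂ : SL(2, ℝ) → ℝ → ℝ := fun K x => χ₂ x * E K x + 2 * χ₁ x * E₁ K x + χ x * E₂ K x
  let H₃ : SL(2, ℝ) → ℝ → ℝ := fun K x =>
    χ₃ x * E K x + 3 * χ₂ x * E₁ K x + 3 * χ₁ x * E₂ K x + χ x * E₃ K x
  let P : SL(2, ℝ) → ℝ → ℝ := fun K x =>
    -H₃ K x / (2 * H₁ K x) + 3 / 4 * (H₂ K x / H₁ K x) ^ 2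
  -- At `K = 1` one has `D = H₁ = 1` and `P = 0`; joint continuity in `(K, x)` and compactness give
  -- one neighbourhood of 1 for all `x`.
  have hev : ∀ᶠ K in 𝓝 (1 : SL(2, ℝ)), ∀ x ∈ Icc (-(1 / κ)) (1 / κ),
      0 < D K x ∧ 0 < H₁ K x ∧ |P K x| < η := by
    refine isCompact_Icc.eventually_forall_of_forall_eventually fun x _ => ?_
    have ce : ∀ i j, ContinuousAt (fun z : SL(2, ℝ) × ℝ => z.1 i j) (1, x) := fun i j =>
      ((continuous_entry i j).comp continuous_fst).continuousAt
    have cx : ContinuousAt (fun z : SL(2, ℝ) × ℝ => z.2) (1, x) := continuousAt_snd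
    have cD : ContinuousAt (fun z : SL(2, ℝ) × ℝ => D z.1 z.2) (1, x) :=
      (ce 0 0).add ((ce 1 0).mul cx)
    have vD : D 1 x = 1 := by simp [D]
    have vD0 : D 1 x ≠ 0 := by rw [vD]; exact one_ne_zero
    have cE : ContinuousAt (fun z : SL(2, ℝ) × ℝ => E z.1 z.2) (1, x) :=
      (((ce 0 1).add ((ce 1 1).mul cx)).div cD vD0).sub cx
    have cE₁ : ContinuousAt (fun z : SL(2, ℝ) × ℝ => E₁ z.1 z.2) (1, x) :=
      (continuousAt_const.div (cD.pow 2) (pow_ne_zero _ vD0)).sub continuousAt_const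
    have cE₂ : ContinuousAt (fun z : SL(2, ℝ) × ℝ => E₂ z.1 z.2) (1, x) :=
      (continuousAt_const.mul (ce 1 0)).div (cD.pow 3) (pow_ne_zero _ vD0)
    have cE₃ : ContinuousAt (fun z : SL(2, ℝ) × ℝ => E₃ z.1 z.2) (1, x) :=
      (continuousAt_const.mul ((ce 1 0).pow 2)).div (cD.pow 4) (pow_ne_zero _ vD0)
    have cχ : ∀ {g : ℝ → ℝ}, ContDiff ℝ ∞ g →
        ContinuousAt (fun z : SL(2, ℝ) × ℝ => g z.2) (1, x) := fun hg =>
      (hg.continuous.comp continuous_snd).continuousAt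
    have cH₁ : ContinuousAt (fun z : SL(2, ℝ) × ℝ => H₁ z.1 z.2) (1, x) :=
      continuousAt_const.add (((cχ s1).mul cE).add ((cχ s0).mul cE₁))
    have cH₂ : ContinuousAt (fun z : SL(2, ℝ) × ℝ => H₂ z.1 z.2) (1, x) :=
      (((cχ s2).mul cE).add ((continuousAt_const.mul (cχ s1)).mul cE₁)).add ((cχ s0).mul cE₂)
    have cH₃ : ContinuousAt (fun z : SL(2, ℝ) × ℝ => H₃ z.1 z.2) (1, x) :=
      ((((cχ s3).mul cE).add ((continuousAt_const.mul (cχ s2)).mul cE₁)).add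
        ((continuousAt_const.mul (cχ s1)).mul cE₂)).add ((cχ s0).mul cE₃)
    have vE : E 1 x = 0 := by simp [E, D]
    have vE₁ : E₁ 1 x = 0 := by simp [E₁, D]
    have vE₂ : E₂ 1 x = 0 := by simp [E₂, D]
    have vE₃ : E₃ 1 x = 0 := by simp [E₃, D]
    have vH₁ : H₁ 1 x = 1 := by simp [H₁, vE, vE₁]
    have vH₂ : H₂ 1 x = 0 := by simp [H₂, vE, vE₁, vE₂]
    have vH₃ : H₃ 1 x = 0 := by simp [H₃, vE, vE₁, vE₂, vE₃]
    have vP : P 1 x = 0 := by simp [P, vH₁, vH₂, vH₃]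
    have vH0 : H₁ 1 x ≠ 0 := by rw [vH₁]; exact one_ne_zero
    have cP : ContinuousAt (fun z : SL(2, ℝ) × ℝ => P z.1 z.2) (1, x) :=
      (cH₃.neg.div (continuousAt_const.mul cH₁) (mul_ne_zero two_ne_zero vH0)).add
        (continuousAt_const.mul ((cH₂.div cH₁ vH0).pow 2))
    refine (cD.eventually (lt_mem_nhds ?_)).and ((cH₁.eventually (lt_mem_nhds ?_)).and
      (cP.abs.eventually (gt_mem_nhds ?_)))
    · simp only [vD]; exact one_pos
    · simp only [vH₁]; exact one_pos
    · simp only [vP, abs_zero]; exact hη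
  filter_upwards [hev] with K hK
  have hdet := det_eq K
  have hD : ∀ t, 0 < D K (hypCoord κ t) := fun t => (hK _ (hypCoord_mem hκ t)).1
  have hH₁ : ∀ t, 0 < H₁ K (hypCoord κ t) := fun t => (hK _ (hypCoord_mem hκ t)).2.1
  have dD : ∀ x, HasDerivAt (D K) (K 1 0) x := fun x =>
    (((hasDerivAt_id x).const_mul (K 1 0)).const_add (K 0 0)).congr_deriv (mul_one _)
  have dE : ∀ {x}, D K x ≠ 0 → HasDerivAt (E K) (E₁ K x) x := fun {x} hx => by
    refine ((((hasDerivAt_id x).const_mul (K 1 1)).const_add (K 0 1)).fun_div (dD x) hx).fun_sub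
      (hasDerivAt_id x) |>.congr_deriv ?_
    simp only [E₁]
    congr 1
    congr 1
    simp only [D, id]
    linear_combination hdet
  have dE₁ : ∀ {x}, D K x ≠ 0 → HasDerivAt (E₁ K) (E₂ K x) x := fun {x} hx => by
    refine (((hasDerivAt_const x (1 : ℝ)).fun_div ((dD x).fun_pow 2)
      (pow_ne_zero 2 hx)).sub_const 1).congr_deriv ?_
    simp only [E₂]
    field_simp
    ring
  have dE₂ : ∀ {x}, D K x ≠ 0 → HasDerivAt (E₂ K) (E₃ K x) x := fun {x} hx => by
    refine (((hasDerivAt_const x (-2 * K 1 0)).fun_div ((dD x).fun_pow 3)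
      (pow_ne_zero 3 hx))).congr_deriv ?_
    simp only [E₃]
    field_simp
    ring
  have dH : ∀ {x}, D K x ≠ 0 → HasDerivAt (H K) (H₁ K x) x := fun {x} hx =>
    (hasDerivAt_id x).fun_add ((d0 x).fun_mul (dE hx))
  have dH₁ : ∀ {x}, D K x ≠ 0 → HasDerivAt (H₁ K) (H₂ K x) x := fun {x} hx => by
    refine ((((d1 x).fun_mul (dE hx)).fun_add ((d0 x).fun_mul (dE₁ hx))).const_add 1).congr_deriv ?_
    simp only [H₂]
    ring
  have dH₂ : ∀ {x}, D K x ≠ 0 → HasDerivAt (H₂ K) (H₃ K x) x := fun {x} hx => by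
    refine ((((d2 x).fun_mul (dE hx)).fun_add (((d1 x).const_mul 2).fun_mul (dE₁ hx))).fun_add
      ((d0 x).fun_mul (dE₂ hx))).congr_deriv ?_
    simp only [H₃]
    ring
  have hS := fun t => hasDerivAt_of_schwarzian (dH (hD t).ne') (dH₁ (hD t).ne') (dH₂ (hD t).ne')
    (hH₁ t)
  have hPlo : ∀ x ≤ 0, P K x = 0 := fun x hx => by
    obtain ⟨a0, a1, a2, a3⟩ := hlo x hx
    simp [P, H₂, H₃, a0, a1, a2, a3]
  have hHhi : ∀ x, X ≤ x → D K x ≠ 0 → H₁ K x = 1 / D K x ^ 2 ∧ H₂ K x = -2 * K 1 0 / D K x ^ 3 ∧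
      H₃ K x = 6 * K 1 0 ^ 2 / D K x ^ 4 ∧ H K x = (K 0 1 + K 1 1 * x) / D K x := fun x hx _ => by
    obtain ⟨a0, a1, a2, a3⟩ := hhi x hx
    refine ⟨?_, ?_, ?_, ?_⟩
    · simp only [H₁, a0, a1, E₁]; ring
    · simp only [H₂, a0, a1, a2, E₂]; ring
    · simp only [H₃, a0, a1, a2, a3, E₃]; ring
    · simp only [H, a0, E]; ring
  -- Beyond `X` the function `H` is a Möbius map, and Möbius maps have zero Schwarzian derivative.
  have hPhi : ∀ x, X ≤ x → D K x ≠ 0 → P K x = 0 := fun x hx hx' => by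
    obtain ⟨b1, b2, b3, -⟩ := hHhi x hx hx'
    simp only [P, b1, b2, b3]
    field_simp
    ring
  refine ⟨_, _, _, _, _, ?_, fun t => ?_, fun t ht => ?_,
    IsClassicalSol.of_hypCoord hκ (P := P K) (V := fun x => 1 / √(H₁ K x))
      (V' := fun x => -H₂ K x / (2 * H₁ K x * √(H₁ K x))) (fun t => (hS t).1.1)
      (fun t => (hS t).1.2),
    IsClassicalSol.of_hypCoord hκ (P := P K) (V := fun x => H K x / √(H₁ K x))
      (V' := fun x => √(H₁ K x) - H K x * H₂ K x / (2 * H₁ K x * √(H₁ K x)))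
      (fun t => (hS t).2.1) (fun t => (hS t).2.2), ?_, ?_⟩
  · have c0 := contDiff_hypCoord hκ
    have cD : ContDiff ℝ ∞ fun t => D K (hypCoord κ t) := contDiff_const.add (contDiff_const.mul c0)
    have cE : ContDiff ℝ ∞ fun t => E K (hypCoord κ t) :=
      ((contDiff_const.add (contDiff_const.mul c0)).div cD fun t => (hD t).ne').sub c0
    have cE₁ : ContDiff ℝ ∞ fun t => E₁ K (hypCoord κ t) :=
      (contDiff_const.div (cD.pow 2) fun t => pow_ne_zero _ (hD t).ne').sub contDiff_const
    have cE₂ : ContDiff ℝ ∞ fun t => E₂ K (hypCoord κ t) :=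
      contDiff_const.div (cD.pow 3) fun t => pow_ne_zero _ (hD t).ne'
    have cE₃ : ContDiff ℝ ∞ fun t => E₃ K (hypCoord κ t) :=
      contDiff_const.div (cD.pow 4) fun t => pow_ne_zero _ (hD t).ne'
    have k0 := s0.comp c0
    have k1 := s1.comp c0
    have k2 := s2.comp c0
    have k3 := s3.comp c0
    have cH₁ : ContDiff ℝ ∞ fun t => H₁ K (hypCoord κ t) :=
      contDiff_const.add ((k1.mul cE).add (k0.mul cE₁))
    have cH₂ : ContDiff ℝ ∞ fun t => H₂ K (hypCoord κ t) :=
      ((k2.mul cE).add ((contDiff_const.mul k1).mul cE₁)).add (k0.mul cE₂)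
    have cH₃ : ContDiff ℝ ∞ fun t => H₃ K (hypCoord κ t) :=
      (((k3.mul cE).add ((contDiff_const.mul k2).mul cE₁)).add
        ((contDiff_const.mul k1).mul cE₂)).add (k0.mul cE₃)
    have cP : ContDiff ℝ ∞ fun t => P K (hypCoord κ t) :=
      (cH₃.neg.div (contDiff_const.mul cH₁) fun t => mul_ne_zero two_ne_zero (hH₁ t).ne').add
        (contDiff_const.mul ((cH₂.div cH₁ fun t => (hH₁ t).ne').pow 2))
    have h1 : ContDiff ℝ ∞ fun t : ℝ => κ * t := contDiff_const.mul contDiff_id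
    exact contDiff_const.add (cP.div (h1.cosh.pow 4) fun t => pow_ne_zero _ (Real.cosh_pos _).ne')
  · rw [add_sub_cancel_left, abs_div]
    have hc : 1 ≤ |Real.cosh (κ * t) ^ 4| := by
      rw [abs_of_pos (pow_pos (Real.cosh_pos _) 4)]
      exact one_le_pow₀ (Real.one_le_cosh _)
    exact (div_le_self (abs_nonneg _) hc).trans_lt (hK _ (hypCoord_mem hκ t)).2.2
  · have : P K (hypCoord κ t) = 0 := by
      rcases le_or_gt t 0 with h | h
      · refine hPlo _ ?_
        rw [← hypCoord_zero κ]
        exact (strictMono_hypCoord hκ).monotone h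
      · refine hPhi _ ?_ (hD t).ne'
        refine (strictMono_hypCoord hκ).monotone ?_
        by_contra! h2
        exact ht ⟨h, h2⟩
    rw [this, zero_div, add_zero]
  · obtain ⟨a0, a1, a2, a3⟩ := hlo 0 le_rfl
    simp [hypCoord_zero, H, H₁, H₂, a0, a1, a2]
  · have hDX := hD τ
    rw [← hXdef] at hDX
    obtain ⟨b1, b2, -, b4⟩ := hHhi X le_rfl hDX.ne'
    have hsq : √(1 / D K X ^ 2) = 1 / D K X := by
      rw [Real.sqrt_div zero_le_one, Real.sqrt_one, Real.sqrt_sq hDX.le]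
    have hc := Real.cosh_pos (κ * τ)
    have hXv : X = Real.sinh (κ * τ) / (κ * Real.cosh (κ * τ)) := rfl
    have hcs := Real.cosh_sq (κ * τ)
    rw [← hXdef, b1, b2, b4, hsq]
    have hm : ∀ i j, (hypFlow κ hκ τ * K) i j =
        hypFlow κ hκ τ i 0 * K 0 j + hypFlow κ hκ τ i 1 * K 1 j := fun i j => by
      rw [Matrix.SpecialLinearGroup.coe_mul, Matrix.mul_apply, Fin.sum_univ_two]
    rw [hm, hm, hm, hm]
    have f00 : hypFlow κ hκ τ 0 0 = Real.cosh (κ * τ) := rfl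
    have f01 : hypFlow κ hκ τ 0 1 = Real.sinh (κ * τ) / κ := rfl
    have f10 : hypFlow κ hκ τ 1 0 = κ * Real.sinh (κ * τ) := rfl
    have f11 : hypFlow κ hκ τ 1 1 = Real.cosh (κ * τ) := rfl
    rw [f00, f01, f10, f11]
    have hDv : D K X = K 0 0 + K 1 0 * X := rfl
    have hXs : X * (κ * Real.cosh (κ * τ)) = Real.sinh (κ * τ) := by
      rw [hXv]; field_simp
    clear_value X
    rw [← hXs] at hcs ⊢
    generalize Real.cosh (κ * τ) = c at *
    have hcc : c ^ 2 * (1 - (X * κ) ^ 2) = 1 := by linear_combination hcs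
    refine ⟨?_, ?_, ?_, ?_⟩
    · field_simp
      rw [hDv]
      ring
    · field_simp
      rw [hDv]
      linear_combination (-K 1 0) * hcc
    · field_simp
    · field_simp
      rw [hDv]
      linear_combination (-K 1 1 * (K 0 0 + K 1 0 * X)) * hcc - hdet

/-! ### Realizing potentials as `g ∘ u` with `u` smooth and periodic -/

/-- Otherwise `g` would be locally constant wherever it exceeds `M`, so the level set at height `M +
1` would be open as well as closed. Surjectivity makes it neither empty nor the whole line. -/
lemma exists_gt_deriv_ne_zero {g : ℝ → ℝ} (hg : ContDiff ℝ ∞ g) (hs : Function.Surjective g)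
    (M : ℝ) : ∃ x, M < g x ∧ deriv g x ≠ 0 := by
  by_contra! h
  have hclosed : IsClosed {x | g x = M + 1} := isClosed_eq hg.continuous continuous_const
  have hopen : IsOpen {x | g x = M + 1} := by
    rw [Metric.isOpen_iff]
    intro x hx
    have hx' : g x = M + 1 := hx
    obtain ⟨ε, hε, hball⟩ := Metric.mem_nhds_iff.1
      (hg.continuous.continuousAt.eventually (lt_mem_nhds (show M < g x by linarith)))
    refine ⟨ε, hε, fun y hy => ?_⟩
    have hc := (convex_ball x ε).is_const_of_fderivWithin_eq_zero (𝕜 := ℝ) (f := g)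
      (hg.differentiable (by simp)).differentiableOn (fun z hz => by
        rw [fderivWithin_of_isOpen Metric.isOpen_ball hz]
        ext
        simpa using h z (hball hz)) hy (Metric.mem_ball_self hε)
    exact hc.trans hx'
  rcases isClopen_iff.1 ⟨hclosed, hopen⟩ with h0 | h1
  · obtain ⟨x, hx⟩ := hs (M + 1)
    exact (h0 ▸ (show x ∈ {x | g x = M + 1} from hx) : x ∈ (∅ : Set ℝ)).elim
  · obtain ⟨x, hx⟩ := hs (M + 2)
    have hx1 : x ∈ {x | g x = M + 1} := h1 ▸ mem_univ x
    have : g x = M + 1 := hx1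
    linarith

/-- A smooth local right inverse at a regular point. -/
lemma exists_smooth_local_inverse {g : ℝ → ℝ} (hg : ContDiff ℝ ∞ g) {x₀ : ℝ}
    (hx₀ : deriv g x₀ ≠ 0) : ∃ (η : ℝ) (ψ : ℝ → ℝ), 0 < η ∧ ψ (g x₀) = x₀ ∧
      ∀ y, |y - g x₀| < η → g (ψ y) = y ∧ ContDiffAt ℝ ∞ ψ y := by
  have hd : HasFDerivAt g ((ContinuousLinearEquiv.unitsEquivAut ℝ (Units.mk0 _ hx₀) : ℝ ≃L[ℝ] ℝ) :
      ℝ →L[ℝ] ℝ) x₀ := by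
    exact ((hg.differentiable (by simp) x₀).hasDerivAt).hasFDerivAt_equiv hx₀
  have hc : ContDiffAt ℝ ∞ g x₀ := hg.contDiffAt
  let e := hc.toOpenPartialHomeomorph g hd (by simp)
  have hes : x₀ ∈ e.source := hc.mem_toOpenPartialHomeomorph_source hd (by simp)
  have hex : ∀ x, e x = g x := fun x => rfl
  have hsymm : e.symm (g x₀) = x₀ := e.left_inv hes
  have htgt : g x₀ ∈ e.target := e.map_source hes
  -- A nonzero derivative at all nearby preimages makes the inverse smooth on a neighbourhood, not
  -- only at `g x₀`.
  have hev : ∀ᶠ y in 𝓝 (g x₀), y ∈ e.target ∧ deriv g (e.symm y) ≠ 0 := by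
    refine Filter.Eventually.and (e.open_target.mem_nhds htgt) ?_
    have hcd : Continuous (deriv g) := ((contDiff_infty_iff_deriv.1 hg).2).continuous
    have h1 : ContinuousAt (fun y => deriv g (e.symm y)) (g x₀) :=
      hcd.continuousAt.comp (e.continuousAt_symm htgt)
    exact h1.eventually_ne (by rwa [hsymm])
  obtain ⟨η, hη, hball⟩ := Metric.mem_nhds_iff.1 hev
  refine ⟨η, e.symm, hη, hsymm, fun y hy => ?_⟩
  obtain ⟨h1, h2⟩ := hball (show y ∈ Metric.ball (g x₀) η by rwa [Metric.mem_ball, Real.dist_eq])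
  exact ⟨e.right_inv h1, e.contDiffAt_symm_deriv h2 h1
    ((hg.differentiable (by simp) _).hasDerivAt) hg.contDiffAt⟩

/-- A measurable right inverse of a continuous function on a compact interval. -/
lemma exists_measurable_right_inverse {g : ℝ → ℝ} (hg : Continuous g) {a b : ℝ} (hab : a ≤ b) :
    ∃ sel : ℝ → ℝ, Measurable sel ∧ ∀ y ∈ Icc (g a) (g b), sel y ∈ Icc a b ∧ g (sel y) = y := by
  -- The inverse takes the first point where `g` reaches height `y`. It is monotone in `y`, hence
  -- measurable, and capping `y` at `g b` keeps the set nonempty for every `y`.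
  let S : ℝ → Set ℝ := fun y => Icc a b ∩ {x | min y (g b) ≤ g x}
  have hbS : ∀ y, b ∈ S y := fun y => ⟨right_mem_Icc.2 hab, (min_le_right _ _ : min y (g b) ≤ g b)⟩
  have hcl : ∀ y, IsClosed {x | min y (g b) ≤ g x} := fun y => isClosed_le continuous_const hg
  have hmem : ∀ y, sInf (S y) ∈ S y := fun y =>
    (isCompact_Icc.inter_right (hcl y)).sInf_mem ⟨b, hbS y⟩
  have hbdd : ∀ y, BddBelow (S y) := fun y => bddBelow_Icc.mono inter_subset_left
  refine ⟨fun y => sInf (S y), Monotone.measurable fun y y' h => ?_, fun y hy => ?_⟩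
  · exact csInf_le_csInf (hbdd y) ⟨b, hbS y'⟩ fun x hx =>
      ⟨hx.1, (min_le_min_right _ h).trans hx.2⟩
  · obtain ⟨h1, h2⟩ := hmem y
    refine ⟨h1, le_antisymm ?_ ?_⟩
    · obtain ⟨x, hx, hxy⟩ := intermediate_value_Icc h1.1 hg.continuousOn
        (show y ∈ Icc (g a) (g (sInf (S y))) from ⟨hy.1, (min_eq_left hy.2).symm.trans_le h2⟩)
      have h3 : sInf (S y) ≤ x :=
        csInf_le (hbdd y) ⟨⟨hx.1, hx.2.trans h1.2⟩, by
          change min y (g b) ≤ g x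
          rw [hxy]; exact min_le_left _ _⟩
      change g (sInf (S y)) ≤ y
      rw [le_antisymm h3 hx.2, hxy]
    · exact (min_eq_left hy.2).symm.trans_le h2

/-- A bounded measurable potential factors through a surjective continuous function. -/
lemma exists_measurable_factor {g : ℝ → ℝ} (hg : Continuous g) (hs : Function.Surjective g)
    (L : ℝ) : ∃ (sel : ℝ → ℝ) (B : ℝ), Measurable sel ∧
      ∀ y, |y| ≤ L → |sel y| ≤ B ∧ g (sel y) = y := by
  obtain ⟨a, ha⟩ := hs (-L)
  obtain ⟨b, hb⟩ := hs L
  have hB : ∀ {x}, x ∈ uIcc a b → |x| ≤ max |a| |b| := fun {x} hx => by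
    rcases le_total a b with h | h
    · rw [uIcc_of_le h] at hx
      exact abs_le_max_abs_abs hx.1 hx.2
    · rw [uIcc_of_ge h] at hx
      rw [max_comm]
      exact abs_le_max_abs_abs hx.1 hx.2
  rcases le_total a b with h | h
  · obtain ⟨sel, hsel, hsel'⟩ := exists_measurable_right_inverse hg h
    refine ⟨sel, max |a| |b|, hsel, fun y hy => ?_⟩
    obtain ⟨h1, h2⟩ := hsel' y (by rw [ha, hb]; exact abs_le.1 hy)
    exact ⟨hB (by rwa [uIcc_of_le h]), h2⟩
  -- When the preimages of `-L` and `L` come in the wrong order, the line is reflected.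
  · obtain ⟨sel, hsel, hsel'⟩ := exists_measurable_right_inverse (g := fun x => g (-x)) (by fun_prop)
      (neg_le_neg h)
    refine ⟨fun y => -sel y, max |a| |b|, hsel.neg, fun y hy => ?_⟩
    obtain ⟨h1, h2⟩ := hsel' y (by simp only [neg_neg]; rw [ha, hb]; exact abs_le.1 hy)
    refine ⟨hB ?_, h2⟩
    rw [uIcc_of_ge h]
    exact ⟨by linarith [h1.2], by linarith [h1.1]⟩

/-- Smooth periodic approximation of a bounded measurable periodic function, exact inside an
interval of constancy. -/
lemma exists_smooth_periodic_approx {x : ℝ → ℝ} {B T δ x₀ : ℝ} (hx : Measurable x)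
    (hB : ∀ t, |x t| ≤ B) (hper : Function.Periodic x T) (hδ : 0 < δ)
    (hx₀ : ∀ t ∈ Icc 0 δ, x t = x₀) :
    ∃ u : ℕ → ℝ → ℝ, (∀ n, ContDiff ℝ ∞ (u n)) ∧ (∀ n, Function.Periodic (u n) T) ∧
      (∀ n t, |u n t| ≤ B) ∧ (∀ n, ∀ t ∈ Icc (δ / 3) (2 * δ / 3), u n t = x₀) ∧
      ∀ᵐ t, Filter.Tendsto (fun n => u n t) Filter.atTop (𝓝 (x t)) := by
  have hB0 : 0 ≤ B := (abs_nonneg _).trans (hB 0)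
  have hpos : ∀ n : ℕ, 0 < δ / 6 / (n + 1) := fun n => by positivity
  -- The outer radius is at most `δ / 3`, so on the middle third the convolution sees only `[0, δ]`,
  -- where `x` is constant. The fixed ratio 2 of the radii is what the almost everywhere convergence
  -- needs.
  let φ : ℕ → ContDiffBump (0 : ℝ) := fun n =>
    ⟨δ / 6 / (n + 1), 2 * (δ / 6 / (n + 1)), hpos n, by linarith [hpos n]⟩
  have hloc : LocallyIntegrable x volume := by
    refine (locallyIntegrable_const B).mono hx.aestronglyMeasurable ?_
    refine Filter.Eventually.of_forall fun t => ?_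
    rw [Real.norm_eq_abs, Real.norm_of_nonneg hB0]
    exact hB t
  refine ⟨fun n => convolution ((φ n).normed volume) x (ContinuousLinearMap.lsmul ℝ ℝ) volume,
    fun n => ?_, fun n t => ?_, fun n t => ?_, fun n t ht => ?_, ?_⟩
  · exact (φ n).hasCompactSupport_normed.contDiff_convolution_left _ (φ n).contDiff_normed hloc
  · simp only [convolution_def]
    refine integral_congr_ae (Filter.Eventually.of_forall fun s => ?_)
    simp only
    rw [show t + T - s = t - s + T by ring, hper]
  · have := dist_convolution_le (f := (φ n).normed volume) (g := x) (x₀ := t) (z₀ := 0)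
      (R := (φ n).rOut) (μ := volume) hB0 (φ n).support_normed_eq.subset (φ n).nonneg_normed
      (φ n).integral_normed hx.aestronglyMeasurable fun s _ => by
        rw [dist_zero_right]; exact hB s
    rwa [dist_zero_right] at this
  · have hr : (φ n).rOut ≤ δ / 3 := by
      change 2 * (δ / 6 / (n + 1)) ≤ δ / 3
      have : δ / 6 / ((n : ℝ) + 1) ≤ δ / 6 := div_le_self (by positivity) (by
        have : (0 : ℝ) ≤ n := n.cast_nonneg
        linarith)
      linarith
    have ht' : t ∈ Icc 0 δ := ⟨by linarith [ht.1], by linarith [ht.2]⟩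
    rw [← hx₀ t ht']
    refine ContDiffBump.normed_convolution_eq_right fun s hs => ?_
    rw [Metric.mem_ball, Real.dist_eq] at hs
    have := abs_lt.1 (hs.trans_le hr)
    rw [hx₀ t ht', hx₀ s ⟨by linarith [ht.1], by linarith [ht.2]⟩]
  · refine ContDiffBump.ae_convolution_tendsto_right_of_locallyIntegrable (K := 2) ?_ ?_ hloc
    · have h1 : Filter.Tendsto (fun n : ℕ => 1 / ((n : ℝ) + 1)) Filter.atTop (𝓝 0) :=
        tendsto_one_div_add_atTop_nhds_zero_nat
      have h2 := h1.const_mul (δ / 3)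
      rw [mul_zero] at h2
      refine h2.congr fun n => ?_
      change _ = 2 * (δ / 6 / (n + 1))
      ring
    · exact Filter.Eventually.of_forall fun n => le_rfl

/-- The periodic extension of a smooth function supported inside one period. -/
lemma exists_periodic_extension {ψ : ℝ → ℝ} {a b T : ℝ} (hψ : ContDiff ℝ ∞ ψ) (ha : 0 < a)
    (hab : a < b) (hb : b < T) (h0 : ∀ t, t ∉ Ioo a b → ψ t = 0) :
    ∃ Ψ : ℝ → ℝ, ContDiff ℝ ∞ Ψ ∧ Function.Periodic Ψ T ∧ ∀ t ∈ Icc 0 T, Ψ t = ψ t := by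
  have hT : 0 < T := ha.trans (hab.trans hb)
  let Ψ : ℝ → ℝ := fun t => ψ (t - T * ⌊t / T⌋)
  -- On an interval reaching to the left of `n T`, one translate of `ψ` describes `Ψ`: across the
  -- jump of the floor function both translates vanish. This yields smoothness at the multiples of
  -- `T`.
  have hkey : ∀ (n : ℤ) (s : ℝ), s - T * n ∈ Ioo (b - T) T → Ψ s = ψ (s - T * n) := by
    intro n s hs
    rcases le_or_gt 0 (s - T * n) with h | h
    · have : ⌊s / T⌋ = n := by
        rw [Int.floor_eq_iff, le_div_iff₀ hT, div_lt_iff₀ hT]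
        constructor <;> nlinarith [hs.2]
      simp only [Ψ, this]
    · have : ⌊s / T⌋ = n - 1 := by
        rw [Int.floor_eq_iff, le_div_iff₀ hT, div_lt_iff₀ hT]
        push_cast
        constructor <;> nlinarith [hs.1]
      simp only [Ψ, this]
      rw [h0 (s - T * n) fun h' => by linarith [h'.1], h0]
      push_cast
      intro h'
      linarith [h'.2, hs.1]
  refine ⟨Ψ, contDiff_iff_contDiffAt.2 fun t => ?_, fun t => ?_, fun t ht => ?_⟩
  · have hsm : ContDiffAt ℝ ∞ (fun s => ψ (s - T * ⌊t / T⌋)) t := by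
      exact (hψ.comp (contDiff_id.sub contDiff_const)).contDiffAt
    refine hsm.congr_of_eventuallyEq ?_
    have h1 := Int.floor_le (t / T)
    have h2 := Int.lt_floor_add_one (t / T)
    rw [le_div_iff₀ hT] at h1
    rw [div_lt_iff₀ hT] at h2
    have hmem : t - T * ⌊t / T⌋ ∈ Ioo (b - T) T := ⟨by linarith, by linarith⟩
    have hc : ContinuousAt (fun s : ℝ => s - T * ⌊t / T⌋) t := by fun_prop
    filter_upwards [hc.eventually (isOpen_Ioo.mem_nhds hmem)] with s hs using hkey _ s hs
  · have : ⌊(t + T) / T⌋ = ⌊t / T⌋ + 1 := by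
      rw [add_div, div_self hT.ne', Int.floor_add_one]
    simp only [Ψ, this]
    congr 1
    push_cast
    ring
  · rcases ht.2.eq_or_lt with h | h
    · rw [hkey 1 t (by rw [h]; simp [hb, hT]), h0 t fun h' => by linarith [h'.2], h0]
      intro h'
      rw [h] at h'
      simp only [Int.cast_one, mul_one, sub_self] at h'
      exact ha.not_gt h'.1
    · have := hkey 0 t (by simp; exact ⟨by linarith [ht.1], h⟩)
      simpa using this

/-! ### Surjectivity onto `G₀` -/

lemma IsClassicalSol.comp_sub {q v w : ℝ → ℝ} (h : IsClassicalSol q v w) (a : ℝ) :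
    IsClassicalSol (fun t => q (t - a)) (fun t => v (t - a)) fun t => w (t - a) :=
  ⟨fun t => (h.deriv_v (t - a)).comp_sub_const t a, fun t => (h.deriv_w (t - a)).comp_sub_const t a⟩

/-- A fundamental matrix is propagated by any frame of solutions. -/
lemma IsFundamentalMatrix.propagate {q p v₁ w₁ v₂ w₂ : ℝ → ℝ} {Φ : ℝ → SL(2, ℝ)} {a b L : ℝ}
    (h : IsFundamentalMatrix q Φ) (hq : Measurable q) (hL : ∀ t, |q t| ≤ L) (ha : 0 ≤ a)
    (hab : a ≤ b) (hb : b ≤ 2 * Real.pi) (hpq : ∀ t ∈ Icc a b, p t = q t)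
    (h₁ : IsSolOn p a b v₁ w₁) (h₂ : IsSolOn p a b v₂ w₂) {M N : SL(2, ℝ)}
    (hM : v₁ a = M 0 0 ∧ w₁ a = M 1 0 ∧ v₂ a = M 0 1 ∧ w₂ a = M 1 1)
    (hN : v₁ b = N 0 0 ∧ w₁ b = N 1 0 ∧ v₂ b = N 0 1 ∧ w₂ b = N 1 1) :
    Φ b = N * M⁻¹ * Φ a := by
  -- The frame multiplied on the right by the constant matrix `C` solves the same equation and
  -- equals `Φ a` at `a`, so uniqueness identifies it with `Φ`.
  set C : SL(2, ℝ) := M⁻¹ * Φ a with hC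
  have hMC : M * C = Φ a := by rw [hC, mul_inv_cancel_left]
  have hmul : ∀ (A : SL(2, ℝ)) i j, (A * C) i j = C 0 j * A i 0 + C 1 j * A i 1 := fun A i j => by
    rw [Matrix.SpecialLinearGroup.coe_mul, Matrix.mul_apply, Fin.sum_univ_two]
    ring
  have hpq' : ∀ᵐ t, t ∈ Icc a b → p t = q t := Filter.Eventually.of_forall hpq
  have k₁ := h₁.congr_ae hpq'
  have k₂ := h₂.congr_ae hpq'
  have hbm : b ∈ Icc a b := ⟨hab, le_rfl⟩
  have e₁ := (h.isSolOn₁.mono hq hL ha hab hb).unique (k₁.linear k₂ hq hL (C 0 0) (C 1 0)) hq hL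
    (by simp only [hM.1, hM.2.2.1]; rw [← hmul, hMC])
    (by simp only [hM.2.1, hM.2.2.2]; rw [← hmul, hMC]) b hbm
  have e₂ := (h.isSolOn₂.mono hq hL ha hab hb).unique (k₁.linear k₂ hq hL (C 0 1) (C 1 1)) hq hL
    (by simp only [hM.1, hM.2.2.1]; rw [← hmul, hMC])
    (by simp only [hM.2.1, hM.2.2.2]; rw [← hmul, hMC]) b hbm
  rw [mul_assoc, ← hC]
  ext i j
  rw [hmul]
  simp only [hN.1, hN.2.1, hN.2.2.1, hN.2.2.2] at e₁ e₂
  fin_cases i <;> fin_cases j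
  exacts [e₁.1, e₂.1, e₁.2, e₂.2]

/-- The fundamental matrix is a Lipschitz function of the potential in the `L¹` norm. -/
lemma IsFundamentalMatrix.exists_lipschitz {q : ℝ → ℝ} {Φ : ℝ → SL(2, ℝ)} {L : ℝ}
    (h : IsFundamentalMatrix q Φ) (hq : Measurable q) (hL : ∀ t, |q t| ≤ L) :
    ∃ C, 0 < C ∧ ∀ (p : ℝ → ℝ) (Ψ : ℝ → SL(2, ℝ)), Measurable p → (∀ t, |p t| ≤ L) →
      IsFundamentalMatrix p Ψ → ∀ t ∈ Icc 0 (2 * Real.pi), ∀ i j,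
        |Ψ t i j - Φ t i j| ≤ C * ∫ s in (0 : ℝ)..2 * Real.pi, |p s - q s| := by
  obtain ⟨B₁, hB₁⟩ := isCompact_Icc.exists_bound_of_continuousOn h.isSolOn₁.cont_v
  obtain ⟨B₂, hB₂⟩ := isCompact_Icc.exists_bound_of_continuousOn h.isSolOn₂.cont_v
  set B := max 1 (max B₁ B₂)
  have hB₁' : ∀ t ∈ Icc 0 (2 * Real.pi), |Φ t 0 0| ≤ B := fun t ht =>
    (hB₁ t ht).trans ((le_max_left _ _).trans (le_max_right _ _))
  have hB₂' : ∀ t ∈ Icc 0 (2 * Real.pi), |Φ t 0 1| ≤ B := fun t ht =>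
    (hB₂ t ht).trans ((le_max_right _ _).trans (le_max_right _ _))
  have hB : 0 < B := one_pos.trans_le (le_max_left _ _)
  refine ⟨B * Real.exp ((1 + L) * (2 * Real.pi - 0)), by positivity, fun p Ψ hp hpL hΨ t ht => ?_⟩
  have e₁ := hΨ.isSolOn₁.dist_le h.isSolOn₁ hp hpL hq hL hB₁' (by rw [h.initial, hΨ.initial])
    (by rw [h.initial, hΨ.initial]) le_rfl t ht
  have e₂ := hΨ.isSolOn₂.dist_le h.isSolOn₂ hp hpL hq hL hB₂' (by rw [h.initial, hΨ.initial])
    (by rw [h.initial, hΨ.initial]) le_rfl t ht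
  rw [mul_right_comm] at e₁ e₂
  have hn : ∀ i j, 0 ≤ |Ψ t i j - Φ t i j| := fun i j => abs_nonneg _
  intro i j
  fin_cases i <;> fin_cases j
  · exact (le_add_of_nonneg_right (hn 1 0)).trans e₁
  · exact (le_add_of_nonneg_right (hn 1 1)).trans e₂
  · exact (le_add_of_nonneg_left (hn 0 0)).trans e₁
  · exact (le_add_of_nonneg_left (hn 0 1)).trans e₂

/-- The total angle depends continuously on the potential in the `L¹` norm. -/
lemma IsFundamentalMatrix.exists_totalAngle_lt {q : ℝ → ℝ} {Φ : ℝ → SL(2, ℝ)} {L ε : ℝ}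
    (h : IsFundamentalMatrix q Φ) (hq : Measurable q) (hL : ∀ t, |q t| ≤ L) (hε : 0 < ε) :
    ∃ d, 0 < d ∧ ∀ (p : ℝ → ℝ) (Ψ : ℝ → SL(2, ℝ)), Measurable p → (∀ t, |p t| ≤ L) →
      IsFundamentalMatrix p Ψ → ∫ s in (0 : ℝ)..2 * Real.pi, |p s - q s| ≤ d →
        |totalAngle Ψ - totalAngle Φ| < ε := by
  have hpi := Real.pi_pos
  obtain ⟨C, hC, hlip⟩ := h.exists_lipschitz hq hL
  let r : ℝ × ℝ → ℝ := fun z => 1 / (z.1 ^ 2 + z.2 ^ 2)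
  have hcpt : IsCompact ((fun t => (Φ t 0 0, Φ t 0 1)) '' Icc 0 (2 * Real.pi)) :=
    isCompact_Icc.image_of_continuousOn (h.isSolOn₁.cont_v.prodMk h.isSolOn₂.cont_v)
  have hcr : ∀ z ∈ (fun t => (Φ t 0 0, Φ t 0 1)) '' Icc 0 (2 * Real.pi), ContinuousAt r z := by
    rintro z ⟨t, -, rfl⟩
    refine ContinuousAt.div continuousAt_const (by fun_prop) (row_sq_pos (Φ t)).ne'
  -- The rows of `Φ` form a compact set away from the origin, near which the angular speed is
  -- uniformly continuous. The tolerance `ε / (4π)` integrates to `ε / 2`.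
  have hun := hcpt.uniformContinuousAt_of_continuousAt r hcr
    (Metric.dist_mem_uniformity (show 0 < ε / (4 * Real.pi) by positivity))
  obtain ⟨e, he, hde⟩ := Metric.mem_uniformity_dist.1 hun
  refine ⟨e / (2 * C), by positivity, fun p Ψ hp hpL hΨ hd => ?_⟩
  have hclose : ∀ t ∈ Icc 0 (2 * Real.pi), ∀ i j, |Ψ t i j - Φ t i j| < e := fun t ht i j => by
    refine (hlip p Ψ hp hpL hΨ t ht i j).trans_lt ?_
    calc C * _ ≤ C * (e / (2 * C)) := by gcongr
      _ = e / 2 := by field_simp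
      _ < e := by linarith
  have hint : ∀ {q : ℝ → ℝ} {Φ : ℝ → SL(2, ℝ)}, IsFundamentalMatrix q Φ → IntervalIntegrable
      (fun s => 1 / (Φ s 0 0 ^ 2 + Φ s 0 1 ^ 2)) volume 0 (2 * Real.pi) := fun h => by
    refine ContinuousOn.intervalIntegrable ?_
    rw [uIcc_of_le (by positivity)]
    exact h.continuousOn_angle
  rw [totalAngle, totalAngle, ← intervalIntegral.integral_sub (hint hΨ) (hint h),
    ← Real.norm_eq_abs]
  refine (intervalIntegral.norm_integral_le_of_norm_le_const (C := ε / (4 * Real.pi))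
    fun t ht => ?_).trans_lt ?_
  · rw [uIoc_of_le (by positivity)] at ht
    have ht' := Ioc_subset_Icc_self ht
    have hdist : dist (Φ t 0 0, Φ t 0 1) (Ψ t 0 0, Ψ t 0 1) < e := by
      rw [Prod.dist_eq, max_lt_iff, dist_comm, dist_comm (Φ t 0 1), Real.dist_eq, Real.dist_eq]
      exact ⟨hclose t ht' 0 0, hclose t ht' 0 1⟩
    have := hde hdist ⟨t, ht', rfl⟩
    simp only [mem_ofPred_eq] at this
    rw [dist_comm, Real.dist_eq] at this
    exact this.le
  · rw [sub_zero, abs_of_pos (by positivity)]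
    field_simp
    linarith

/-- Every element of `G₀` is the monodromy of `g ∘ φ` for some nonconstant smooth periodic `φ`. -/
lemma exists_smoothCircle_monodromy_eq {g : ℝ → ℝ} (hg : ContDiff ℝ ∞ g)
    (hs : Function.Surjective g) {y : G} (hy : y ∈ G₀) :
    ∃ φ : SmoothCircle,
      (∀ q, (fun t => g (φ.toFun t)) =ᵐ[volume.restrict (Icc 0 (2 * Real.pi))] q →
        monodromy q = y) ∧
      ¬ ∃ c : ℝ, ∀ t ∈ Icc 0 (2 * Real.pi), φ.toFun t = c := by
  have hpi := Real.pi_pos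
  obtain ⟨γ, a, ha, ha1, rfl⟩ := exists_rowAngle_pos_of_mem_G₀ hy
  set T := γ.1 1 with hT
  -- Regularity of `x₀` allows `g` to be inverted there; the height above `(T 0 0)²` rules out a
  -- constant solution at the end.
  obtain ⟨x₀, hx₀, hx₀'⟩ := exists_gt_deriv_ne_zero hg hs (T 0 0 ^ 2)
  obtain ⟨η₀, ψ, hη₀, hψ₀, hψ⟩ := exists_smooth_local_inverse hg hx₀'
  have hgx₀ : 0 < g x₀ := (sq_nonneg _).trans_lt hx₀
  obtain ⟨κ, hκ, hκg⟩ : ∃ κ, 0 < κ ∧ κ ^ 2 = g x₀ :=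
    ⟨√(g x₀), Real.sqrt_pos.2 hgx₀, Real.sq_sqrt hgx₀.le⟩
  obtain ⟨δ, L, q, Φ, hδ, hδ2, hq, hL, hqδ, hΦ, hΦT, hΦA⟩ :=
    exists_exact_potential hκ ha1 (ha.cos_eq 1) (ha.sin_eq 1)
  obtain ⟨sel, B, hsel, hselB⟩ := exists_measurable_factor hg.continuous hs L
  -- the bounded measurable periodic function `x` with `g ∘ x = q`
  let x : ℝ → ℝ := fun t =>
    if t - 2 * Real.pi * ⌊t / (2 * Real.pi)⌋ ≤ δ then x₀
    else sel (q (t - 2 * Real.pi * ⌊t / (2 * Real.pi)⌋))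
  have hmod : Measurable fun t : ℝ => t - 2 * Real.pi * ⌊t / (2 * Real.pi)⌋ := by
    have : Measurable fun t : ℝ => (⌊t / (2 * Real.pi)⌋ : ℝ) :=
      (measurable_from_top (f := fun n : ℤ => (n : ℝ))).comp
        (Int.measurable_floor.comp (measurable_id.div_const _))
    exact measurable_id.sub (measurable_const.mul this)
  have hx : Measurable x := Measurable.ite (hmod measurableSet_Iic) measurable_const
    (hsel.comp (hq.comp hmod))
  set B' := max |x₀| B
  have hxB : ∀ t, |x t| ≤ B' := fun t => by
    simp only [x]
    split_ifs
    · exact le_max_left _ _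
    · exact (hselB _ (hL _)).1.trans (le_max_right _ _)
  have hxper : Function.Periodic x (2 * Real.pi) := fun t => by
    have h1 : ⌊(t + 2 * Real.pi) / (2 * Real.pi)⌋ = ⌊t / (2 * Real.pi)⌋ + 1 := by
      rw [add_div, div_self (by positivity), Int.floor_add_one]
    have h2 : t + 2 * Real.pi - 2 * Real.pi * (⌊t / (2 * Real.pi)⌋ + 1 : ℤ) =
        t - 2 * Real.pi * ⌊t / (2 * Real.pi)⌋ := by push_cast; ring
    simp only [x, h1, h2]
  have hfloor : ∀ t ∈ Ico 0 (2 * Real.pi), t - 2 * Real.pi * ⌊t / (2 * Real.pi)⌋ = t :=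
    fun t ht => by
      have : ⌊t / (2 * Real.pi)⌋ = 0 := by
        rw [Int.floor_eq_zero_iff]
        exact ⟨div_nonneg ht.1 (by positivity), (div_lt_one (by positivity)).2 ht.2⟩
      rw [this]
      simp
  have hxx₀ : ∀ t ∈ Icc 0 δ, x t = x₀ := fun t ht => by
    simp only [x, hfloor t ⟨ht.1, ht.2.trans_lt hδ2⟩, if_pos ht.2]
  have hgx : ∀ t ∈ Ico 0 (2 * Real.pi), g (x t) = q t := fun t ht => by
    simp only [x, hfloor t ht]
    split_ifs with h
    · rw [hqδ t h, hκg]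
    · exact (hselB _ (hL t)).2
  obtain ⟨u, hu, huper, huB, hux₀, hulim⟩ := exists_smooth_periodic_approx hx hxB hxper hδ hxx₀
  obtain ⟨L₁, hL₁⟩ := (isCompact_Icc (a := -B') (b := B')).exists_bound_of_continuousOn
    hg.continuous.continuousOn
  have hgL₁ : ∀ y, |y| ≤ B' → |g y| ≤ L₁ := fun y hy => hL₁ y (abs_le.1 hy)
  -- One bound for `q`, for all `g ∘ u n`, and for the corrected potential, which moves by at most
  -- `η₀`.
  set L₂ := max L L₁ + η₀ with hL₂
  have hqL₂ : ∀ t, |q t| ≤ L₂ := fun t => by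
    have := (hL t).trans (le_max_left L L₁); linarith
  have hguL₂ : ∀ n t, |g (u n t)| ≤ L₂ := fun n t => by
    have := (hgL₁ _ (huB n t)).trans (le_max_right L L₁); linarith
  have hgum : ∀ n, Measurable fun t => g (u n t) := fun n =>
    (hg.continuous.comp (hu n).continuous).measurable
  choose Ψ hΨ using fun n => exists_isFundamentalMatrix (hgum n) (hguL₂ n)
  -- convergence of the approximations
  have hlim : Filter.Tendsto (fun n => ∫ s in (0 : ℝ)..2 * Real.pi, |g (u n s) - q s|)
      Filter.atTop (𝓝 0) := by
    rw [show 𝓝 (0 : ℝ) = 𝓝 (∫ s in (0 : ℝ)..2 * Real.pi, (0 : ℝ)) by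
      rw [intervalIntegral.integral_zero]]
    refine intervalIntegral.tendsto_integral_filter_of_dominated_convergence
      (fun _ => L₂ + L₂) ?_ ?_ intervalIntegrable_const ?_
    · exact Filter.Eventually.of_forall fun n =>
        ((hgum n).sub hq).norm.aestronglyMeasurable
    · refine Filter.Eventually.of_forall fun n => Filter.Eventually.of_forall fun t _ => ?_
      rw [Real.norm_eq_abs, abs_abs]
      exact (abs_sub _ _).trans (add_le_add (hguL₂ n t) (hqL₂ t))
    · filter_upwards [hulim, Measure.ae_ne volume (2 * Real.pi)] with t ht hne htm
      rw [uIoc_of_le (by positivity)] at htm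
      have h1 := ((hg.continuous.tendsto _).comp ht).sub_const (q t)
      rw [hgx t ⟨htm.1.le, lt_of_le_of_ne htm.2 hne⟩, sub_self] at h1
      simpa using h1.abs
  obtain ⟨C, hC, hlip⟩ := hΦ.exists_lipschitz hq hqL₂
  have hΨlim : ∀ t ∈ Icc 0 (2 * Real.pi), Filter.Tendsto (fun n => Ψ n t) Filter.atTop (𝓝 (Φ t)) := by
    intro t ht
    refine tendsto_subtype_rng.2 (tendsto_pi_nhds.2 fun i => tendsto_pi_nhds.2 fun j => ?_)
    rw [tendsto_iff_dist_tendsto_zero]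
    have h1 := hlim.const_mul C
    rw [mul_zero] at h1
    exact squeeze_zero (fun n => dist_nonneg)
      (fun n => hlip _ (Ψ n) (hgum n) (hguL₂ n) (hΨ n) t ht i j) h1
  set t₁ := δ / 3 with ht₁
  set t₂ := 2 * δ / 3 with ht₂
  set τ := δ / 3 with hτ
  have ht12 : t₁ < t₂ := by rw [ht₁, ht₂]; linarith
  have ht1 : 0 < t₁ := by positivity
  have ht2 : t₂ < 2 * Real.pi := by rw [ht₂]; linarith
  have hτ21 : t₂ - t₁ = τ := by rw [ht₁, ht₂, hτ]; ring
  -- This solves `Ψ(2π) Ψ(t₁)⁻¹ K Ψ(t₁) = T`, the condition that inserting `K` into the flow over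
  -- `[t₁, t₂]` moves the endpoint to `T`. It tends to 1 because `Φ (2π) = T`.
  let K : ℕ → SL(2, ℝ) := fun n => Ψ n t₁ * (Ψ n (2 * Real.pi))⁻¹ * T * (Ψ n t₁)⁻¹
  have hKlim : Filter.Tendsto K Filter.atTop (𝓝 1) := by
    have h1 := hΨlim t₁ ⟨ht1.le, by linarith⟩
    have h2 := hΨlim (2 * Real.pi) ⟨by positivity, le_rfl⟩
    have h3 := ((h1.mul h2.inv).mul_const T).mul h1.inv
    have h4 : Φ t₁ * (Φ (2 * Real.pi))⁻¹ * T * (Φ t₁)⁻¹ = 1 := by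
      rw [hΦT, ← hT]
      group
    rwa [h4] at h3
  obtain ⟨d, hd, hangle⟩ := hΦ.exists_totalAngle_lt hq hqL₂ one_pos
  -- The bound `η₀` keeps the corrected potential in the domain of `ψ`; the other bound makes the
  -- correction cost at most `d / 2` in `L¹`, and the mollification uses the other half.
  set η := min η₀ (d / (4 * Real.pi)) with hη
  have hηpos : 0 < η := lt_min hη₀ (by positivity)
  obtain ⟨n, ⟨p, v₁, w₁, v₂, w₂, hp, hpη, hpτ, hs₁, hs₂, hini, hfin⟩, hnd⟩ :=
    ((hKlim.eventually (eventually_exists_correction hκ (show 0 < τ by positivity) hηpos)).and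
      (hlim.eventually (gt_mem_nhds (show 0 < d / 2 by positivity)))).exists
  have hpη₀ : ∀ t, |p t - g x₀| < η₀ := fun t => by
    rw [← hκg]; exact (hpη t).trans_le (min_le_left _ _)
  -- the corrected function
  obtain ⟨ζ, hζ, hζper, hζeq⟩ := exists_periodic_extension
    (ψ := fun t => ψ (p (t - t₁)) - x₀) (a := t₁) (b := t₂) (T := 2 * Real.pi)
    (contDiff_iff_contDiffAt.2 fun t =>
      ((hψ _ (hpη₀ (t - t₁))).2.comp t
        (hp.comp (contDiff_id.sub contDiff_const)).contDiffAt).sub contDiffAt_const)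
    ht1 ht12 ht2 (fun t ht => by
      have : p (t - t₁) = κ ^ 2 := hpτ _ fun h => ht ⟨by linarith [h.1], by linarith [h.2]⟩
      simp only [this, hκg, hψ₀, sub_self])
  let φ : SmoothCircle := ⟨fun t => u n t + ζ t, (hu n).add hζ, (huper n).add hζper⟩
  have hφ : ContDiff ℝ ∞ φ.toFun := φ.smooth
  have hφper : Function.Periodic φ.toFun (2 * Real.pi) := φ.periodic
  have hin : ∀ t ∈ Icc t₁ t₂, g (φ.toFun t) = p (t - t₁) := fun t ht => by
    have h1 : φ.toFun t = ψ (p (t - t₁)) := by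
      change u n t + ζ t = _
      rw [hζeq t ⟨ht1.le.trans ht.1, ht.2.trans ht2.le⟩, hux₀ n t ht]
      ring
    rw [h1, (hψ _ (hpη₀ _)).1]
  have hout : ∀ t ∈ Icc 0 (2 * Real.pi), t ∉ Ioo t₁ t₂ → g (φ.toFun t) = g (u n t) :=
    fun t ht ht' => by
      have : p (t - t₁) = κ ^ 2 := hpτ _ fun h => ht' ⟨by linarith [h.1], by linarith [h.2]⟩
      change g (u n t + ζ t) = _
      rw [hζeq t ht, this, hκg, hψ₀, sub_self, add_zero]
  have hcloseη : ∀ t ∈ Icc 0 (2 * Real.pi), |g (φ.toFun t) - g (u n t)| ≤ η := fun t ht => by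
    by_cases h : t ∈ Ioo t₁ t₂
    · have h' := Ioo_subset_Icc_self h
      rw [hin t h', hux₀ n t h', ← hκg]
      exact (hpη _).le
    · rw [hout t ht h, sub_self, abs_zero]
      exact hηpos.le
  have hgφm : Measurable fun t => g (φ.toFun t) := (hg.continuous.comp hφ.continuous).measurable
  have hgφL : ∀ t, |g (φ.toFun t)| ≤ L₂ := fun t => by
    obtain ⟨s, hs, hst⟩ := hφper.exists_mem_Ico₀ (by positivity) t
    rw [hst]
    have h1 := hcloseη s (Ico_subset_Icc_self hs)
    have h2 := (hgL₁ _ (huB n s)).trans (le_max_right L L₁)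
    have h3 : η ≤ η₀ := min_le_left _ _
    have h4 := abs_sub_abs_le_abs_sub (g (φ.toFun s)) (g (u n s))
    linarith
  obtain ⟨Θ, hΘ⟩ := exists_isFundamentalMatrix hgφm hgφL
  have frame : ∀ M : SL(2, ℝ), M 0 0 = M 0 0 ∧ M 1 0 = M 1 0 ∧ M 0 1 = M 0 1 ∧ M 1 1 = M 1 1 :=
    fun M => ⟨rfl, rfl, rfl, rfl⟩
  have hypini : Real.cosh (κ * 0) = (1 : SL(2, ℝ)) 0 0 ∧ κ * Real.sinh (κ * 0) = (1 : SL(2, ℝ)) 1 0 ∧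
      Real.sinh (κ * 0) / κ = (1 : SL(2, ℝ)) 0 1 ∧ Real.cosh (κ * 0) = (1 : SL(2, ℝ)) 1 1 := by
    simp
  have hconst : Continuous fun _ : ℝ => κ ^ 2 := continuous_const
  have step₁ : Θ t₁ = Ψ n t₁ := by
    have := hΘ.propagate hgφm hgφL le_rfl ht1.le (by linarith)
      (fun t ht => (hout t ⟨ht.1, by linarith [ht.2]⟩ fun h => by linarith [h.1, ht.2]).symm)
      ((hΨ n).isSolOn₁.mono (hgum n) (hguL₂ n) le_rfl ht1.le (by linarith))
      ((hΨ n).isSolOn₂.mono (hgum n) (hguL₂ n) le_rfl ht1.le (by linarith))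
      (frame (Ψ n 0)) (frame (Ψ n t₁))
    rw [this, (hΨ n).initial, hΘ.initial]
    simp
  have step₂ : Θ t₂ = hypFlow κ hκ τ * K n * Θ t₁ := by
    have := hΘ.propagate hgφm hgφL ht1.le ht12.le ht2.le (fun t ht => (hin t ht).symm)
      ((hs₁.comp_sub t₁).isSolOn (hp.continuous.comp (continuous_sub_right t₁)) t₁ t₂)
      ((hs₂.comp_sub t₁).isSolOn (hp.continuous.comp (continuous_sub_right t₁)) t₁ t₂)
      (M := 1) (N := hypFlow κ hκ τ * K n) (by simpa using hini) (by rw [hτ21]; exact hfin)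
    rw [this]
    simp
  have step₃ : Ψ n t₂ = hypFlow κ hκ τ * Ψ n t₁ := by
    have := (hΨ n).propagate (hgum n) (hguL₂ n) ht1.le ht12.le ht2.le
      (fun t ht => by rw [hux₀ n t ht, hκg])
      (((isClassicalSol_cosh κ).comp_sub t₁).isSolOn hconst t₁ t₂)
      (((isClassicalSol_sinh hκ).comp_sub t₁).isSolOn hconst t₁ t₂)
      (M := 1) (N := hypFlow κ hκ τ) (by rw [sub_self]; exact hypini)
      (by rw [hτ21]; exact ⟨rfl, rfl, rfl, rfl⟩)
    rw [this]
    simp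
  have step₄ : Θ (2 * Real.pi) = Ψ n (2 * Real.pi) * (Ψ n t₂)⁻¹ * Θ t₂ :=
    hΘ.propagate hgφm hgφL (ht1.le.trans ht12.le) ht2.le le_rfl
      (fun t ht => (hout t ⟨by linarith [ht.1], ht.2⟩ fun h => by linarith [h.2, ht.1]).symm)
      ((hΨ n).isSolOn₁.mono (hgum n) (hguL₂ n) (ht1.le.trans ht12.le) ht2.le le_rfl)
      ((hΨ n).isSolOn₂.mono (hgum n) (hguL₂ n) (ht1.le.trans ht12.le) ht2.le le_rfl)
      (frame (Ψ n t₂)) (frame (Ψ n (2 * Real.pi)))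
  have hΘT : Θ (2 * Real.pi) = T := by
    rw [step₄, step₂, step₃, step₁]
    simp only [K]
    group
  have hΘangle : |totalAngle Θ - a 1| < 1 := by
    rw [← hΦA]
    refine hangle _ Θ hgφm hgφL hΘ ?_
    have hi : ∀ {h k : ℝ → ℝ} {l : ℝ}, Measurable h → Measurable k → (∀ t, |h t| ≤ l) →
        (∀ t, |k t| ≤ l) → IntervalIntegrable (fun t => |h t - k t|) volume 0 (2 * Real.pi) :=
      fun hh hk hl kl => ((intervalIntegrable_of_bounded hh hl _ _).sub
        (intervalIntegrable_of_bounded hk kl _ _)).abs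
    have h1 : ∫ s in (0 : ℝ)..2 * Real.pi, |g (φ.toFun s) - q s| ≤
        ∫ s in (0 : ℝ)..2 * Real.pi, (η + |g (u n s) - q s|) := by
      refine intervalIntegral.integral_mono_on (by positivity) (hi hgφm hq hgφL hqL₂)
        (intervalIntegrable_const.add (hi (hgum n) hq (hguL₂ n) hqL₂)) fun s hs => ?_
      have h2 := abs_sub_le (g (φ.toFun s)) (g (u n s)) (q s)
      have h3 := hcloseη s hs
      linarith
    rw [intervalIntegral.integral_add intervalIntegrable_const (hi (hgum n) hq (hguL₂ n) hqL₂),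
      intervalIntegral.integral_const, smul_eq_mul, sub_zero] at h1
    have h4 : 2 * Real.pi * η ≤ d / 2 := by
      calc 2 * Real.pi * η ≤ 2 * Real.pi * (d / (4 * Real.pi)) := by
            gcongr; exact min_le_right _ _
        _ = d / 2 := by field_simp; norm_num
    linarith
  refine ⟨φ, ?_, ?_⟩
  · intro q' hq'
    rw [monodromy_eq hgφm hgφL hq' hΘ]
    obtain ⟨b, hb, hb1⟩ := hΘ.exists_isRowAngle
    have hend : hΘ.path.1 1 = γ.1 1 := by
      change Θ (2 * Real.pi * (1 : I)) = T
      rw [← hΘT]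
      simp
    refine toG_eq_of_rowAngle hb ha hend ?_
    rw [← hb1] at hΘangle
    have hlt := abs_lt.1 hΘangle
    have hpi3 := Real.pi_gt_three
    have hr : √(γ.1 1 0 0 ^ 2 + γ.1 1 0 1 ^ 2) ≠ 0 := (Real.sqrt_pos.2 (row_sq_pos _)).ne'
    have e1 := hb.cos_eq 1
    have e2 := hb.sin_eq 1
    rw [hend] at e1 e2
    have hcos := mul_left_cancel₀ hr (e1.symm.trans (ha.cos_eq 1))
    have hsin := mul_left_cancel₀ hr (e2.symm.trans (ha.sin_eq 1))
    -- Equal endpoints make the row angles congruent modulo `2π`; being less than 1 apart, they are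
    -- equal.
    have h1 : Real.cos (b 1 - a 1) = 1 := by
      rw [Real.cos_sub, hcos, hsin]; linear_combination Real.sin_sq_add_cos_sq (a 1)
    have := (Real.cos_eq_one_iff_of_lt_of_lt (by linarith) (by linarith)).1 h1
    linarith
  · rintro ⟨c, hc⟩
    have hm₁ : t₁ ∈ Icc t₁ t₂ := ⟨le_rfl, ht12.le⟩
    -- At `t₁` the correction vanishes, so a constant value must be `x₀`. The potential is then
    -- `κ²`, and `T 0 0 = cosh (2πκ) > κ` contradicts the choice of `x₀`.
    have hc₀ : c = x₀ := by
      rw [← hc t₁ ⟨ht1.le, by linarith⟩]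
      change u n t₁ + ζ t₁ = x₀
      have : p (t₁ - t₁) = κ ^ 2 := hpτ _ fun h => by simpa using h.1
      rw [hζeq t₁ ⟨ht1.le, by linarith⟩, hux₀ n t₁ hm₁, this, hκg, hψ₀, sub_self, add_zero]
    have hT2 : Θ (2 * Real.pi) = hypFlow κ hκ (2 * Real.pi) := by
      have := hΘ.propagate hgφm hgφL le_rfl (by positivity) le_rfl
        (fun t ht => by rw [hc t ht, hc₀, hκg])
        ((isClassicalSol_cosh κ).isSolOn hconst 0 (2 * Real.pi))
        ((isClassicalSol_sinh hκ).isSolOn hconst 0 (2 * Real.pi))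
        (M := 1) (N := hypFlow κ hκ (2 * Real.pi)) hypini ⟨rfl, rfl, rfl, rfl⟩
      rw [this, hΘ.initial]
      simp
    have h00 : T 0 0 = Real.cosh (κ * (2 * Real.pi)) := by
      rw [← hΘT, hT2]; rfl
    have h1 : κ * (2 * Real.pi) ≤ Real.sinh (κ * (2 * Real.pi)) :=
      Real.self_le_sinh_iff.2 (by positivity)
    have h2 := Real.sinh_lt_cosh (κ * (2 * Real.pi))
    have hpi3 := Real.pi_gt_three
    have h3 : κ < T 0 0 := by
      rw [h00]
      exact (le_mul_of_one_le_right hκ.le (by linarith)).trans_lt (h1.trans_lt h2)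
    rw [← hκg] at hx₀
    exact (pow_lt_pow_left₀ h3 hκ.le two_ne_zero).not_gt hx₀

end SturmLiouville

theorem mainTheorem6 {X : Type*} [NormedAddCommGroup X] [NormedSpace ℝ X]
    (incl : X →L[ℝ] SturmLiouville.Linfty) (hX : SturmLiouville.IsSmoothing X incl)
    (f : ℝ → ℝ) (hf : ContDiff ℝ ∞ f) (hflat : SturmLiouville.NowhereFlat (deriv f))
    (hsurj : Function.Surjective (deriv f)) :
    Set.MapsTo (fun u : X => SturmLiouville.nonlinearMonodromy f (incl u))
        (SturmLiouville.nonconstant incl) SturmLiouville.G₀ ∧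
      Set.SurjOn (fun u : X => SturmLiouville.nonlinearMonodromy f (incl u))
        (SturmLiouville.nonconstant incl) SturmLiouville.G₀ := by
  have hf' : ContDiff ℝ ∞ (deriv f) := (contDiff_infty_iff_deriv.1 hf).2
  refine ⟨fun u _ => SturmLiouville.nonlinearMonodromy_mem_G₀ hf'.continuous (incl u),
    fun y hy => ?_⟩
  obtain ⟨φ, hφy, hφc⟩ := SturmLiouville.exists_smoothCircle_monodromy_eq hf' hsurj hy
  obtain ⟨j, -, hj⟩ := hX.smooth_incl
  have hpi : (0 : ℝ) < 2 * Real.pi := by positivity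
  refine ⟨j φ, ?_, ?_⟩
  · rintro ⟨c, hc⟩
    refine hφc ⟨c, fun t ht => ?_⟩
    -- By continuity, constancy almost everywhere on `[0, 2π]` becomes constancy at every point.
    exact MeasureTheory.Measure.eqOn_Icc_of_ae_eq _ hpi.ne ((hj φ).symm.trans hc)
      φ.smooth.continuous.continuousOn continuousOn_const ht
  · refine hφy _ ?_
    filter_upwards [hj φ] with t ht
    rw [ht]
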